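/- Let $U\subseteq\mathbb R^4$ be an open coordinate patch of spacetime and $G>0$. Let $g^{\alpha\beta}$ be the smooth contravariant components on $U$ of a metric of signature $(-,+,+,+)$, with $(g_{\alpha\beta})$ the inverse matrix, $g=\det(g_{\alpha\beta})$, Christoffel symbols $\Gamma^\lambda_{\mu\nu}$, Ricci tensor $R_{\alpha\beta}=\partial_\mu\Gamma^\mu_{\alpha\beta}-\partial_\beta\Gamma^\mu_{\alpha\mu}+\Gamma^\mu_{\mu\nu}\Gamma^\nu_{\alpha\beta}-\Gamma^\mu_{\beta\nu}\Gamma^\nu_{\alpha\mu}$ and scalar curvature $R=g^{\alpha\beta}R_{\alpha\beta}$. Let $u$ consist of finitely many smooth real scalar fields $\varphi_a$ and finitely many smooth covector fields $u_{b\alpha}$ on $U$ (either family may be empty), and let the matter Lagrangian $\mathcal L_M(g,u,\nabla u)$ be a smooth function of $g^{\alpha\beta}$, $u$ and $\nabla u$, where $\nabla_\mu\varphi_a=\partial_\mu\varphi_a$ and $\nabla_\mu u_{b\alpha}=\partial_\mu u_{b\alpha}-\Gamma^\lambda_{\mu\alpha}u_{b\lambda}$. Write $\Phi=(g^{\alpha\beta},u)$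 and consider $$A_\Omega=\int_\Omega d^4x\,L,\qquad L=L_G+L_M=\sqrt{-g}\,\Bigl[\tfrac1{16\pi G}R+\mathcal L_M(g,u,\nabla u)\Bigr],$$ where $\Omega$ is any bounded open region with $\overline\Omega\subset U$. For a Lagrangian $L(\Phi,\partial\Phi,\partial^2\Phi)$ and a field component $\Phi_a$ put $$\frac{\delta A}{\delta\Phi_a}=\frac{\partial L}{\partial\Phi_a}-\partial_\mu\frac{\partial L}{\partial\,\partial_\mu\Phi_a}+\partial_\mu\partial_\nu\frac{\partial L}{\partial\,\partial_\mu\partial_\nu\Phi_a};$$ derivatives with respect to the symmetric variables $g^{\alpha\beta}$ and $\partial_\mu\partial_\nu\Phi$ are normalized so that total variations are sums over all ordered index pairs. Let $\delta A_M/\delta g^{\alpha\beta}$ be this expression for $L_M$, and define $T_{\alpha\beta}=\dfrac{-2}{\sqrt{-g}}\dfrac{\delta A_M}{\delta g^{\alpha\beta}}$. Variations $\delta\Phi=(\delta g^{\alpha\beta},\delta u)$ are smooth on $U$, with $\delta g^{\alpha\beta}$ symmetric and $\delta g^{\alpha\beta}=0$, $\partial_\mu\delta g^{\alpha\beta}=0$,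 $\delta u=0$ on $\partial\Omega$. Then: 1. $R$, $L_G$ and $L_M$ are functions of $(\Phi,\partial\Phi,\partial^2\Phi)$ (given by the explicit coordinate formulas), and for every $\Omega$ and every variation $$\frac{d}{d\varepsilon}\Big|_{\varepsilon=0}A_\Omega[\Phi+\varepsilon\,\delta\Phi]=\int_\Omega d^4x\Bigl(\frac{\delta A}{\delta g^{\alpha\beta}}\delta g^{\alpha\beta}+\sum_a\frac{\delta A}{\delta\varphi_a}\delta\varphi_a+\sum_b\frac{\delta A}{\delta u_{b\alpha}}\delta u_{b\alpha}\Bigr).$$ 2. On $U$, for all $\alpha,\beta$, the following identity holds: $$\begin{aligned}0\equiv I={}&-R_{\alpha\beta}+\frac{\partial R}{\partial g^{\alpha\beta}}-\partial_\mu\frac{\partial R}{\partial\,\partial_\mu g^{\alpha\beta}}+\partial_\mu\partial_\nu\frac{\partial R}{\partial\,\partial_\mu\partial_\nu g^{\alpha\beta}}+\tfrac12 g_{\rho\sigma}\partial_\mu g^{\rho\sigma}\frac{\partial R}{\partial\,\partial_\mu g^{\alpha\beta}}\\&+\tfrac14 g_{\rho\sigma}\partial_\mu g^{\rho\sigma}g_{\xi\eta}\partial_\nu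 g^{\xi\eta}\frac{\partial R}{\partial\,\partial_\mu\partial_\nu g^{\alpha\beta}}-g_{\rho\sigma}\partial_\mu g^{\rho\sigma}\partial_\nu\frac{\partial R}{\partial\,\partial_\mu\partial_\nu g^{\alpha\beta}}\\&-\tfrac12 g_{\rho\sigma}\partial_\mu\partial_\nu g^{\rho\sigma}\frac{\partial R}{\partial\,\partial_\mu\partial_\nu g^{\alpha\beta}}+\tfrac12 g_{\rho\xi}g_{\sigma\eta}\partial_\mu g^{\rho\sigma}\partial_\nu g^{\xi\eta}\frac{\partial R}{\partial\,\partial_\mu\partial_\nu g^{\alpha\beta}}.\end{aligned}$$ 3. On $U$, $$\frac{\delta A}{\delta\varphi_a}=\sqrt{-g}\Bigl[\frac{\partial\mathcal L_M}{\partial\varphi_a}-\nabla_\mu\frac{\partial\mathcal L_M}{\partial\nabla_\mu\varphi_a}\Bigr],\qquad \frac{\delta A}{\delta u_{b\alpha}}=\sqrt{-g}\Bigl[\frac{\partial\mathcal L_M}{\partial u_{b\alpha}}-\nabla_\mu\frac{\partial\mathcal L_M}{\partial\nabla_\mu u_{b\alpha}}\Bigr],$$ $$\frac{\delta A}{\delta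 g^{\alpha\beta}}=\frac{\sqrt{-g}}{16\pi G}\Bigl[R_{\alpha\beta}-\tfrac12 g_{\alpha\beta}R-8\pi G\,T_{\alpha\beta}\Bigr].$$ 4. The action $A_\Omega$ is stationary at $\Phi$ for every $\Omega$ under all variations of the metric alone if and only if $R_{\alpha\beta}-\frac12g_{\alpha\beta}R=8\pi G\,T_{\alpha\beta}$ on $U$; under all variations of the matter fields alone if and only if, on $U$, $\frac{\partial\mathcal L_M}{\partial\varphi_a}-\nabla_\mu\frac{\partial\mathcal L_M}{\partial\nabla_\mu\varphi_a}=0$ for all $a$ and $\frac{\partial\mathcal L_M}{\partial u_{b\alpha}}-\nabla_\mu\frac{\partial\mathcal L_M}{\partial\nabla_\mu u_{b\alpha}}=0$ for all $b,\alpha$; and under all variations if and only if all of these field equations hold. -/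

import Mathlib

open scoped ContDiff

noncomputable section

namespace GR

/-- Coordinates `(x⁰, x¹, x², x³)` of a spacetime point in a coordinate patch. -/
abbrev Pt := Fin 4 → ℝ

/-- Values of the metric variable: the array of contravariant components `g^{αβ}`. -/
abbrev Met := Fin 4 → Fin 4 → ℝ

/-- Values of the matter field: real scalars `φ_a` (`a : ι`) and covector components `u_{b α}`
(`b : κ`). -/
abbrev Matter (ι κ : Type*) := (ι → ℝ) × (κ → Fin 4 → ℝ)

/-- Values of all dynamical variables: `(g^{αβ}, u)`. -/
abbrev Fields (ι κ : Type*) := Met × Matter ι κ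

/-- Values of `(Φ, ∂_μ Φ, ∂_μ ∂_ν Φ)` for a field `Φ` with values in `V`. -/
abbrev Jet (V : Type*) := V × (Fin 4 → V) × (Fin 4 → Fin 4 → V)

section Calculus

variable {V : Type*} [NormedAddCommGroup V] [NormedSpace ℝ V]

/-- The partial derivative `∂_μ f`. -/
def pd (m : Fin 4) (f : Pt → V) (x : Pt) : V := fderiv ℝ f x (Pi.single m 1)

/-- `(Φ(x), ∂Φ(x), ∂²Φ(x))`. -/
def jet (Φ : Pt → V) (x : Pt) : Jet V :=
  (Φ x, fun m => pd m Φ x, fun m n => pd m (pd n Φ) x)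

/-- `∂L/∂Φ` in the direction `w`. -/
def partial0 (L : Jet V → ℝ) (w : V) (j : Jet V) : ℝ :=
  deriv (fun t : ℝ => L (j.1 + t • w, j.2.1, j.2.2)) 0

/-- `∂L/∂(∂_μ Φ)` in the direction `w`. -/
def partial1 (L : Jet V → ℝ) (m : Fin 4) (w : V) (j : Jet V) : ℝ :=
  deriv (fun t : ℝ => L (j.1, j.2.1 + t • (Pi.single m w : Fin 4 → V), j.2.2)) 0

/-- `∂L/∂(∂_μ ∂_ν Φ)` in the direction `w`. The variables `∂_μ ∂_ν Φ` are symmetric in `μ, ν`, and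
the derivative is normalized so that `δL = ∑_{μ,ν} ∂L/∂(∂_μ ∂_ν Φ) δ∂_μ ∂_ν Φ`, the sum being over
all ordered pairs. -/
def partial2 (L : Jet V → ℝ) (m n : Fin 4) (w : V) (j : Jet V) : ℝ :=
  deriv (fun t : ℝ => L (j.1, j.2.1, j.2.2 +
    t • ((1 / 2 : ℝ) • (Pi.single m (Pi.single n w) + Pi.single n (Pi.single m w) :
      Fin 4 → Fin 4 → V)))) 0

/-- The Euler-Lagrange expression
`∂L/∂Φ - ∂_μ (∂L/∂(∂_μ Φ)) + ∂_μ ∂_ν (∂L/∂(∂_μ ∂_ν Φ))` of `∫ L(Φ, ∂Φ, ∂²Φ) d⁴x`, for the component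
of the field `Φ` given by the direction `w`. -/
def eulerLagrange (L : Jet V → ℝ) (Φ : Pt → V) (w : V) (x : Pt) : ℝ :=
  partial0 L w (jet Φ x)
    - ∑ m, pd m (fun y => partial1 L m w (jet Φ y)) x
    + ∑ m, ∑ n, pd m (pd n (fun y => partial2 L m n w (jet Φ y))) x

end Calculus

section Geometry

/-- The covariant components `g_{αβ}`: the inverse matrix of `g^{αβ}`. -/
def lower (h : Met) : Matrix (Fin 4) (Fin 4) ℝ := (Matrix.of h)⁻¹

/-- `√(-g)`, with `g = det (g_{αβ})`. -/
def sqrtNeg (h : Met) : ℝ := Real.sqrt (-(lower h).det)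

/-- `h` is symmetric, nondegenerate, of signature `(-,+,+,+)`. -/
def IsLorentzian (h : Met) : Prop :=
  ∃ P : Matrix (Fin 4) (Fin 4) ℝ, IsUnit P.det ∧
    Matrix.of h = P * Matrix.diagonal ![-1, 1, 1, 1] * P.transpose

/-- The direction of `g^{αβ}` in the space of symmetric arrays, normalized so that
`δF = ∑_{α,β} ∂F/∂g^{αβ} δg^{αβ}` over all ordered pairs, with `∂F/∂g^{αβ}` symmetric. -/
def symUnit (a b : Fin 4) : Met := fun i j =>
  ((if i = a ∧ j = b then 1 else 0) + (if i = b ∧ j = a then 1 else 0)) / 2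

/-- The Christoffel symbols `Γ^l_{mn}` of the metric with contravariant components `g`. -/
def christoffel (g : Pt → Met) (l m n : Fin 4) (x : Pt) : ℝ :=
  1 / 2 * ∑ s, g x l s * (pd m (fun y => lower (g y) s n) x + pd n (fun y => lower (g y) s m) x
    - pd s (fun y => lower (g y) m n) x)

/-- The Ricci tensor
`R_{ab} = ∂_m Γ^m_{ab} - ∂_b Γ^m_{am} + Γ^m_{mn} Γ^n_{ab} - Γ^m_{bn} Γ^n_{am}`. -/
def ricci (g : Pt → Met) (a b : Fin 4) (x : Pt) : ℝ :=
  ∑ m, (pd m (christoffel g m a b) x - pd b (christoffel g m a m) x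
    + ∑ n, (christoffel g m m n x * christoffel g n a b x
      - christoffel g m b n x * christoffel g n a m x))

/-- The scalar curvature `R = g^{ab} R_{ab}`. -/
def scalarCurvature (g : Pt → Met) (x : Pt) : ℝ := ∑ a, ∑ b, g x a b * ricci g a b x

/-- The covariant divergence `∇_m X^m` of a vector field. -/
def divVector (g : Pt → Met) (X : Fin 4 → Pt → ℝ) (x : Pt) : ℝ :=
  ∑ m, (pd m (X m) x + ∑ n, christoffel g m m n x * X n x)

/-- The covariant divergence `∇_m P^{ma}` of a contravariant 2-tensor field. -/
def divTensor (g : Pt → Met) (P : Fin 4 → Fin 4 → Pt → ℝ) (a : Fin 4) (x : Pt) : ℝ :=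
  ∑ m, (pd m (P m a) x + ∑ n, christoffel g m m n x * P n a x
    + ∑ n, christoffel g a m n x * P m n x)

/-! ### The same quantities as functions of `(g^{αβ}, ∂_μ g^{αβ}, ∂_μ ∂_ν g^{αβ})` -/

/-- `∂_m g_{ab}` in terms of `g^{αβ}` and `∂_m g^{αβ}`. -/
def dLowerJet (j : Jet Met) (m : Fin 4) : Matrix (Fin 4) (Fin 4) ℝ :=
  -(lower j.1 * Matrix.of (j.2.1 m) * lower j.1)

/-- `∂_m ∂_n g_{ab}` in terms of `g^{αβ}` and its derivatives. -/
def ddLowerJet (j : Jet Met) (m n : Fin 4) : Matrix (Fin 4) (Fin 4) ℝ :=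
  lower j.1 * Matrix.of (j.2.1 m) * lower j.1 * Matrix.of (j.2.1 n) * lower j.1
    + lower j.1 * Matrix.of (j.2.1 n) * lower j.1 * Matrix.of (j.2.1 m) * lower j.1
    - lower j.1 * Matrix.of (j.2.2 m n) * lower j.1

/-- `Γ^l_{mn}`. -/
def christoffelJet (j : Jet Met) (l m n : Fin 4) : ℝ :=
  1 / 2 * ∑ s, j.1 l s * (dLowerJet j m s n + dLowerJet j n s m - dLowerJet j s m n)

/-- `∂_k Γ^l_{mn}`. -/
def dChristoffelJet (j : Jet Met) (k l m n : Fin 4) : ℝ :=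
  1 / 2 * ∑ s, (j.2.1 k l s * (dLowerJet j m s n + dLowerJet j n s m - dLowerJet j s m n)
    + j.1 l s * (ddLowerJet j k m s n + ddLowerJet j k n s m - ddLowerJet j k s m n))

/-- `R_{ab}`. -/
def ricciJet (j : Jet Met) (a b : Fin 4) : ℝ :=
  ∑ m, (dChristoffelJet j m m a b - dChristoffelJet j b m a m
    + ∑ n, (christoffelJet j m m n * christoffelJet j n a b
      - christoffelJet j m b n * christoffelJet j n a m))

/-- `R`. -/
def scalarJet (j : Jet Met) : ℝ := ∑ a, ∑ b, j.1 a b * ricciJet j a b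

/-- The expression `I_{ab}`: the Euler-Lagrange expression of `√(-g) R` with respect to `g^{ab}`,
expanded and divided by `√(-g)`, plus `½ g_{ab} R`, minus `R_{ab}`. -/
def identityExpr (g : Pt → Met) (a b : Fin 4) (x : Pt) : ℝ :=
  let w := symUnit a b
  let R1 : Fin 4 → Pt → ℝ := fun m y => partial1 scalarJet m w (jet g y)
  let R2 : Fin 4 → Fin 4 → Pt → ℝ := fun m n y => partial2 scalarJet m n w (jet g y)
  let gl := lower (g x)
  let dg : Fin 4 → Met := fun m => pd m g x
  let ddg : Fin 4 → Fin 4 → Met := fun m n => pd m (pd n g) x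
  let tr : Fin 4 → ℝ := fun m => ∑ r, ∑ s, gl r s * dg m r s
  partial0 scalarJet w (jet g x) - ricci g a b x
    - ∑ m, pd m (R1 m) x
    + ∑ m, ∑ n, pd m (pd n (R2 m n)) x
    + 1 / 2 * ∑ m, tr m * R1 m x
    + 1 / 4 * ∑ m, ∑ n, tr m * tr n * R2 m n x
    - ∑ m, ∑ n, tr m * pd n (R2 m n) x
    - 1 / 2 * ∑ m, ∑ n, (∑ r, ∑ s, gl r s * ddg m n r s) * R2 m n x
    + 1 / 2 * ∑ m, ∑ n,
        (∑ r, ∑ s, ∑ p, ∑ q, gl r p * gl s q * dg m r s * dg n p q) * R2 m n x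

end Geometry

section Action

variable {ι κ : Type*}

/-- The covariant derivative `∇_m u` of the matter field: `∂_m φ_a` for the scalars and
`∂_m u_{bα} - Γ^l_{mα} u_{bl}` for the covectors. -/
def covDeriv (g : Pt → Met) (u : Pt → Matter ι κ) (x : Pt) (m : Fin 4) : Matter ι κ :=
  (fun a => pd m (fun y => (u y).1 a) x,
   fun b al => pd m (fun y => (u y).2 b al) x - ∑ l, christoffel g l m al x * (u x).2 b l)

/-- The arguments `(g, u, ∇u)` of the matter Lagrangian, along the fields `Φ = (g, u)`. -/
def matterArg (Φ : Pt → Fields ι κ) (x : Pt) : Met × Matter ι κ × (Fin 4 → Matter ι κ) :=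
  ((Φ x).1, (Φ x).2, covDeriv (fun y => (Φ y).1) (fun y => (Φ y).2) x)

/-- `A = ∫_Ω d⁴x √(-g) [R / (16πG) + 𝓛_M(g, u, ∇u)]`. -/
def action (G : ℝ) (LM : Met × Matter ι κ × (Fin 4 → Matter ι κ) → ℝ) (Ω : Set Pt)
    (Φ : Pt → Fields ι κ) : ℝ :=
  ∫ x in Ω, sqrtNeg (Φ x).1 *
    (1 / (16 * Real.pi * G) * scalarCurvature (fun y => (Φ y).1) x + LM (matterArg Φ x))

/-- The metric part of a jet of `Φ = (g, u)`. -/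
def metJet (j : Jet (Fields ι κ)) : Jet Met :=
  (j.1.1, fun m => (j.2.1 m).1, fun m n => (j.2.2 m n).1)

/-- `L_G = √(-g) R / (16πG)` as a function of `(Φ, ∂Φ, ∂²Φ)`. -/
def gravLagrangian (G : ℝ) (j : Jet (Fields ι κ)) : ℝ :=
  sqrtNeg j.1.1 * (1 / (16 * Real.pi * G) * scalarJet (metJet j))

/-- `L_M = √(-g) 𝓛_M(g, u, ∇u)` as a function of `(Φ, ∂Φ, ∂²Φ)`. -/
def matterLagrangian (LM : Met × Matter ι κ × (Fin 4 → Matter ι κ) → ℝ)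
    (j : Jet (Fields ι κ)) : ℝ :=
  sqrtNeg j.1.1 * LM (j.1.1, j.1.2, fun m =>
    ((j.2.1 m).2.1,
     fun b al => (j.2.1 m).2.2 b al - ∑ l, christoffelJet (metJet j) l m al * j.1.2.2 b l))

/-- `L = L_G + L_M`. -/
def totalLagrangian (G : ℝ) (LM : Met × Matter ι κ × (Fin 4 → Matter ι κ) → ℝ)
    (j : Jet (Fields ι κ)) : ℝ :=
  gravLagrangian G j + matterLagrangian LM j

/-- `∂𝓛_M/∂u` in the direction `w`, at `(g, u, ∇u)` along `Φ`. -/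
def matterPartial0 (LM : Met × Matter ι κ × (Fin 4 → Matter ι κ) → ℝ)
    (Φ : Pt → Fields ι κ) (w : Matter ι κ) (x : Pt) : ℝ :=
  deriv (fun t : ℝ =>
    LM ((matterArg Φ x).1, (matterArg Φ x).2.1 + t • w, (matterArg Φ x).2.2)) 0

/-- `∂𝓛_M/∂(∇_m u)` in the direction `w`, at `(g, u, ∇u)` along `Φ`. -/
def matterPartial1 (LM : Met × Matter ι κ × (Fin 4 → Matter ι κ) → ℝ)
    (Φ : Pt → Fields ι κ) (m : Fin 4) (w : Matter ι κ) (x : Pt) : ℝ :=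
  deriv (fun t : ℝ =>
    LM ((matterArg Φ x).1, (matterArg Φ x).2.1, (matterArg Φ x).2.2 +
      t • (Pi.single m w : Fin 4 → Matter ι κ))) 0

/-- The direction of `g^{αβ}` among all field components. -/
def metDir (a b : Fin 4) : Fields ι κ := (symUnit a b, 0)

/-- The direction of the scalar `φ_a` among the matter components. -/
def scalarDir [DecidableEq ι] (a : ι) : Matter ι κ := (Pi.single a 1, 0)

/-- The direction of `u_{bα}` among the matter components. -/
def vectorDir [DecidableEq κ] (b : κ) (al : Fin 4) : Matter ι κ :=
  (0, Pi.single b (Pi.single al 1))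

/-- The scalar expression `∂𝓛_M/∂φ_a - ∇_m (∂𝓛_M/∂(∇_m φ_a))`. -/
def scalarEq [DecidableEq ι] (LM : Met × Matter ι κ × (Fin 4 → Matter ι κ) → ℝ)
    (Φ : Pt → Fields ι κ) (a : ι) (x : Pt) : ℝ :=
  matterPartial0 LM Φ (scalarDir a) x
    - divVector (fun y => (Φ y).1) (fun m => matterPartial1 LM Φ m (scalarDir a)) x

/-- The vector expression `∂𝓛_M/∂u_{bα} - ∇_m (∂𝓛_M/∂(∇_m u_{bα}))`. -/
def vectorEq [DecidableEq κ] (LM : Met × Matter ι κ × (Fin 4 → Matter ι κ) → ℝ)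
    (Φ : Pt → Fields ι κ) (b : κ) (al : Fin 4) (x : Pt) : ℝ :=
  matterPartial0 LM Φ (vectorDir b al) x
    - divTensor (fun y => (Φ y).1) (fun m n => matterPartial1 LM Φ m (vectorDir b n)) al x

variable [Fintype ι] [Fintype κ]

/-- The energy-momentum tensor `T_{ab} = (-2/√(-g)) δA_M/δg^{ab}`. -/
def energyMomentum (LM : Met × Matter ι κ × (Fin 4 → Matter ι κ) → ℝ)
    (Φ : Pt → Fields ι κ) (a b : Fin 4) (x : Pt) : ℝ :=
  -2 / sqrtNeg (Φ x).1 * eulerLagrange (matterLagrangian LM) Φ (metDir a b) x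

/-- The Einstein tensor `R_{ab} - ½ g_{ab} R`. -/
def einstein (g : Pt → Met) (a b : Fin 4) (x : Pt) : ℝ :=
  ricci g a b x - 1 / 2 * lower (g x) a b * scalarCurvature g x

/-- `Φ = (g, u)` is a smooth field configuration on `U` with a Lorentzian metric. -/
structure IsConfiguration (U : Set Pt) (Φ : Pt → Fields ι κ) : Prop where
  smooth : ContDiffOn ℝ ∞ Φ U
  lorentzian : ∀ x ∈ U, IsLorentzian (Φ x).1

/-- `Ω` is a bounded region whose closure lies in `U`. -/
structure IsRegion (U Ω : Set Pt) : Prop where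
  isOpen : IsOpen Ω
  compact : IsCompact (closure Ω)
  subset : closure Ω ⊆ U

/-- `δΦ = (δg, δu)` is an admissible variation on `Ω`: smooth, `δg^{αβ}` symmetric, and on `∂Ω`
all of `δg`, `∂δg` and `δu` vanish. -/
structure IsVariation (U Ω : Set Pt) (δΦ : Pt → Fields ι κ) : Prop where
  smooth : ContDiffOn ℝ ∞ δΦ U
  symm : ∀ x ∈ U, ∀ a b, (δΦ x).1 a b = (δΦ x).1 b a
  boundary : ∀ x ∈ frontier Ω, δΦ x = 0
  boundary_deriv : ∀ x ∈ frontier Ω, ∀ m, pd m (fun y => (δΦ y).1) x = 0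

/-- The action on every region is stationary at `Φ` under the admissible variations with values
in `K`. -/
def StationaryAction (G : ℝ) (LM : Met × Matter ι κ × (Fin 4 → Matter ι κ) → ℝ) (U : Set Pt)
    (Φ : Pt → Fields ι κ) (K : Set (Fields ι κ)) : Prop :=
  ∀ (Ω : Set Pt) (δΦ : Pt → Fields ι κ), IsRegion U Ω → IsVariation U Ω δΦ →
    (∀ x, δΦ x ∈ K) →
    HasDerivAt (fun ε : ℝ => action G LM Ω (fun x => Φ x + ε • δΦ x)) 0 0

end Action

end GR

end

open GR

/-! Each Lagrangian is a function on jets `(Φ, ∂Φ, ∂²Φ)`, smooth on an open set, and one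
first-variation formula serves them all. Along `c • e` with `e` a constant direction, the Leibniz
rule gives pointwise `δL = E(L) c + ∂_m J^m`, with `E(L)` the Euler-Lagrange expression and `J` a
current linear in `c` and `∂c` (`fderiv_jet_smul_const`). The boundary of `Ω` is arbitrary, so the
divergence is integrated away by `integral_pd_eq_zero_of_frontier`, a divergence theorem for
functions vanishing on the boundary, proved by truncating small values. Together with
differentiation under the integral this is the variation formula; the fundamental lemma
`eq_zero_of_integral_mul_eq_zero` then turns stationarity into vanishing of `E(L)`.

The geometric core is `E(√(-g) R)`. Palatini's identity (`palatini_algebra`, `IsMetric.palatini`)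
says that `√(-g) g^{ab} δR_{ab}` is a divergence, so `δ(√(-g) R) = √(-g) (R_{ab} - ½ g_{ab} R)
δg^{ab}` up to a divergence. Comparing this with the general formula, for test functions supported
inside `Ω`, both divergences integrate to zero and `E(√(-g) R) = √(-g) (R_{ab} - ½ g_{ab} R)`
follows (`IsMetric.eulerLagrange_hilbertDensity`). No partial derivative of `R` is ever computed.

The identity `I = 0` is a corollary. Expanding `E(√(-g) R)` by the product rule, with `∂_m √(-g) =
-½ √(-g) g_{rs} ∂_m g^{rs}`, gives `√(-g) (I + R_{ab} - ½ g_{ab} R)`, and the value just found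
leaves `√(-g) I = 0`.

For matter, `∂_m √(-g) = √(-g) Γ^k_{km}` and the dependence of `∇u` on `u` through `-Γ u` combine
into the covariant divergence (`eulerLagrange_matter`).

One obstacle is the domain: symmetric arrays are not open among all arrays, and the matter
Lagrangian is smooth only over Lorentzian metrics. It is therefore replaced by `symLM`, its
composition with symmetrization, which is smooth on an open set by `isOpen_isLorentzian_symMet`.
Every derivative that occurs is along symmetric directions, so the replacement changes nothing
(`eulerLagrange_symLM`). -/

namespace GR

open Filter Topology

/-! ### Partial derivatives and jets of fields -/

section PartialDerivatives

variable {V W : Type*} [NormedAddCommGroup V] [NormedSpace ℝ V]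
  [NormedAddCommGroup W] [NormedSpace ℝ W]

theorem ContDiffOn.diffAt {E : Type*} [NormedAddCommGroup E] [NormedSpace ℝ E] {f : E → V}
    {U : Set E} (hf : ContDiffOn ℝ ∞ f U) (hU : IsOpen U) {x : E} (hx : x ∈ U) :
    DifferentiableAt ℝ f x :=
  (hf.contDiffAt (hU.mem_nhds hx)).differentiableAt (by simp)

theorem pd_congr {f g : Pt → V} {x : Pt} (h : f =ᶠ[𝓝 x] g) (m : Fin 4) : pd m f x = pd m g x := by
  unfold pd; rw [h.fderiv_eq]

theorem pd_congr_on {f g : Pt → V} {U : Set Pt} (hU : IsOpen U) (h : ∀ y ∈ U, f y = g y) {x : Pt}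
    (hx : x ∈ U) (m : Fin 4) : pd m f x = pd m g x :=
  pd_congr (eventually_of_mem (hU.mem_nhds hx) h) m

theorem ContDiffOn.pd {f : Pt → V} {U : Set Pt} (hf : ContDiffOn ℝ ∞ f U) (hU : IsOpen U)
    (m : Fin 4) : ContDiffOn ℝ ∞ (pd m f) U :=
  (hf.fderiv_of_isOpen hU (by simp)).clm_apply contDiffOn_const

theorem ContDiffOn.jet {f : Pt → V} {U : Set Pt} (hf : ContDiffOn ℝ ∞ f U) (hU : IsOpen U) :
    ContDiffOn ℝ ∞ (jet f) U :=
  hf.prodMk ((contDiffOn_pi.2 fun m => ContDiffOn.pd hf hU m).prodMk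
    (contDiffOn_pi.2 fun m => contDiffOn_pi.2 fun n =>
      ContDiffOn.pd (ContDiffOn.pd hf hU n) hU m))

theorem pd_const (m : Fin 4) (c : V) (x : Pt) : pd m (fun _ => c) x = 0 := by
  simp [pd]

theorem pd_add {f g : Pt → V} {x : Pt} (hf : DifferentiableAt ℝ f x) (hg : DifferentiableAt ℝ g x)
    (m : Fin 4) : pd m (fun y => f y + g y) x = pd m f x + pd m g x := by
  simp [pd, fderiv_fun_add hf hg]

theorem pd_sub {f g : Pt → V} {x : Pt} (hf : DifferentiableAt ℝ f x) (hg : DifferentiableAt ℝ g x)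
    (m : Fin 4) : pd m (fun y => f y - g y) x = pd m f x - pd m g x := by
  simp [pd, fderiv_fun_sub hf hg]

theorem pd_neg (f : Pt → V) (x : Pt) (m : Fin 4) : pd m (fun y => -f y) x = -pd m f x := by
  simp [pd, fderiv_fun_neg]

theorem pd_mul {f g : Pt → ℝ} {x : Pt} (hf : DifferentiableAt ℝ f x) (hg : DifferentiableAt ℝ g x)
    (m : Fin 4) : pd m (fun y => f y * g y) x = pd m f x * g x + f x * pd m g x := by
  simp [pd, fderiv_fun_mul hf hg]; ring

theorem pd_sum {I : Type*} {s : Finset I} {f : I → Pt → V} {x : Pt}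
    (hf : ∀ i ∈ s, DifferentiableAt ℝ (f i) x) (m : Fin 4) :
    pd m (fun y => ∑ i ∈ s, f i y) x = ∑ i ∈ s, pd m (f i) x := by
  simp [pd, fderiv_fun_sum hf]

theorem pd_const_smul {f : Pt → V} {x : Pt} (hf : DifferentiableAt ℝ f x) (c : ℝ) (m : Fin 4) :
    pd m (fun y => c • f y) x = c • pd m f x := by
  simp [pd, fderiv_fun_const_smul hf]

theorem pd_const_mul {f : Pt → ℝ} {x : Pt} (hf : DifferentiableAt ℝ f x) (c : ℝ) (m : Fin 4) :
    pd m (fun y => c * f y) x = c * pd m f x := pd_const_smul hf c m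

theorem pd_clm (ℓ : V →L[ℝ] W) {f : Pt → V} {x : Pt} (hf : DifferentiableAt ℝ f x) (m : Fin 4) :
    pd m (fun y => ℓ (f y)) x = ℓ (pd m f x) := by
  have := (ℓ.hasFDerivAt.comp x hf.hasFDerivAt).fderiv
  unfold pd
  rw [show (fun y => ℓ (f y)) = ⇑ℓ ∘ f from rfl, this]; rfl

/-- Schwarz's theorem. The space is general because it is also needed on `ℝ × Pt`, to exchange the
variation parameter with a coordinate. -/
theorem fderiv_apply_comm {E : Type*} [NormedAddCommGroup E] [NormedSpace ℝ E] {f : E → V}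
    {U : Set E} (hf : ContDiffOn ℝ ∞ f U) (hU : IsOpen U) {x : E} (hx : x ∈ U) (v w : E) :
    fderiv ℝ (fun y => fderiv ℝ f y v) x w = fderiv ℝ (fun y => fderiv ℝ f y w) x v := by
  have h1 : DifferentiableAt ℝ (fderiv ℝ f) x :=
    ContDiffOn.diffAt (hf.fderiv_of_isOpen hU (by simp)) hU hx
  have h2 : IsSymmSndFDerivAt ℝ f x :=
    (hf.contDiffAt (hU.mem_nhds hx)).isSymmSndFDerivAt (by
      simpa using WithTop.coe_le_coe.2 (le_top : (2 : ℕ∞) ≤ ⊤))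
  rw [fderiv_clm_apply h1 (differentiableAt_const _), fderiv_clm_apply h1 (differentiableAt_const _)]
  simpa using h2 w v

theorem pd_comm {f : Pt → V} {U : Set Pt} (hf : ContDiffOn ℝ ∞ f U) (hU : IsOpen U) {x : Pt}
    (hx : x ∈ U) (m n : Fin 4) : pd m (pd n f) x = pd n (pd m f) x :=
  fderiv_apply_comm hf hU hx _ _

theorem jet_congr {f g : Pt → V} {x : Pt} (h : f =ᶠ[𝓝 x] g) : jet f x = jet g x := by
  have h1 : ∀ n, pd n f =ᶠ[𝓝 x] pd n g := fun n =>
    h.eventually_nhds.mono fun y hy => pd_congr hy n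
  simp only [jet, h.self_of_nhds, pd_congr h, fun m n => pd_congr (h1 n) m]

theorem jet_clm (ℓ : V →L[ℝ] W) {f : Pt → V} {U : Set Pt} (hf : ContDiffOn ℝ ∞ f U)
    (hU : IsOpen U) {x : Pt} (hx : x ∈ U) :
    jet (fun y => ℓ (f y)) x
      = (ℓ (jet f x).1, fun m => ℓ ((jet f x).2.1 m), fun m n => ℓ ((jet f x).2.2 m n)) := by
  have h1 : ∀ n, ∀ y ∈ U, pd n (fun z => ℓ (f z)) y = ℓ (pd n f y) := fun n y hy =>
    pd_clm ℓ (ContDiffOn.diffAt hf hU hy) n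
  unfold jet
  ext1
  · rfl
  ext1
  · funext m; exact h1 m x hx
  · funext m n
    exact (pd_congr_on hU (h1 n) hx m).trans
      (pd_clm ℓ (ContDiffOn.diffAt (ContDiffOn.pd hf hU n) hU hx) m)

theorem jet_add_smul {f g : Pt → V} {U : Set Pt} (hf : ContDiffOn ℝ ∞ f U)
    (hg : ContDiffOn ℝ ∞ g U) (hU : IsOpen U) {x : Pt} (hx : x ∈ U) (t : ℝ) :
    jet (fun y => f y + t • g y) x = jet f x + t • jet g x := by
  have h1 : ∀ (n : Fin 4) {f g : Pt → V}, ContDiffOn ℝ ∞ f U → ContDiffOn ℝ ∞ g U →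
      ∀ y ∈ U, pd n (fun z => f z + t • g z) y = pd n f y + t • pd n g y := fun n f g hf hg y hy => by
    rw [pd_add (g := fun z => t • g z) (ContDiffOn.diffAt hf hU hy)
        ((ContDiffOn.diffAt hg hU hy).const_smul t),
      pd_const_smul (ContDiffOn.diffAt hg hU hy)]
  unfold jet
  ext1
  · rfl
  ext1
  · funext m; exact h1 m hf hg x hx
  · funext m n
    exact (pd_congr_on hU (h1 n hf hg) hx m).trans
      (h1 m (ContDiffOn.pd hf hU n) (ContDiffOn.pd hg hU n) x hx)

theorem jet_finset_sum {I : Type*} (s : Finset I) {f : I → Pt → V} {U : Set Pt}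
    (hf : ∀ i, ContDiffOn ℝ ∞ (f i) U) (hU : IsOpen U) {x : Pt} (hx : x ∈ U) :
    jet (fun y => ∑ i ∈ s, f i y) x = ∑ i ∈ s, jet (f i) x := by
  classical
  induction s using Finset.induction_on with
  | empty =>
    simp only [Finset.sum_empty]
    unfold jet
    simp only [pd_const]
    have : ∀ m : Fin 4, pd m (fun _ : Pt => (0 : V)) = fun _ => 0 := fun m => funext (pd_const m 0)
    simp only [this, pd_const]; rfl
  | insert a s ha ih =>
    simp only [Finset.sum_insert ha]
    have := jet_add_smul (hf a) (ContDiffOn.sum fun i _ => hf i : ContDiffOn ℝ ∞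
      (fun y => ∑ i ∈ s, f i y) U) hU hx 1
    simp only [one_smul] at this
    rw [this, ih]

end PartialDerivatives

/-! ### Partial derivatives of a Lagrangian and linearity of the Euler-Lagrange expression -/

section JetPartials

variable {V : Type*} [NormedAddCommGroup V] [NormedSpace ℝ V]

/-- The jet direction of a first derivative. -/
noncomputable def dir1 (m : Fin 4) (w : V) : Jet V := (0, Pi.single m w, 0)

/-- The symmetrized jet direction of a second derivative. -/
noncomputable def dir2 (m n : Fin 4) (w : V) : Jet V :=
  (0, 0, (1 / 2 : ℝ) • (Pi.single m (Pi.single n w) + Pi.single n (Pi.single m w)))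

/-- As derivatives along straight lines in jet space, the partials of two Lagrangians can be
compared with no differentiability assumption; `eulerLagrange_congr` relies on this. -/
theorem partial0_eq_line (L : Jet V → ℝ) (w : V) (j : Jet V) :
    partial0 L w j = deriv (fun t : ℝ => L (j + t • ((w, 0, 0) : Jet V))) 0 := by
  unfold partial0; congr 1; funext t; congr 1
  ext1 <;> [simp; (ext1 <;> simp)]

theorem partial1_eq_line (L : Jet V → ℝ) (m : Fin 4) (w : V) (j : Jet V) :
    partial1 L m w j = deriv (fun t : ℝ => L (j + t • dir1 m w)) 0 := by
  unfold partial1 dir1; congr 1; funext t; congr 1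
  ext1 <;> [simp; (ext1 <;> simp)]

theorem partial2_eq_line (L : Jet V → ℝ) (m n : Fin 4) (w : V) (j : Jet V) :
    partial2 L m n w j = deriv (fun t : ℝ => L (j + t • dir2 m n w)) 0 := by
  unfold partial2 dir2; congr 1; funext t; congr 1
  ext1 <;> [simp; (ext1 <;> simp)]

theorem hasDerivAt_line {E : Type*} [NormedAddCommGroup E] [NormedSpace ℝ E] {L : E → ℝ} {j : E}
    (h : DifferentiableAt ℝ L j) (v : E) :
    HasDerivAt (fun t : ℝ => L (j + t • v)) (fderiv ℝ L j v) 0 := by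
  have := (h.hasFDerivAt.hasLineDerivAt v)
  simpa [HasLineDerivAt] using this

theorem partial0_eq {L : Jet V → ℝ} {j : Jet V} (h : DifferentiableAt ℝ L j) (w : V) :
    partial0 L w j = fderiv ℝ L j (w, 0, 0) := by
  rw [partial0_eq_line, (hasDerivAt_line h _).deriv]

theorem partial1_eq {L : Jet V → ℝ} {j : Jet V} (h : DifferentiableAt ℝ L j) (m : Fin 4) (w : V) :
    partial1 L m w j = fderiv ℝ L j (dir1 m w) := by
  rw [partial1_eq_line, (hasDerivAt_line h _).deriv]

theorem partial2_eq {L : Jet V → ℝ} {j : Jet V} (h : DifferentiableAt ℝ L j) (m n : Fin 4) (w : V) :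
    partial2 L m n w j = fderiv ℝ L j (dir2 m n w) := by
  rw [partial2_eq_line, (hasDerivAt_line h _).deriv]

variable {L : Jet V → ℝ} {O : Set (Jet V)} {Φ : Pt → V} {U : Set Pt}

theorem contDiffOn_fderiv_jet (hL : ContDiffOn ℝ ∞ L O) (hO : IsOpen O)
    (hΦ : ContDiffOn ℝ ∞ Φ U) (hU : IsOpen U) (hj : ∀ x ∈ U, jet Φ x ∈ O) (v : Jet V) :
    ContDiffOn ℝ ∞ (fun y => fderiv ℝ L (jet Φ y) v) U :=
  ContDiffOn.clm_apply ((hL.fderiv_of_isOpen hO (by simp)).comp (ContDiffOn.jet hΦ hU) hj)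
    contDiffOn_const

theorem contDiffOn_partial0 (hL : ContDiffOn ℝ ∞ L O) (hO : IsOpen O)
    (hΦ : ContDiffOn ℝ ∞ Φ U) (hU : IsOpen U) (hj : ∀ x ∈ U, jet Φ x ∈ O) (w : V) :
    ContDiffOn ℝ ∞ (fun y => partial0 L w (jet Φ y)) U :=
  (contDiffOn_fderiv_jet hL hO hΦ hU hj (w, 0, 0)).congr fun y hy =>
    partial0_eq (ContDiffOn.diffAt hL hO (hj y hy)) w

theorem contDiffOn_partial1 (hL : ContDiffOn ℝ ∞ L O) (hO : IsOpen O)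
    (hΦ : ContDiffOn ℝ ∞ Φ U) (hU : IsOpen U) (hj : ∀ x ∈ U, jet Φ x ∈ O) (m : Fin 4) (w : V) :
    ContDiffOn ℝ ∞ (fun y => partial1 L m w (jet Φ y)) U :=
  (contDiffOn_fderiv_jet hL hO hΦ hU hj (dir1 m w)).congr fun y hy =>
    partial1_eq (ContDiffOn.diffAt hL hO (hj y hy)) m w

theorem contDiffOn_partial2 (hL : ContDiffOn ℝ ∞ L O) (hO : IsOpen O)
    (hΦ : ContDiffOn ℝ ∞ Φ U) (hU : IsOpen U) (hj : ∀ x ∈ U, jet Φ x ∈ O) (m n : Fin 4) (w : V) :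
    ContDiffOn ℝ ∞ (fun y => partial2 L m n w (jet Φ y)) U :=
  (contDiffOn_fderiv_jet hL hO hΦ hU hj (dir2 m n w)).congr fun y hy =>
    partial2_eq (ContDiffOn.diffAt hL hO (hj y hy)) m n w

theorem contDiffOn_eulerLagrange (hL : ContDiffOn ℝ ∞ L O) (hO : IsOpen O)
    (hΦ : ContDiffOn ℝ ∞ Φ U) (hU : IsOpen U) (hj : ∀ x ∈ U, jet Φ x ∈ O) (w : V) :
    ContDiffOn ℝ ∞ (eulerLagrange L Φ w) U := by
  refine ((contDiffOn_partial0 hL hO hΦ hU hj w).sub (ContDiffOn.sum fun m _ => ?_)).add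
    (ContDiffOn.sum fun m _ => ContDiffOn.sum fun n _ => ?_)
  · exact ContDiffOn.pd (contDiffOn_partial1 hL hO hΦ hU hj m w) hU m
  · exact ContDiffOn.pd (ContDiffOn.pd (contDiffOn_partial2 hL hO hΦ hU hj m n w) hU n) hU m

theorem partial2_comm (L : Jet V → ℝ) (m n : Fin 4) (w : V) (j : Jet V) :
    partial2 L m n w j = partial2 L n m w j := by
  unfold partial2; rw [add_comm (Pi.single m _)]

/-- The Euler-Lagrange expression only depends on the Lagrangian near the jets of the field, in
the directions used. -/
theorem eulerLagrange_congr {L L' : Jet V → ℝ} {w : V} (hU : IsOpen U)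
    (h0 : ∀ x ∈ U, ∀ t : ℝ, L (jet Φ x + t • ((w, 0, 0) : Jet V))
      = L' (jet Φ x + t • ((w, 0, 0) : Jet V)))
    (h1 : ∀ x ∈ U, ∀ (t : ℝ) (a : _) (b : _), L (jet Φ x + t • (0, a, b))
      = L' (jet Φ x + t • (0, a, b)))
    {x : Pt} (hx : x ∈ U) : eulerLagrange L Φ w x = eulerLagrange L' Φ w x := by
  unfold eulerLagrange
  have e0 : partial0 L w (jet Φ x) = partial0 L' w (jet Φ x) := by
    simp only [partial0_eq_line, h0 x hx]
  have e1 : ∀ m, ∀ y ∈ U, partial1 L m w (jet Φ y) = partial1 L' m w (jet Φ y) := fun m y hy => by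
    simp only [partial1_eq_line, dir1, h1 y hy]
  have e2 : ∀ m n, ∀ y ∈ U, partial2 L m n w (jet Φ y) = partial2 L' m n w (jet Φ y) :=
    fun m n y hy => by simp only [partial2_eq_line, dir2, h1 y hy]
  rw [e0, Finset.sum_congr rfl fun m _ => pd_congr_on hU (e1 m) hx m,
    Finset.sum_congr rfl fun m _ => Finset.sum_congr rfl fun n _ =>
      pd_congr_on hU (fun y hy => pd_congr_on hU (e2 m n) hy n) hx m]

theorem eulerLagrange_add {L L' : Jet V → ℝ} (hL : ContDiffOn ℝ ∞ L O) (hL' : ContDiffOn ℝ ∞ L' O)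
    (hO : IsOpen O) (hΦ : ContDiffOn ℝ ∞ Φ U) (hU : IsOpen U) (hj : ∀ x ∈ U, jet Φ x ∈ O) (w : V)
    {x : Pt} (hx : x ∈ U) :
    eulerLagrange (fun j => L j + L' j) Φ w x = eulerLagrange L Φ w x + eulerLagrange L' Φ w x := by
  have d : ∀ y ∈ U, DifferentiableAt ℝ L (jet Φ y) := fun y hy => ContDiffOn.diffAt hL hO (hj y hy)
  have d' : ∀ y ∈ U, DifferentiableAt ℝ L' (jet Φ y) := fun y hy =>
    ContDiffOn.diffAt hL' hO (hj y hy)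
  have dd : ∀ y ∈ U, DifferentiableAt ℝ (fun j => L j + L' j) (jet Φ y) := fun y hy =>
    (d y hy).add (d' y hy)
  have s1 := contDiffOn_partial1 hL hO hΦ hU hj
  have s1' := contDiffOn_partial1 hL' hO hΦ hU hj
  have s2 := contDiffOn_partial2 hL hO hΦ hU hj
  have s2' := contDiffOn_partial2 hL' hO hΦ hU hj
  have e0 : partial0 (fun j => L j + L' j) w (jet Φ x)
      = partial0 L w (jet Φ x) + partial0 L' w (jet Φ x) := by
    rw [partial0_eq (d x hx), partial0_eq (d' x hx), partial0_eq (dd x hx),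
      fderiv_fun_add (d x hx) (d' x hx)]; rfl
  have e1 : ∀ m, ∀ y ∈ U, partial1 (fun j => L j + L' j) m w (jet Φ y)
      = partial1 L m w (jet Φ y) + partial1 L' m w (jet Φ y) := fun m y hy => by
    rw [partial1_eq (d y hy), partial1_eq (d' y hy), partial1_eq (dd y hy),
      fderiv_fun_add (d y hy) (d' y hy)]; rfl
  have e2 : ∀ m n, ∀ y ∈ U, partial2 (fun j => L j + L' j) m n w (jet Φ y)
      = partial2 L m n w (jet Φ y) + partial2 L' m n w (jet Φ y) := fun m n y hy => by
    rw [partial2_eq (d y hy), partial2_eq (d' y hy), partial2_eq (dd y hy),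
      fderiv_fun_add (d y hy) (d' y hy)]; rfl
  have f1 : ∀ m, pd m (fun y => partial1 (fun j => L j + L' j) m w (jet Φ y)) x
      = pd m (fun y => partial1 L m w (jet Φ y)) x + pd m (fun y => partial1 L' m w (jet Φ y)) x :=
    fun m => (pd_congr_on hU (e1 m) hx m).trans
      (pd_add (ContDiffOn.diffAt (s1 m w) hU hx) (ContDiffOn.diffAt (s1' m w) hU hx) m)
  have f2 : ∀ m n, ∀ y ∈ U, pd n (fun y => partial2 (fun j => L j + L' j) m n w (jet Φ y)) y
      = pd n (fun y => partial2 L m n w (jet Φ y)) y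
        + pd n (fun y => partial2 L' m n w (jet Φ y)) y :=
    fun m n y hy => (pd_congr_on hU (e2 m n) hy n).trans
      (pd_add (ContDiffOn.diffAt (s2 m n w) hU hy) (ContDiffOn.diffAt (s2' m n w) hU hy) n)
  have f3 : ∀ m n, pd m (pd n (fun y => partial2 (fun j => L j + L' j) m n w (jet Φ y))) x
      = pd m (pd n (fun y => partial2 L m n w (jet Φ y))) x
        + pd m (pd n (fun y => partial2 L' m n w (jet Φ y))) x :=
    fun m n => (pd_congr_on hU (f2 m n) hx m).trans
      (pd_add (ContDiffOn.diffAt (ContDiffOn.pd (s2 m n w) hU n) hU hx)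
        (ContDiffOn.diffAt (ContDiffOn.pd (s2' m n w) hU n) hU hx) m)
  simp only [eulerLagrange, e0, f1, f3, Finset.sum_add_distrib]
  ring

theorem eulerLagrange_const_mul {L : Jet V → ℝ} (hL : ContDiffOn ℝ ∞ L O) 
    (hO : IsOpen O) (hΦ : ContDiffOn ℝ ∞ Φ U) (hU : IsOpen U) (hj : ∀ x ∈ U, jet Φ x ∈ O) (c : ℝ)
    (w : V) {x : Pt} (hx : x ∈ U) :
    eulerLagrange (fun j => c * L j) Φ w x = c * eulerLagrange L Φ w x := by
  have s1 := contDiffOn_partial1 hL hO hΦ hU hj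
  have s2 := contDiffOn_partial2 hL hO hΦ hU hj
  have e0 : ∀ j, partial0 (fun j => c * L j) w j = c * partial0 L w j := fun j => by
    simp only [partial0, deriv_const_mul_field]
  have e1 : ∀ m j, partial1 (fun j => c * L j) m w j = c * partial1 L m w j := fun m j => by
    simp only [partial1, deriv_const_mul_field]
  have e2 : ∀ m n j, partial2 (fun j => c * L j) m n w j = c * partial2 L m n w j :=
    fun m n j => by simp only [partial2, deriv_const_mul_field]
  simp only [eulerLagrange, e0, e1, e2]
  have f1 : ∀ m, pd m (fun y => c * partial1 L m w (jet Φ y)) x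
      = c * pd m (fun y => partial1 L m w (jet Φ y)) x := fun m =>
    pd_const_mul (ContDiffOn.diffAt (s1 m w) hU hx) c m
  have f3 : ∀ m n, pd m (pd n (fun y => c * partial2 L m n w (jet Φ y))) x
      = c * pd m (pd n (fun y => partial2 L m n w (jet Φ y))) x := fun m n =>
    (pd_congr_on hU (fun y hy => pd_const_mul (ContDiffOn.diffAt (s2 m n w) hU hy) c n) hx m).trans
      (pd_const_mul (ContDiffOn.diffAt (ContDiffOn.pd (s2 m n w) hU n) hU hx) c m)
  simp only [f1, f3, mul_add, mul_sub, Finset.mul_sum]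

end JetPartials

end GR

namespace GR

open Filter Topology MeasureTheory

/-! ### Divergence theorem, differentiation under the integral, fundamental lemma -/

section Integration

theorem IsRegion.subset' {U Ω : Set Pt} (hΩ : IsRegion U Ω) : Ω ⊆ U :=
  subset_closure.trans hΩ.subset

theorem IsRegion.integrableOn {U Ω : Set Pt} (hΩ : IsRegion U Ω) {f : Pt → ℝ}
    (hf : ContinuousOn f U) : IntegrableOn f Ω :=
  ((hf.mono hΩ.subset).integrableOn_compact hΩ.compact).mono_set subset_closure

/-- Integration by parts against the constant function `1`, whose derivative is zero. -/
theorem integral_pd_eq_zero_of_hasCompactSupport {f : Pt → ℝ} (hf : ContDiff ℝ 1 f)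
    (hs : HasCompactSupport f) (m : Fin 4) : ∫ x, pd m f x = 0 := by
  have hc : Continuous (pd m f) := (hf.continuous_fderiv (by simp)).clm_apply continuous_const
  have hs' : HasCompactSupport (pd m f) := by
    have := hs.fderiv_apply ℝ (Pi.single m (1 : ℝ) : Pt)
    exact this
  have := integral_mul_fderiv_eq_neg_fderiv_mul_of_integrable (μ := (volume : Measure Pt))
    (f := fun _ => (1 : ℝ)) (g := f) (v := Pi.single m (1 : ℝ)) (by simp)
    (by
      have h := hc.integrable_of_hasCompactSupport (μ := volume) hs'
      unfold pd at h
      simpa only [one_mul] using h)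
    (by simpa using hf.continuous.integrable_of_hasCompactSupport hs)
    (fun x _ => differentiableAt_const _) (fun x _ => hf.differentiable (by simp) x)
  simpa [pd] using this

/-- The gradient of a function vanishes almost everywhere on its zero set. -/
theorem ae_pd_eq_zero_of_eq_zero {s : Set Pt} (hs : MeasurableSet s) {f : Pt → ℝ}
    (hf : ∀ x ∈ s, DifferentiableAt ℝ f x) (h0 : ∀ x ∈ s, f x = 0) (m : Fin 4) :
    ∀ᵐ x ∂(volume.restrict s), pd m f x = 0 := by
  -- The estimate `ApproximatesLinearOn.norm_fderiv_sub_le` concerns self-maps, so `f` is made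
  -- `Pt`-valued along a fixed vector. On `s` the result is identically zero, hence approximated by
  -- the zero map with constant `0`, which forces its derivative to vanish almost everywhere.
  set e : ℝ →L[ℝ] Pt := ContinuousLinearMap.toSpanSingleton ℝ (fun _ => (1 : ℝ)) with he
  have happ : ApproximatesLinearOn (fun x => e (f x)) (0 : Pt →L[ℝ] Pt) s 0 := by
    intro x hx y hy
    simp [h0 x hx, h0 y hy]
  have hd : ∀ x ∈ s, HasFDerivWithinAt (fun x => e (f x)) (e.comp (fderiv ℝ f x)) s x :=
    fun x hx => (e.hasFDerivAt.comp x (hf x hx).hasFDerivAt).hasFDerivWithinAt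
  filter_upwards [happ.norm_fderiv_sub_le volume hs _ hd] with x hx
  have h1 : e.comp (fderiv ℝ f x) = 0 := by
    have : ‖e.comp (fderiv ℝ f x) - 0‖₊ = 0 := le_antisymm hx bot_le
    simpa using this
  have h2 := congrFun (DFunLike.congr_fun h1 (Pi.single m (1 : ℝ))) 0
  simpa [he, pd] using h2

/-- A smooth truncation `s ↦ s (1 - b s)` with `b = 1` near `0` and `b = 0` far from `0`. -/
theorem exists_truncation : ∃ (ψ : ℝ → ℝ) (C : ℝ), ContDiff ℝ 1 ψ ∧ (∀ t, |t| ≤ 1 → ψ t = 0) ∧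
    (∀ t, 2 < |t| → ψ t = t) ∧ ∀ t, |deriv ψ t| ≤ C := by
  let b : ContDiffBump (0 : ℝ) := ⟨1, 2, one_pos, one_lt_two⟩
  have hb : ContDiff ℝ 1 (b : ℝ → ℝ) := b.contDiff
  have hψ : ContDiff ℝ 1 fun t => t - t * b t := contDiff_id.sub (contDiff_id.mul hb)
  have hsupp : HasCompactSupport fun t => t * b t := b.hasCompactSupport.mul_left
  have hdb : ContDiff ℝ 1 fun t => t * b t := contDiff_id.mul hb
  obtain ⟨C, hC⟩ := (hdb.continuous_deriv le_rfl).bounded_above_of_compact_support hsupp.deriv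
  refine ⟨fun t => t - t * b t, 1 + C, hψ, fun t ht => ?_, fun t ht => ?_, fun t => ?_⟩
  · have : b t = 1 := b.one_of_mem_closedBall (by simpa using ht)
    simp [this]
  · have : b t = 0 := b.zero_of_le_dist (by simpa using ht.le)
    simp [this]
  · rw [deriv_fun_sub differentiableAt_fun_id (hdb.differentiable one_ne_zero t)]
    have h1 := hC t
    rw [Real.norm_eq_abs] at h1
    simp only [deriv_id'']
    calc |1 - deriv (fun t => t * b t) t| ≤ |(1 : ℝ)| + |deriv (fun t => t * b t) t| := abs_sub _ _
      _ ≤ 1 + C := by rw [abs_one]; linarith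

/-- The divergence theorem on an arbitrary bounded open region, for a function vanishing on the
boundary. -/
theorem integral_pd_eq_zero_of_frontier {U Ω : Set Pt} (hU : IsOpen U) (hΩ : IsRegion U Ω)
    {f : Pt → ℝ} (hf : ContDiffOn ℝ ∞ f U) (h0 : ∀ x ∈ frontier Ω, f x = 0) (m : Fin 4) :
    ∫ x in Ω, pd m f x = 0 := by
  obtain ⟨ψ, C, hψ, hψ0, hψ1, hψC⟩ := exists_truncation
  have hfd : ∀ x ∈ U, DifferentiableAt ℝ f x := fun x hx => ContDiffOn.diffAt hf hU hx
  have hfc : ContinuousOn (pd m f) U := (ContDiffOn.pd hf hU m).continuousOn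
  have hΩm : MeasurableSet Ω := hΩ.isOpen.measurableSet
  -- the truncated functions
  let ψk : ℕ → ℝ → ℝ := fun k t => ψ ((k + 1) * t) / (k + 1)
  have hψk : ∀ k, ContDiff ℝ 1 (ψk k) := fun k =>
    (hψ.comp (contDiff_const.mul contDiff_id)).div_const _
  have hψk' : ∀ k t, deriv (ψk k) t = deriv ψ ((k + 1) * t) := by
    intro k t
    have h1 : HasDerivAt (fun t : ℝ => ((k : ℝ) + 1) * t) ((k : ℝ) + 1) t := by
      simpa using (hasDerivAt_id t).const_mul ((k : ℝ) + 1)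
    have h2 : HasDerivAt ψ (deriv ψ ((k + 1) * t)) ((k + 1) * t) :=
      (hψ.differentiable one_ne_zero _).hasDerivAt
    have h3 := ((h2.comp t h1).div_const ((k : ℝ) + 1)).deriv
    rw [mul_div_cancel_right₀ _ (by positivity : ((k : ℝ) + 1) ≠ 0)] at h3
    exact h3
  let F : ℕ → Pt → ℝ := fun k => Ω.indicator fun x => ψk k (f x)
  have hcomp : ∀ k, ∀ x ∈ U, ContDiffAt ℝ 1 (fun x => ψk k (f x)) x := fun k x hx =>
    (hψk k).contDiffAt.comp x ((hf.contDiffAt (hU.mem_nhds hx)).of_le (by simp))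
  have hin : ∀ k, ∀ x ∈ Ω, F k =ᶠ[𝓝 x] fun x => ψk k (f x) := fun k x hx =>
    eventually_of_mem (hΩ.isOpen.mem_nhds hx) fun y hy => Set.indicator_of_mem hy _
  -- Near a frontier point `|(k + 1) f| < 1` by continuity, and there `ψ` vanishes. So the extension
  -- by zero is `C¹` across the boundary, however irregular it is.
  have hout : ∀ k, ∀ x ∉ Ω, F k =ᶠ[𝓝 x] fun _ => 0 := by
    intro k x hx
    by_cases hxc : x ∈ closure Ω
    · have hxf : x ∈ frontier Ω := by rw [hΩ.isOpen.frontier_eq]; exact ⟨hxc, hx⟩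
      have hcont : Tendsto (fun y => |((k : ℝ) + 1) * f y|) (𝓝 x) (𝓝 0) := by
        have := ((hfd x (hΩ.subset hxc)).continuousAt.const_mul ((k : ℝ) + 1)).abs
        unfold ContinuousAt at this
        simpa [h0 x hxf] using this
      filter_upwards [hcont.eventually (gt_mem_nhds one_pos)] with y hy
      by_cases hyΩ : y ∈ Ω
      · simp [F, Set.indicator_of_mem hyΩ, ψk, hψ0 _ hy.le]
      · simp [F, Set.indicator_of_notMem hyΩ]
    · filter_upwards [isClosed_closure.isOpen_compl.mem_nhds hxc] with y hy
      exact Set.indicator_of_notMem (fun h => hy (subset_closure h)) _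
  have hFC : ∀ k, ContDiff ℝ 1 (F k) := fun k => contDiff_iff_contDiffAt.2 fun x => by
    by_cases hx : x ∈ Ω
    · exact (hcomp k x (hΩ.subset' hx)).congr_of_eventuallyEq (hin k x hx)
    · exact contDiffAt_const.congr_of_eventuallyEq (hout k x hx)
  have hFs : ∀ k, HasCompactSupport (F k) := fun k =>
    HasCompactSupport.intro hΩ.compact fun x hx =>
      Set.indicator_of_notMem (fun h => hx (subset_closure h)) _
  have hpd : ∀ k, ∀ x ∈ Ω, pd m (F k) x = deriv ψ ((k + 1) * f x) * pd m f x := by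
    intro k x hx
    rw [pd_congr (hin k x hx)]
    have h1 : HasDerivAt (ψk k) (deriv ψ ((k + 1) * f x)) (f x) := by
      rw [← hψk']; exact ((hψk k).differentiable one_ne_zero _).hasDerivAt
    have := (h1.comp_hasFDerivAt x (hfd x (hΩ.subset' hx)).hasFDerivAt).fderiv
    unfold pd
    rw [show (fun x => ψk k (f x)) = ψk k ∘ f from rfl, this]; simp
  have hint : ∀ k : ℕ, ∫ x in Ω, deriv ψ ((k + 1) * f x) * pd m f x = 0 := by
    intro k
    rw [← integral_pd_eq_zero_of_hasCompactSupport (hFC k) (hFs k) m,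
      ← setIntegral_congr_fun hΩm (hpd k)]
    refine setIntegral_eq_integral_of_forall_compl_eq_zero fun x hx => ?_
    rw [pd_congr (hout k x hx), pd_const]
  -- passage to the limit
  have hae : ∀ᵐ x ∂(volume.restrict Ω), f x = 0 → pd m f x = 0 := by
    have hS : MeasurableSet (Ω ∩ f ⁻¹' {0}) := by
      have hc : ContinuousOn f Ω := hf.continuousOn.mono hΩ.subset'
      have : MeasurableSet (Ω ∩ f ⁻¹' {0}ᶜ) :=
        (hc.isOpen_inter_preimage hΩ.isOpen isOpen_compl_singleton).measurableSet
      have e : Ω ∩ f ⁻¹' {0} = Ω \ (Ω ∩ f ⁻¹' {0}ᶜ) := by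
        ext x; by_cases hx : f x = 0 <;> simp [hx]
      rw [e]; exact hΩm.diff this
    have := ae_pd_eq_zero_of_eq_zero hS (fun x hx => hfd x (hΩ.subset' hx.1)) (fun x hx => hx.2) m
    rw [ae_restrict_iff' hS] at this
    rw [ae_restrict_iff' hΩm]
    filter_upwards [this] with x hx h1 h2 using hx ⟨h1, h2⟩
  have hdψ : Continuous (deriv ψ) := hψ.continuous_deriv le_rfl
  -- Where `f ≠ 0` the factor `ψ'((k + 1) f)` is eventually `1`; where `f = 0` the integrand and its
  -- limit both vanish almost everywhere. The bound on `ψ'` supplies the dominating function.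
  have hlim : Tendsto (fun k : ℕ => ∫ x in Ω, deriv ψ ((k + 1) * f x) * pd m f x) atTop
      (𝓝 (∫ x in Ω, pd m f x)) := by
    refine tendsto_integral_of_dominated_convergence (fun x => C * |pd m f x|) (fun k => ?_)
      ((hΩ.integrableOn hfc).abs.const_mul C) (fun k => ?_) ?_
    · refine ContinuousOn.aestronglyMeasurable ?_ hΩm
      exact (hdψ.comp_continuousOn (continuousOn_const.mul
        (hf.continuousOn.mono hΩ.subset'))).mul (hfc.mono hΩ.subset')
    · refine Eventually.of_forall fun x => ?_
      rw [norm_mul, Real.norm_eq_abs, Real.norm_eq_abs]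
      exact mul_le_mul_of_nonneg_right (hψC _) (abs_nonneg _)
    · filter_upwards [hae] with x hx
      by_cases h : f x = 0
      · simp [hx h]
      · refine tendsto_const_nhds.congr' ?_
        have hbig : Tendsto (fun k : ℕ => ((k : ℝ) + 1) * |f x|) atTop atTop :=
          (tendsto_atTop_add_const_right _ _ tendsto_natCast_atTop_atTop).atTop_mul_const
            (abs_pos.2 h)
        filter_upwards [hbig.eventually_gt_atTop 2] with k hk
        have hk' : 2 < |((k : ℝ) + 1) * f x| := by
          rwa [abs_mul, abs_of_pos (by positivity : (0 : ℝ) < (k : ℝ) + 1)]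
        have : ψ =ᶠ[𝓝 (((k : ℝ) + 1) * f x)] fun t => t :=
          eventually_of_mem ((isOpen_lt continuous_const continuous_abs).mem_nhds hk')
            fun t ht => hψ1 t ht
        rw [this.deriv_eq]; simp
  simp only [hint] at hlim
  exact (tendsto_nhds_unique hlim tendsto_const_nhds)

/-- Differentiation under the integral over a bounded region. -/
theorem hasDerivAt_setIntegral {Ω : Set Pt} (hΩ : IsOpen Ω) (hΩc : IsCompact (closure Ω))
    {N : Set (ℝ × Pt)} (hN : IsOpen N) {F : ℝ × Pt → ℝ} (hF : ContDiffOn ℝ ∞ F N)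
    (hsub : ∀ x ∈ closure Ω, ((0 : ℝ), x) ∈ N) :
    HasDerivAt (fun ε => ∫ x in Ω, F (ε, x)) (∫ x in Ω, fderiv ℝ F (0, x) (1, 0)) 0 := by
  have hF' : ContinuousOn (fun q => fderiv ℝ F q (1, 0)) N :=
    (hF.continuousOn_fderiv_of_isOpen hN (by simp)).clm_apply continuousOn_const
  have hev : ∀ᶠ ε in 𝓝 (0 : ℝ), ∀ x ∈ closure Ω, (ε, x) ∈ N :=
    hΩc.eventually_forall_of_forall_eventually fun x hx => hN.mem_nhds (hsub x hx)
  obtain ⟨δ, hδ, hδN⟩ := Metric.eventually_nhds_iff_ball.1 hev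
  -- Halving the radius makes the parameter range compact, which yields one bound for the
  -- `ε`-derivative over all of `closure Ω`.
  have hK : IsCompact (Metric.closedBall (0 : ℝ) (δ / 2) ×ˢ closure Ω) :=
    (isCompact_closedBall _ _).prod hΩc
  have hKN : Metric.closedBall (0 : ℝ) (δ / 2) ×ˢ closure Ω ⊆ N := fun q hq =>
    hδN q.1 (Metric.closedBall_subset_ball (by linarith) hq.1) q.2 hq.2
  obtain ⟨C, hC⟩ := hK.exists_bound_of_continuousOn (hF'.mono hKN)
  have hslice : ∀ ε ∈ Metric.ball (0 : ℝ) δ, Set.MapsTo (fun x => (ε, x)) Ω N := fun ε hε x hx =>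
    hδN ε hε x (subset_closure hx)
  have hcs : ∀ ε : ℝ, ContinuousOn (fun x : Pt => (ε, x)) Ω := fun ε =>
    continuousOn_const.prodMk continuousOn_id
  have hfin : volume Ω < ⊤ := (measure_mono subset_closure).trans_lt hΩc.measure_lt_top
  refine (hasDerivAt_integral_of_dominated_loc_of_deriv_le (μ := volume.restrict Ω)
    (F := fun ε x => F (ε, x)) (F' := fun ε x => fderiv ℝ F (ε, x) (1, 0)) (x₀ := (0 : ℝ))
    (bound := fun _ => C) (s := Metric.ball 0 (δ / 2))
    (Metric.ball_mem_nhds _ (by positivity)) ?_ ?_ ?_ ?_ ?_ ?_).2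
  · filter_upwards [Metric.ball_mem_nhds (0 : ℝ) hδ] with ε hε
    exact (hF.continuousOn.comp (hcs ε) (hslice ε hε)).aestronglyMeasurable hΩ.measurableSet
  · have : ContinuousOn (fun x => F (0, x)) (closure Ω) :=
      hF.continuousOn.comp (by fun_prop) fun x hx => hsub x hx
    exact (this.integrableOn_compact hΩc).mono_set subset_closure
  · exact (hF'.comp (hcs 0) (hslice 0 (Metric.mem_ball_self hδ))).aestronglyMeasurable
      hΩ.measurableSet
  · filter_upwards [ae_restrict_mem hΩ.measurableSet] with x hx ε hε
    exact hC (ε, x) ⟨Metric.ball_subset_closedBall hε, subset_closure hx⟩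
  · exact integrableOn_const hfin.ne
  · filter_upwards [ae_restrict_mem hΩ.measurableSet] with x hx ε hε
    have hm : (ε, x) ∈ N := hKN ⟨Metric.ball_subset_closedBall hε, subset_closure hx⟩
    have h1 : HasDerivAt (fun ε : ℝ => (ε, x)) ((1 : ℝ), (0 : Pt)) ε :=
      (hasDerivAt_id ε).prodMk (hasDerivAt_const ε x)
    exact (ContDiffOn.diffAt hF hN hm).hasFDerivAt.comp_hasDerivAt ε h1

/-- The fundamental lemma of the calculus of variations. -/
theorem eq_zero_of_integral_mul_eq_zero {U : Set Pt} (hU : IsOpen U) {f : Pt → ℝ}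
    (hf : ContinuousOn f U)
    (h : ∀ (c : Pt → ℝ) (Ω : Set Pt), ContDiff ℝ ∞ c → IsRegion U Ω → tsupport c ⊆ Ω →
      ∫ x in Ω, f x * c x = 0) : ∀ x ∈ U, f x = 0 := by
  have hae : ∀ᵐ x ∂(volume : Measure Pt), x ∈ U → f x = 0 := by
    refine hU.ae_eq_zero_of_integral_contDiff_smul_eq_zero
      (hf.locallyIntegrableOn hU.measurableSet) fun c hc hcs hcU => ?_
    -- A precompact open set between the support of `c` and `U` serves as the region.
    obtain ⟨Ω, h1, h2, h3, h4⟩ := exists_open_between_and_isCompact_closure hcs hU hcU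
    rw [← h c Ω hc ⟨h1, h4, h3⟩ h2, ← setIntegral_eq_integral_of_forall_compl_eq_zero (s := Ω)]
    · simp [mul_comm]
    · intro x hx
      rw [image_eq_zero_of_notMem_tsupport fun hh => hx (h2 hh), zero_smul]
  have hae' : f =ᵐ[volume.restrict U] fun _ => 0 := by
    rw [EventuallyEq, ae_restrict_iff' hU.measurableSet]; exact hae
  exact Measure.eqOn_open_of_ae_eq hae' hU hf continuousOn_const

end Integration

end GR

namespace GR

open Filter Topology MeasureTheory

/-! ### The first variation of a second-order action -/

section FirstVariation

variable {V : Type*} [NormedAddCommGroup V] [NormedSpace ℝ V]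
variable {L : Jet V → ℝ} {O : Set (Jet V)} {Φ δΦ : Pt → V} {U : Set Pt}

theorem jet_smul_const {c : Pt → ℝ} (hc : ContDiffOn ℝ ∞ c U) (hU : IsOpen U) {x : Pt} (hx : x ∈ U)
    (e : V) : jet (fun y => c y • e) x = (c x • e, fun m => pd m c x • e,
      fun m n => pd m (pd n c) x • e) :=
  jet_clm (ContinuousLinearMap.toSpanSingleton ℝ e) hc hU hx

/-- The symmetrized directions `dir2` lose nothing: the Hessian of `c` is symmetric, so the halves
coming from `(m, n)` and `(n, m)` recombine to the full second derivative. -/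
theorem jet_smul_const_eq_sum {c : Pt → ℝ} (hc : ContDiffOn ℝ ∞ c U) (hU : IsOpen U) {x : Pt}
    (hx : x ∈ U) (e : V) :
    jet (fun y => c y • e) x = c x • ((e, 0, 0) : Jet V) + ∑ m, pd m c x • dir1 m e
      + ∑ m, ∑ n, pd m (pd n c) x • dir2 m n e := by
  rw [jet_smul_const hc hU hx]
  have hs : ∀ m n, pd m (pd n c) x = pd n (pd m c) x := fun m n => pd_comm hc hU hx m n
  ext1
  · simp [dir1, dir2, Prod.fst_sum]
  ext1
  · funext k
    simp [dir1, dir2, Prod.fst_sum, Prod.snd_sum, Finset.sum_apply, Pi.single_apply]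
  · funext k l
    simp only [dir1, dir2, Prod.snd_add, Prod.smul_snd, Prod.snd_sum, smul_zero,
      Finset.sum_const_zero, add_zero, Finset.sum_apply, Pi.zero_apply, zero_add, Pi.smul_apply, Pi.add_apply,
      Pi.single_apply, smul_add, Finset.sum_add_distrib]
    have h1 : ∑ m, ∑ n, pd m (pd n c) x • (1 / 2 : ℝ) •
        (if k = m then (fun i => if i = n then e else 0 : Fin 4 → V) else 0) l
        = (1 / 2 * pd k (pd l c) x) • e := by
      rw [Finset.sum_eq_single k, Finset.sum_eq_single l]
      · simp [smul_smul, mul_comm]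
      · intro b _ hb; simp [hb.symm]
      · simp
      · intro b _ hb; simp [hb.symm]
      · simp
    have h2 : ∑ m, ∑ n, pd m (pd n c) x • (1 / 2 : ℝ) •
        (if k = n then (fun i => if i = m then e else 0 : Fin 4 → V) else 0) l
        = (1 / 2 * pd k (pd l c) x) • e := by
      rw [Finset.sum_eq_single l, Finset.sum_eq_single k]
      · simp [smul_smul, mul_comm, hs l k]
      · intro b _ hb; simp [hb.symm]
      · simp
      · exact fun b _ hb => Finset.sum_eq_zero fun n _ => by by_cases h : k = n <;> simp [h, hb.symm]
      · simp
    have h3 : ∀ m n : Fin 4, (Pi.single n e : Fin 4 → V) = fun i => if i = n then e else 0 :=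
      fun m n => by funext i; simp [Pi.single_apply]
    simp only [h3 0]
    rw [h1, h2, ← add_smul]
    congr 1; ring

/-- The boundary current of the first variation in the direction `e` with coefficient `c`. -/
noncomputable def variationCurrent (L : Jet V → ℝ) (Φ : Pt → V) (e : V) (c : Pt → ℝ) (m : Fin 4) (x : Pt) : ℝ :=
  partial1 L m e (jet Φ x) * c x
    + ∑ n, (partial2 L m n e (jet Φ x) * pd n c x
      - c x * pd n (fun y => partial2 L m n e (jet Φ y)) x)

theorem contDiffOn_variationCurrent (hL : ContDiffOn ℝ ∞ L O) (hO : IsOpen O)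
    (hΦ : ContDiffOn ℝ ∞ Φ U) (hU : IsOpen U) (hj : ∀ x ∈ U, jet Φ x ∈ O) (e : V)
    {c : Pt → ℝ} (hc : ContDiffOn ℝ ∞ c U) (m : Fin 4) :
    ContDiffOn ℝ ∞ (variationCurrent L Φ e c m) U :=
  ((contDiffOn_partial1 hL hO hΦ hU hj m e).mul hc).add (ContDiffOn.sum fun n _ =>
    ((contDiffOn_partial2 hL hO hΦ hU hj m n e).mul (ContDiffOn.pd hc hU n)).sub
      (hc.mul (ContDiffOn.pd (contDiffOn_partial2 hL hO hΦ hU hj m n e) hU n)))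

/-- Integration by parts before integrating: the Leibniz rule moves the derivatives from `c` onto
the partials of `L`, and what is left over is the divergence of the current. -/
theorem fderiv_jet_smul_const (hL : ContDiffOn ℝ ∞ L O) (hO : IsOpen O)
    (hΦ : ContDiffOn ℝ ∞ Φ U) (hU : IsOpen U) (hj : ∀ x ∈ U, jet Φ x ∈ O) (e : V)
    {c : Pt → ℝ} (hc : ContDiffOn ℝ ∞ c U) {x : Pt} (hx : x ∈ U) :
    fderiv ℝ L (jet Φ x) (jet (fun y => c y • e) x)
      = eulerLagrange L Φ e x * c x + ∑ m, pd m (variationCurrent L Φ e c m) x := by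
  have hd := ContDiffOn.diffAt hL hO (hj x hx)
  have s1 := contDiffOn_partial1 hL hO hΦ hU hj
  have s2 := contDiffOn_partial2 hL hO hΦ hU hj
  have d1 : ∀ m, DifferentiableAt ℝ (fun y => partial1 L m e (jet Φ y)) x := fun m =>
    ContDiffOn.diffAt (s1 m e) hU hx
  have d2 : ∀ m n, DifferentiableAt ℝ (fun y => partial2 L m n e (jet Φ y)) x := fun m n =>
    ContDiffOn.diffAt (s2 m n e) hU hx
  have d2' : ∀ m n, DifferentiableAt ℝ (pd n fun y => partial2 L m n e (jet Φ y)) x := fun m n =>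
    ContDiffOn.diffAt (ContDiffOn.pd (s2 m n e) hU n) hU hx
  have dc : DifferentiableAt ℝ c x := ContDiffOn.diffAt hc hU hx
  have dc' : ∀ n, DifferentiableAt ℝ (pd n c) x := fun n =>
    ContDiffOn.diffAt (ContDiffOn.pd hc hU n) hU hx
  have hcur : ∀ m, pd m (variationCurrent L Φ e c m) x
      = pd m (fun y => partial1 L m e (jet Φ y)) x * c x + partial1 L m e (jet Φ x) * pd m c x
        + ∑ n, ((pd m (fun y => partial2 L m n e (jet Φ y)) x * pd n c x
            + partial2 L m n e (jet Φ x) * pd m (pd n c) x)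
          - (pd m c x * pd n (fun y => partial2 L m n e (jet Φ y)) x
            + c x * pd m (pd n fun y => partial2 L m n e (jet Φ y)) x)) := by
    intro m
    unfold variationCurrent
    rw [pd_add ((d1 m).fun_mul dc) (DifferentiableAt.fun_sum fun n _ =>
        ((d2 m n).fun_mul (dc' n)).fun_sub (dc.fun_mul (d2' m n))), pd_mul (d1 m) dc,
      pd_sum fun n _ => ((d2 m n).fun_mul (dc' n)).fun_sub (dc.fun_mul (d2' m n))]
    congr 1
    refine Finset.sum_congr rfl fun n _ => ?_
    rw [pd_sub ((d2 m n).fun_mul (dc' n)) (dc.fun_mul (d2' m n)), pd_mul (d2 m n) (dc' n),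
      pd_mul dc (d2' m n)]
  -- The mixed terms, with one derivative on `c` and one on the partial, cancel after exchanging the
  -- indices, since `partial2` is symmetric in them.
  have hswap : ∑ m, ∑ n, pd m (fun y => partial2 L m n e (jet Φ y)) x * pd n c x
      = ∑ m, ∑ n, pd m c x * pd n (fun y => partial2 L m n e (jet Φ y)) x := by
    rw [Finset.sum_comm]
    refine Finset.sum_congr rfl fun m _ => Finset.sum_congr rfl fun n _ => ?_
    rw [mul_comm]
    simp only [partial2_comm L n m]
  rw [jet_smul_const_eq_sum hc hU hx]
  simp only [hcur, map_add, map_sum, map_smul, ← partial0_eq hd, ← partial1_eq hd,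
    ← partial2_eq hd, smul_eq_mul, eulerLagrange, Finset.sum_add_distrib, Finset.sum_sub_distrib,
    hswap, add_mul, sub_mul, Finset.sum_mul]
  simp only [mul_comm (c x), mul_comm (pd _ c x), mul_comm (pd _ (pd _ c) x)]
  ring

/-- The second boundary hypothesis involves only the product of `partial2` with `∂c`. Metric
components meet it because `∂δg = 0` on the boundary, matter components because their `partial2`
vanishes, so no condition on `∂δu` is needed. -/
theorem integral_fderiv_jet_smul_const (hL : ContDiffOn ℝ ∞ L O) (hO : IsOpen O)
    (hΦ : ContDiffOn ℝ ∞ Φ U) (hU : IsOpen U) (hj : ∀ x ∈ U, jet Φ x ∈ O) (e : V)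
    {c : Pt → ℝ} (hc : ContDiffOn ℝ ∞ c U) {Ω : Set Pt} (hΩ : IsRegion U Ω)
    (h0 : ∀ x ∈ frontier Ω, c x = 0)
    (h1 : ∀ x ∈ frontier Ω, ∀ m n, partial2 L m n e (jet Φ x) * pd n c x = 0) :
    ∫ x in Ω, fderiv ℝ L (jet Φ x) (jet (fun y => c y • e) x)
      = ∫ x in Ω, eulerLagrange L Φ e x * c x := by
  have sX := contDiffOn_variationCurrent hL hO hΦ hU hj e hc
  have iX : ∀ m, IntegrableOn (pd m (variationCurrent L Φ e c m)) Ω := fun m =>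
    hΩ.integrableOn (ContDiffOn.pd (sX m) hU m).continuousOn
  rw [setIntegral_congr_fun hΩ.isOpen.measurableSet
      fun x hx => fderiv_jet_smul_const hL hO hΦ hU hj e hc (hΩ.subset' hx),
    integral_add (hΩ.integrableOn
      ((contDiffOn_eulerLagrange hL hO hΦ hU hj e).mul hc).continuousOn)
      (integrable_finsetSum _ fun m _ => iX m), integral_finsetSum _ fun m _ => iX m]
  simp only [add_eq_left]
  refine Finset.sum_eq_zero fun m _ => ?_
  refine integral_pd_eq_zero_of_frontier hU hΩ (sX m) (fun x hx => ?_) m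
  simp [variationCurrent, h0 x hx, h1 x hx]

theorem integral_fderiv_jet_sum {I : Type*} [Fintype I] (hL : ContDiffOn ℝ ∞ L O) (hO : IsOpen O)
    (hΦ : ContDiffOn ℝ ∞ Φ U) (hU : IsOpen U) (hj : ∀ x ∈ U, jet Φ x ∈ O) {e : I → V}
    {c : I → Pt → ℝ} (hc : ∀ i, ContDiffOn ℝ ∞ (c i) U) {Ω : Set Pt} (hΩ : IsRegion U Ω)
    (hδ : ∀ x ∈ U, δΦ x = ∑ i, c i x • e i)
    (h0 : ∀ i, ∀ x ∈ frontier Ω, c i x = 0)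
    (h1 : ∀ i, ∀ x ∈ frontier Ω, ∀ m n, partial2 L m n (e i) (jet Φ x) * pd n (c i) x = 0) :
    ∫ x in Ω, fderiv ℝ L (jet Φ x) (jet δΦ x)
      = ∫ x in Ω, ∑ i, eulerLagrange L Φ (e i) x * c i x := by
  have hce : ∀ i, ContDiffOn ℝ ∞ (fun y => c i y • e i) U := fun i => (hc i).smul contDiffOn_const
  have key : ∀ x ∈ Ω, fderiv ℝ L (jet Φ x) (jet δΦ x)
      = ∑ i, fderiv ℝ L (jet Φ x) (jet (fun y => c i y • e i) x) := by
    intro x hx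
    have hxU := hΩ.subset' hx
    rw [jet_congr (eventually_of_mem (hU.mem_nhds hxU) hδ), jet_finset_sum _ hce hU hxU, map_sum]
  rw [setIntegral_congr_fun hΩ.isOpen.measurableSet key, integral_finsetSum, integral_finsetSum]
  · exact Finset.sum_congr rfl fun i _ =>
      integral_fderiv_jet_smul_const hL hO hΦ hU hj (e i) (hc i) hΩ (h0 i) (h1 i)
  · exact fun i _ => hΩ.integrableOn
      ((contDiffOn_eulerLagrange hL hO hΦ hU hj (e i)).mul (hc i)).continuousOn
  · exact fun i _ => hΩ.integrableOn (ContinuousOn.clm_apply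
      ((hL.continuousOn_fderiv_of_isOpen hO (by simp)).comp (ContDiffOn.jet hΦ hU).continuousOn hj)
      (ContDiffOn.jet (hce i) hU).continuousOn)

/-- Differentiation under the integral takes place on this set of pairs `(ε, x)`, where the varied
jet stays in the domain of the Lagrangian. -/
theorem isOpen_jet_line (hO : IsOpen O) (hΦ : ContDiffOn ℝ ∞ Φ U) (hδ : ContDiffOn ℝ ∞ δΦ U)
    (hU : IsOpen U) : IsOpen {q : ℝ × Pt | q.2 ∈ U ∧ jet Φ q.2 + q.1 • jet δΦ q.2 ∈ O} := by
  have h : ContinuousOn (fun q : ℝ × Pt => jet Φ q.2 + q.1 • jet δΦ q.2) (Set.univ ×ˢ U) :=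
    ((ContDiffOn.jet hΦ hU).continuousOn.comp continuousOn_snd fun q hq => hq.2).add
      (continuousOn_fst.smul
        ((ContDiffOn.jet hδ hU).continuousOn.comp continuousOn_snd fun q hq => hq.2))
  have := h.isOpen_inter_preimage (isOpen_univ.prod hU) hO
  convert this using 1
  ext q; simp

theorem contDiffOn_jet_line (hΦ : ContDiffOn ℝ ∞ Φ U) (hδ : ContDiffOn ℝ ∞ δΦ U)
    (hU : IsOpen U) : ContDiffOn ℝ ∞ (fun q : ℝ × Pt => jet Φ q.2 + q.1 • jet δΦ q.2)
      {q | q.2 ∈ U ∧ jet Φ q.2 + q.1 • jet δΦ q.2 ∈ O} :=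
  ((ContDiffOn.jet hΦ hU).comp contDiff_snd.contDiffOn fun _ hq => hq.1).add
    (contDiff_fst.contDiffOn.smul
      ((ContDiffOn.jet hδ hU).comp contDiff_snd.contDiffOn fun _ hq => hq.1))

theorem hasDerivAt_integral_jet (hL : ContDiffOn ℝ ∞ L O) (hO : IsOpen O)
    (hΦ : ContDiffOn ℝ ∞ Φ U) (hδ : ContDiffOn ℝ ∞ δΦ U) (hU : IsOpen U)
    (hj : ∀ x ∈ U, jet Φ x ∈ O) {Ω : Set Pt} (hΩ : IsRegion U Ω) :
    HasDerivAt (fun ε : ℝ => ∫ x in Ω, L (jet Φ x + ε • jet δΦ x))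
      (∫ x in Ω, fderiv ℝ L (jet Φ x) (jet δΦ x)) 0 := by
  have hN := isOpen_jet_line hO hΦ hδ hU
  have hF : ContDiffOn ℝ ∞ (fun q : ℝ × Pt => L (jet Φ q.2 + q.1 • jet δΦ q.2))
      {q | q.2 ∈ U ∧ jet Φ q.2 + q.1 • jet δΦ q.2 ∈ O} :=
    hL.comp (contDiffOn_jet_line hΦ hδ hU) fun q hq => hq.2
  have hmem : ∀ x ∈ U, ((0 : ℝ), x) ∈ {q : ℝ × Pt | q.2 ∈ U ∧ jet Φ q.2 + q.1 • jet δΦ q.2 ∈ O} :=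
    fun x hx => ⟨hx, by simpa using hj x hx⟩
  have := hasDerivAt_setIntegral hΩ.isOpen hΩ.compact hN hF fun x hx => hmem x (hΩ.subset hx)
  rw [setIntegral_congr_fun hΩ.isOpen.measurableSet fun x hx => ?_] at this
  · exact this
  have hxU := hΩ.subset' hx
  have h1 : HasDerivAt (fun ε : ℝ => (ε, x)) ((1 : ℝ), (0 : Pt)) 0 :=
    (hasDerivAt_id _).prodMk (hasDerivAt_const _ x)
  have h2 := (ContDiffOn.diffAt hF hN (hmem x hxU)).hasFDerivAt.comp_hasDerivAt 0 h1
  exact HasDerivAt.unique (f := fun ε : ℝ => L (jet Φ x + ε • jet δΦ x)) h2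
    (hasDerivAt_line (ContDiffOn.diffAt hL hO (hj x hxU)) _)

theorem eventually_jet_line_mem (hO : IsOpen O) (hΦ : ContDiffOn ℝ ∞ Φ U)
    (hδ : ContDiffOn ℝ ∞ δΦ U) (hU : IsOpen U) (hj : ∀ x ∈ U, jet Φ x ∈ O) {Ω : Set Pt}
    (hΩ : IsRegion U Ω) :
    ∀ᶠ ε in 𝓝 (0 : ℝ), ∀ x ∈ closure Ω, jet Φ x + ε • jet δΦ x ∈ O := by
  have hN := isOpen_jet_line hO hΦ hδ hU
  have hmem : ∀ x ∈ closure Ω, ((0 : ℝ), x) ∈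
      {q : ℝ × Pt | q.2 ∈ U ∧ jet Φ q.2 + q.1 • jet δΦ q.2 ∈ O} :=
    fun x hx => ⟨hΩ.subset hx, by simpa using hj x (hΩ.subset hx)⟩
  have h := hΩ.compact.eventually_forall_of_forall_eventually (x₀ := (0 : ℝ))
    (P := fun ε x => (ε, x) ∈ {q : ℝ × Pt | q.2 ∈ U ∧ jet Φ q.2 + q.1 • jet δΦ q.2 ∈ O})
    fun x hx => hN.mem_nhds (hmem x hx)
  exact h.mono fun ε hε x hx => (hε x hx).2

/-- The formula for `A` is required only while all varied jets over `closure Ω` stay in `O`.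
Compactness guarantees this for small `ε`, and a derivative at `0` sees nothing else. -/
theorem hasDerivAt_of_eq_integral_jet (hL : ContDiffOn ℝ ∞ L O) (hO : IsOpen O)
    (hΦ : ContDiffOn ℝ ∞ Φ U) (hδ : ContDiffOn ℝ ∞ δΦ U) (hU : IsOpen U)
    (hj : ∀ x ∈ U, jet Φ x ∈ O) {Ω : Set Pt} (hΩ : IsRegion U Ω) {A : ℝ → ℝ}
    (hA : ∀ ε : ℝ, (∀ x ∈ closure Ω, jet Φ x + ε • jet δΦ x ∈ O) →
      A ε = ∫ x in Ω, L (jet Φ x + ε • jet δΦ x)) :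
    HasDerivAt A (∫ x in Ω, fderiv ℝ L (jet Φ x) (jet δΦ x)) 0 :=
  (hasDerivAt_integral_jet hL hO hΦ hδ hU hj hΩ).congr_of_eventuallyEq
    ((eventually_jet_line_mem hO hΦ hδ hU hj hΩ).mono hA)

end FirstVariation

end GR

namespace GR

open Filter Topology

/-! ### Openness of the Lorentzian signature; the inverse metric and its determinant -/

section Metric

/-- The symmetric part of an array, as a linear map. -/
noncomputable def symMet : Met →L[ℝ] Met := LinearMap.toContinuousLinearMap
  { toFun := fun h i j => (h i j + h j i) / 2
    map_add' := fun h k => by funext i j; simp; ring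
    map_smul' := fun c h => by funext i j; simp; ring }

theorem symMet_apply (h : Met) (i j : Fin 4) : symMet h i j = (h i j + h j i) / 2 := rfl

theorem symMet_symm (h : Met) (i j : Fin 4) : symMet h i j = symMet h j i := by
  simp only [symMet_apply, add_comm]

theorem symMet_eq_self {h : Met} (hs : ∀ i j, h i j = h j i) : symMet h = h := by
  funext i j; rw [symMet_apply, hs j i]; ring

/-- The Minkowski metric. -/
noncomputable def minkowski : Matrix (Fin 4) (Fin 4) ℝ := Matrix.diagonal ![-1, 1, 1, 1]

theorem minkowski_mul_self : minkowski * minkowski = 1 := by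
  rw [minkowski, Matrix.diagonal_mul_diagonal, ← Matrix.diagonal_one]
  congr 1; funext i; fin_cases i <;> simp

theorem minkowski_transpose : minkowski.transpose = minkowski := Matrix.diagonal_transpose _

theorem IsLorentzian.symm {h : Met} (hh : IsLorentzian h) (i j : Fin 4) : h i j = h j i := by
  obtain ⟨P, -, e⟩ := hh
  have : (Matrix.of h).transpose = Matrix.of h := by
    rw [e]; simp [Matrix.transpose_mul, Matrix.mul_assoc]
  exact congrFun (congrFun this j) i

theorem IsLorentzian.det_neg {h : Met} (hh : IsLorentzian h) : (Matrix.of h).det < 0 := by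
  obtain ⟨P, hP, e⟩ := hh
  rw [e, Matrix.det_mul, Matrix.det_mul, Matrix.det_transpose, Matrix.det_diagonal]
  have : 0 < P.det * P.det := mul_self_pos.2 hP.ne_zero
  have h4 : ∏ i, (![-1, 1, 1, 1] : Fin 4 → ℝ) i = -1 := by simp [Fin.prod_univ_four]
  rw [h4]; linarith

/-- With `D` the Minkowski matrix and `X` symmetric, `D² = 1` gives `(1 + X D) D (1 + X D)ᵀ = D + 2
X + X D X`. The map `X ↦ 2 X + X D X` has derivative `2` at the origin, so by the inverse function
theorem it covers a neighbourhood of zero: small symmetric perturbations of `D` are congruent to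
`D`. -/
theorem isLorentzian_near_minkowski :
    ∀ᶠ E in 𝓝 (0 : Met), (∀ i j, E i j = E j i) → IsLorentzian fun i j => minkowski i j + E i j := by
  -- `Q X` is `X D X` when `X` is symmetric. Building it from `symMet X` makes `Q X` symmetric for
  -- every `X`; hence a preimage `X` of a symmetric array under `2 X + Q X` is itself symmetric.
  let Q : Met → Met := fun X i j => ∑ k, symMet X i k * (![-1, 1, 1, 1] : Fin 4 → ℝ) k * symMet X k j
  have hℓ : ∀ i k, ContDiff ℝ ∞ fun X : Met => symMet X i k := fun i k =>
    contDiff_pi.1 (contDiff_pi.1 symMet.contDiff i) k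
  have hQ : ∀ i j, ContDiff ℝ ∞ fun X => Q X i j := fun i j =>
    ContDiff.sum fun k _ => ((hℓ i k).mul contDiff_const).mul (hℓ k j)
  have hQ0 : ∀ i j, HasStrictFDerivAt (fun X => Q X i j) (0 : Met →L[ℝ] ℝ) 0 := by
    intro i j
    -- `Q` is homogeneous of degree two, so its derivative along every line through `0` vanishes.
    have h1 : fderiv ℝ (fun X => Q X i j) 0 = 0 := by
      ext v
      have h2 := hasDerivAt_line ((hQ i j).differentiable (by simp) 0) v
      have h3 : (fun t : ℝ => Q (0 + t • v) i j) = fun t => t ^ 2 * Q v i j := by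
        funext t
        simp only [Q, zero_add, map_smul, Pi.smul_apply, smul_eq_mul, Finset.mul_sum]
        exact Finset.sum_congr rfl fun k _ => by ring
      rw [h3] at h2
      have h4 : HasDerivAt (fun t : ℝ => t ^ 2 * Q v i j) 0 0 := by
        simpa using ((hasDerivAt_id (0 : ℝ)).pow 2).mul_const (Q v i j)
      exact h2.unique h4
    rw [← h1]
    exact (hQ i j).contDiffAt.hasStrictFDerivAt (by simp)
  let G : Met → Met := fun X => (2 : ℝ) • X + Q X
  have hG : HasStrictFDerivAt G ((ContinuousLinearEquiv.smulLeft (Units.mk0 (2 : ℝ) two_ne_zero) :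
      Met ≃L[ℝ] Met) : Met →L[ℝ] Met) 0 := by
    have hQs : HasStrictFDerivAt Q (0 : Met →L[ℝ] Met) 0 :=
      hasStrictFDerivAt_pi'.2 fun i => hasStrictFDerivAt_pi'.2 fun j =>
        (hQ0 i j).congr_fderiv (by ext v; simp)
    have := ((ContinuousLinearMap.id ℝ Met).hasStrictFDerivAt (x := 0)).const_smul (2 : ℝ) |>.add hQs
    exact this.congr_fderiv (by ext v i j; simp)
  have hmap := hG.map_nhds_eq_of_equiv
  have hG0 : G 0 = 0 := by
    funext i j; simp [G, Q]
  rw [hG0] at hmap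
  have hdet : ∀ᶠ X in 𝓝 (0 : Met), (1 + Matrix.of X * minkowski).det ≠ 0 := by
    have hc : Continuous fun X : Met => (1 + Matrix.of X * minkowski).det := by
      refine Continuous.matrix_det ?_
      exact continuous_const.add (Continuous.matrix_mul continuous_id continuous_const)
    refine hc.continuousAt.eventually_ne ?_
    have : Matrix.of (0 : Met) = 0 := rfl
    simp [this]
  have him : G '' {X | (1 + Matrix.of X * minkowski).det ≠ 0} ∈ 𝓝 (0 : Met) := by
    rw [← hmap]; exact image_mem_map hdet
  filter_upwards [him] with E hE hs
  obtain ⟨X, hX, rfl⟩ := hE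
  have hXs : ∀ i j, X i j = X j i := by
    intro i j
    have h1 := hs i j
    have h2 : Q X i j = Q X j i := Finset.sum_congr rfl fun k _ => by
      rw [symMet_symm X i k, symMet_symm X k j]; ring
    simp only [G, Pi.add_apply, Pi.smul_apply, smul_eq_mul, h2] at h1
    linarith
  refine ⟨1 + Matrix.of X * minkowski, isUnit_iff_ne_zero.2 hX, ?_⟩
  have hT : (Matrix.of X).transpose = Matrix.of X := by ext i j; exact hXs j i
  have hQX : Matrix.of (Q X) = Matrix.of X * minkowski * Matrix.of X := by
    ext i j
    simp only [Q, symMet_eq_self hXs, minkowski, Matrix.of_apply]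
    rw [Matrix.mul_apply]
    simp only [Matrix.mul_diagonal, Matrix.of_apply]
  have hsum : (Matrix.of fun i j => minkowski i j + G X i j)
      = minkowski + ((2 : ℝ) • Matrix.of X + Matrix.of (Q X)) := rfl
  rw [hsum, hQX, Matrix.transpose_add, Matrix.transpose_one, Matrix.transpose_mul, hT,
    minkowski_transpose, ← minkowski]
  have hDD : ∀ A : Matrix (Fin 4) (Fin 4) ℝ, minkowski * (minkowski * A) = A := fun A => by
    rw [← Matrix.mul_assoc, minkowski_mul_self, Matrix.one_mul]
  simp only [Matrix.add_mul, Matrix.mul_add, Matrix.one_mul, Matrix.mul_one, Matrix.mul_assoc, hDD,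
    minkowski_mul_self, two_smul]
  abel

/-- Congruence by `P⁻¹` carries `P D Pᵀ` to the Minkowski matrix `D`, which reduces the claim at any
point to `isLorentzian_near_minkowski`. Symmetrization appears because symmetric arrays are not open
among all arrays. -/
theorem isOpen_isLorentzian_symMet : IsOpen {h : Met | IsLorentzian (symMet h)} := by
  rw [isOpen_iff_eventually]
  rintro h₀ ⟨P, hP, e⟩
  rw [← minkowski] at e
  let E : Met → Met := fun h => P⁻¹ * (Matrix.of (symMet h) - Matrix.of (symMet h₀)) * P⁻¹.transpose
  have hE0 : E h₀ = 0 := by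
    change P⁻¹ * (Matrix.of (symMet h₀) - Matrix.of (symMet h₀)) * P⁻¹.transpose = 0
    simp
  have hc : Continuous E := by
    have h1 : Continuous fun h : Met => (Matrix.of (symMet h) - Matrix.of (symMet h₀) :
        Matrix (Fin 4) (Fin 4) ℝ) :=
      Continuous.sub (f := fun h : Met => (Matrix.of (symMet h) : Matrix (Fin 4) (Fin 4) ℝ))
        symMet.continuous continuous_const
    exact (Continuous.matrix_mul continuous_const h1).matrix_mul continuous_const
  have ht : Tendsto E (𝓝 h₀) (𝓝 0) := by
    rw [← hE0]; exact hc.continuousAt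
  filter_upwards [ht.eventually isLorentzian_near_minkowski] with h hh
  have hst : ∀ k, (Matrix.of (symMet k)).transpose = Matrix.of (symMet k) := fun k => by
    ext i j; exact symMet_symm k j i
  have hsymm : (Matrix.of (E h)).transpose = Matrix.of (E h) := by
    change (P⁻¹ * (Matrix.of (symMet h) - Matrix.of (symMet h₀)) * P⁻¹.transpose).transpose
      = P⁻¹ * (Matrix.of (symMet h) - Matrix.of (symMet h₀)) * P⁻¹.transpose
    simp only [Matrix.transpose_mul, Matrix.mul_assoc, Matrix.transpose_sub, hst,
      Matrix.transpose_transpose]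
  obtain ⟨R, hR, e'⟩ := hh fun i j => congrFun (congrFun hsymm j) i
  refine ⟨P * R, by rw [Matrix.det_mul]; exact hP.mul hR, ?_⟩
  have e'' : minkowski + P⁻¹ * (Matrix.of (symMet h) - Matrix.of (symMet h₀)) * P⁻¹.transpose
      = R * minkowski * R.transpose := e'
  have hPT : P⁻¹.transpose * P.transpose = 1 := by
    rw [← Matrix.transpose_mul, Matrix.mul_nonsing_inv _ hP, Matrix.transpose_one]
  calc Matrix.of (symMet h)
      = P * minkowski * P.transpose + (Matrix.of (symMet h) - Matrix.of (symMet h₀)) := by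
        rw [← e]; abel
    _ = P * (minkowski + P⁻¹ * (Matrix.of (symMet h) - Matrix.of (symMet h₀)) * P⁻¹.transpose)
        * P.transpose := by
        simp only [Matrix.mul_add, Matrix.add_mul, Matrix.mul_assoc, hPT, Matrix.mul_one]
        rw [Matrix.mul_nonsing_inv_cancel_left _ _ hP]
    _ = P * R * minkowski * (P * R).transpose := by
        rw [e'', Matrix.transpose_mul]; simp only [Matrix.mul_assoc]

theorem contDiff_det_of {E : Type*} [NormedAddCommGroup E] [NormedSpace ℝ E]
    {A : E → Matrix (Fin 4) (Fin 4) ℝ} (hA : ∀ i j, ContDiff ℝ ∞ fun x => A x i j) :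
    ContDiff ℝ ∞ fun x => (A x).det := by
  simp only [Matrix.det_apply]
  exact ContDiff.sum fun σ _ => (contDiff_prod fun i _ => hA _ _).const_smul _

theorem contDiff_entry (i j : Fin 4) : ContDiff ℝ ∞ fun h : Met => h i j := by fun_prop

theorem contDiff_det : ContDiff ℝ ∞ fun h : Met => (Matrix.of h).det :=
  contDiff_det_of contDiff_entry

theorem lower_apply (h : Met) (i j : Fin 4) :
    lower h i j = (Matrix.of h).det⁻¹ * (Matrix.of h).adjugate i j := by
  rw [lower, Matrix.inv_def, Ring.inverse_eq_inv']; rfl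

theorem contDiffOn_lower (i j : Fin 4) :
    ContDiffOn ℝ ∞ (fun h : Met => lower h i j) {h | (Matrix.of h).det ≠ 0} := by
  simp only [lower_apply]
  refine (contDiff_det.contDiffOn.inv fun h hh => hh).mul (ContDiff.contDiffOn ?_)
  simp only [Matrix.adjugate_apply]
  refine contDiff_det_of fun k l => ?_
  simp only [Matrix.updateRow_apply]
  split_ifs
  · exact contDiff_const
  · exact contDiff_entry k l

theorem det_lower (h : Met) : (lower h).det = (Matrix.of h).det⁻¹ := by
  rw [lower, Matrix.det_nonsing_inv, Ring.inverse_eq_inv']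

theorem sqrtNeg_eq (h : Met) : sqrtNeg h = Real.sqrt (-(Matrix.of h).det⁻¹) := by
  rw [sqrtNeg, det_lower]

theorem sqrtNeg_pos {h : Met} (hh : (Matrix.of h).det < 0) : 0 < sqrtNeg h := by
  rw [sqrtNeg_eq]; exact Real.sqrt_pos.2 (neg_pos.2 (inv_lt_zero.2 hh))

theorem isOpen_det_neg : IsOpen {h : Met | (Matrix.of h).det < 0} :=
  isOpen_lt contDiff_det.continuous continuous_const

theorem contDiffOn_sqrtNeg : ContDiffOn ℝ ∞ sqrtNeg {h | (Matrix.of h).det < 0} := by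
  have : sqrtNeg = fun h => Real.sqrt (-(Matrix.of h).det⁻¹) := funext sqrtNeg_eq
  rw [this]
  refine ContDiffOn.sqrt ((contDiff_det.contDiffOn.inv fun h hh => ?_).neg) fun h hh => ?_
  · exact ne_of_lt hh
  · exact (neg_pos.2 (inv_lt_zero.2 hh)).ne'

theorem lower_mul {h : Met} (hh : (Matrix.of h).det ≠ 0) : lower h * Matrix.of h = 1 :=
  Matrix.nonsing_inv_mul _ (isUnit_iff_ne_zero.2 hh)

theorem mul_lower {h : Met} (hh : (Matrix.of h).det ≠ 0) : Matrix.of h * lower h = 1 :=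
  Matrix.mul_nonsing_inv _ (isUnit_iff_ne_zero.2 hh)

theorem lower_symm {h : Met} (hs : ∀ i j, h i j = h j i) (i j : Fin 4) :
    lower h i j = lower h j i := by
  have h1 : (Matrix.of h).transpose = Matrix.of h := by ext i j; exact hs j i
  have : (lower h).transpose = lower h := by rw [lower, Matrix.transpose_nonsing_inv, h1]
  exact congrFun (congrFun this j) i

/-- Jacobi's formula. -/
theorem hasDerivAt_det_line {h : Met} (hh : (Matrix.of h).det ≠ 0) (w : Met) :
    HasDerivAt (fun t : ℝ => (Matrix.of (h + t • w)).det)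
      ((Matrix.of h).det * (lower h * Matrix.of w).trace) 0 := by
  set M := lower h * Matrix.of w
  -- After factoring out `det h`, what remains is `det (1 + t M)`, a polynomial in `t` whose
  -- constant and linear coefficients are `1` and the trace of `M`.
  have h1 : (fun t : ℝ => (Matrix.of (h + t • w)).det)
      = fun t => (Matrix.of h).det * (1 + M.trace * t
        + (Matrix.det (1 + (Polynomial.X : Polynomial ℝ) • M.map Polynomial.C)).divX.divX.eval t
          * t ^ 2) := by
    funext t
    rw [← Matrix.det_one_add_smul, ← Matrix.det_mul, Matrix.mul_add, Matrix.mul_one,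
      Matrix.mul_smul, ← Matrix.mul_assoc, mul_lower hh, Matrix.one_mul]
    rfl
  rw [h1]
  have h2 : HasDerivAt (fun t : ℝ => 1 + M.trace * t) M.trace 0 := by
    simpa using ((hasDerivAt_id (0 : ℝ)).const_mul M.trace).const_add 1
  have h3 := (Matrix.det (1 + (Polynomial.X : Polynomial ℝ) • M.map Polynomial.C)).divX.divX.hasDerivAt 0
  have h4 := h3.mul ((hasDerivAt_id (0 : ℝ)).pow 2)
  have h5 := (h2.add h4).const_mul (Matrix.of h).det
  simpa using h5

/-- Jacobi's formula applied to `√(-1 / det h)`. The sign is negative because the variable is the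
contravariant metric. -/
theorem fderiv_sqrtNeg {h : Met} (hh : (Matrix.of h).det < 0) (w : Met) :
    fderiv ℝ sqrtNeg h w = -(1 / 2) * sqrtNeg h * ∑ a, ∑ b, lower h a b * w b a := by
  have hd : DifferentiableAt ℝ sqrtNeg h := ContDiffOn.diffAt contDiffOn_sqrtNeg isOpen_det_neg hh
  refine (hasDerivAt_line hd w).unique ?_
  have hne : (Matrix.of h).det ≠ 0 := hh.ne
  have hpos : 0 < -(Matrix.of h).det⁻¹ := neg_pos.2 (inv_lt_zero.2 hh)
  have e0 : Matrix.of (h + (0 : ℝ) • w) = Matrix.of h := by simp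
  have h1 := ((hasDerivAt_det_line hne w).fun_inv (by simpa using hne)).fun_neg.sqrt
    (by simpa using hpos.ne')
  simp only [sqrtNeg_eq]
  refine h1.congr_deriv ?_
  rw [e0]
  have htr : (lower h * Matrix.of w).trace = ∑ a, ∑ b, lower h a b * w b a := rfl
  rw [htr]
  set T := ∑ a, ∑ b, lower h a b * w b a
  set s := Real.sqrt (-(Matrix.of h).det⁻¹) with hs
  have hs2 : s * s = -(Matrix.of h).det⁻¹ := Real.mul_self_sqrt hpos.le
  have hs0 : s ≠ 0 := (Real.sqrt_pos.2 hpos).ne'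
  rw [div_eq_iff (by positivity)]
  field_simp
  have : s ^ 2 * (Matrix.of h).det = -1 := by rw [pow_two, hs2]; field_simp
  linear_combination T * this

end Metric

end GR

namespace GR

open Filter Topology

/-! ### Geometric and jet formulas for the curvature agree; metric compatibility; symmetry of Ricci
-/

section Curvature

theorem contDiffOn_matrix_mul {E : Type*} [NormedAddCommGroup E] [NormedSpace ℝ E] {s : Set E}
    {A B : E → Matrix (Fin 4) (Fin 4) ℝ} (hA : ∀ i j, ContDiffOn ℝ ∞ (fun x => A x i j) s)
    (hB : ∀ i j, ContDiffOn ℝ ∞ (fun x => B x i j) s) (i j : Fin 4) :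
    ContDiffOn ℝ ∞ (fun x => (A x * B x) i j) s := by
  simp only [Matrix.mul_apply]
  exact ContDiffOn.sum fun k _ => (hA i k).mul (hB k j)

/-- The jets of metrics with negative determinant. -/
def detNegJets : Set (Jet Met) := {j | (Matrix.of j.1).det < 0}

theorem isOpen_detNegJets : IsOpen detNegJets := isOpen_det_neg.preimage continuous_fst

theorem contDiffOn_lower_jet (a b : Fin 4) :
    ContDiffOn ℝ ∞ (fun j : Jet Met => lower j.1 a b) detNegJets :=
  (contDiffOn_lower a b).comp contDiff_fst.contDiffOn fun _ hj => ne_of_lt hj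

theorem contDiffOn_dLowerJet (m a b : Fin 4) :
    ContDiffOn ℝ ∞ (fun j : Jet Met => dLowerJet j m a b) detNegJets :=
  (contDiffOn_matrix_mul (contDiffOn_matrix_mul contDiffOn_lower_jet
    (fun i k => ContDiff.contDiffOn (by simp only [Matrix.of_apply]; fun_prop)))
    contDiffOn_lower_jet a b).neg

theorem contDiffOn_ddLowerJet (m n a b : Fin 4) :
    ContDiffOn ℝ ∞ (fun j : Jet Met => ddLowerJet j m n a b) detNegJets := by
  have h1 : ∀ m i k, ContDiffOn ℝ ∞ (fun j : Jet Met => Matrix.of (j.2.1 m) i k) detNegJets :=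
    fun m i k => ContDiff.contDiffOn (by simp only [Matrix.of_apply]; fun_prop)
  have h2 : ∀ m n i k, ContDiffOn ℝ ∞ (fun j : Jet Met => Matrix.of (j.2.2 m n) i k) detNegJets :=
    fun m n i k => ContDiff.contDiffOn (by simp only [Matrix.of_apply]; fun_prop)
  have h3 : ∀ m n a b, ContDiffOn ℝ ∞ (fun j : Jet Met => (lower j.1 * Matrix.of (j.2.1 m)
      * lower j.1 * Matrix.of (j.2.1 n) * lower j.1) a b) detNegJets := fun m n =>
    contDiffOn_matrix_mul (contDiffOn_matrix_mul (contDiffOn_matrix_mul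
      (contDiffOn_matrix_mul contDiffOn_lower_jet (h1 m)) contDiffOn_lower_jet) (h1 n))
      contDiffOn_lower_jet
  exact ((h3 m n a b).add (h3 n m a b)).sub (contDiffOn_matrix_mul
    (contDiffOn_matrix_mul contDiffOn_lower_jet (h2 m n)) contDiffOn_lower_jet a b)

theorem contDiffOn_christoffelJet (l m n : Fin 4) :
    ContDiffOn ℝ ∞ (fun j : Jet Met => christoffelJet j l m n) detNegJets :=
  contDiffOn_const.mul (ContDiffOn.sum fun s _ =>
    (ContDiff.contDiffOn (by fun_prop)).mul (((contDiffOn_dLowerJet m s n).add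
      (contDiffOn_dLowerJet n s m)).sub (contDiffOn_dLowerJet s m n)))

theorem contDiffOn_dChristoffelJet (k l m n : Fin 4) :
    ContDiffOn ℝ ∞ (fun j : Jet Met => dChristoffelJet j k l m n) detNegJets :=
  contDiffOn_const.mul (ContDiffOn.sum fun s _ =>
    ((ContDiff.contDiffOn (by fun_prop)).mul (((contDiffOn_dLowerJet m s n).add
      (contDiffOn_dLowerJet n s m)).sub (contDiffOn_dLowerJet s m n))).add
    ((ContDiff.contDiffOn (by fun_prop)).mul (((contDiffOn_ddLowerJet k m s n).add
      (contDiffOn_ddLowerJet k n s m)).sub (contDiffOn_ddLowerJet k s m n))))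

theorem contDiffOn_ricciJet (a b : Fin 4) :
    ContDiffOn ℝ ∞ (fun j : Jet Met => ricciJet j a b) detNegJets :=
  ContDiffOn.sum fun m _ => ((contDiffOn_dChristoffelJet m m a b).sub
    (contDiffOn_dChristoffelJet b m a m)).add (ContDiffOn.sum fun n _ =>
      ((contDiffOn_christoffelJet m m n).mul (contDiffOn_christoffelJet n a b)).sub
        ((contDiffOn_christoffelJet m b n).mul (contDiffOn_christoffelJet n a m)))

theorem contDiffOn_scalarJet : ContDiffOn ℝ ∞ scalarJet detNegJets :=
  ContDiffOn.sum fun a _ => ContDiffOn.sum fun b _ =>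
    (ContDiff.contDiffOn (by fun_prop)).mul (contDiffOn_ricciJet a b)

/-- The entrywise partial derivative of a matrix field. -/
noncomputable def pdMat (m : Fin 4) (A : Pt → Matrix (Fin 4) (Fin 4) ℝ) (x : Pt) :
    Matrix (Fin 4) (Fin 4) ℝ := Matrix.of fun a b => pd m (fun y => A y a b) x

theorem pdMat_mul {A B : Pt → Matrix (Fin 4) (Fin 4) ℝ} {x : Pt}
    (hA : ∀ i j, DifferentiableAt ℝ (fun y => A y i j) x)
    (hB : ∀ i j, DifferentiableAt ℝ (fun y => B y i j) x) (m : Fin 4) :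
    pdMat m (fun y => A y * B y) x = pdMat m A x * B x + A x * pdMat m B x := by
  ext a b
  simp only [pdMat, Matrix.of_apply, Matrix.add_apply, Matrix.mul_apply]
  rw [pd_sum fun i _ => (hA a i).fun_mul (hB i b), ← Finset.sum_add_distrib]
  exact Finset.sum_congr rfl fun i _ => pd_mul (hA a i) (hB i b) m

theorem pd_apply {g : Pt → Met} {x : Pt} (hg : DifferentiableAt ℝ g x) (m a b : Fin 4) :
    pd m (fun y => g y a b) x = pd m g x a b :=
  pd_clm ((ContinuousLinearMap.proj b : (Fin 4 → ℝ) →L[ℝ] ℝ).comp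
    (ContinuousLinearMap.proj a : Met →L[ℝ] (Fin 4 → ℝ))) hg m

/-- A smooth metric with negative determinant on an open set. -/
structure IsMetric (U : Set Pt) (g : Pt → Met) : Prop where
  isOpen : IsOpen U
  smooth : ContDiffOn ℝ ∞ g U
  det_neg : ∀ x ∈ U, (Matrix.of (g x)).det < 0

variable {U : Set Pt} {g : Pt → Met}

namespace IsMetric

theorem smooth_entry (hg : IsMetric U g) (a b : Fin 4) : ContDiffOn ℝ ∞ (fun y => g y a b) U :=
  (contDiff_entry a b).comp_contDiffOn hg.smooth

theorem jet_mem (hg : IsMetric U g) {x : Pt} (hx : x ∈ U) : jet g x ∈ detNegJets := hg.det_neg x hx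

theorem comp_jet {V : Type*} [NormedAddCommGroup V] [NormedSpace ℝ V] (hg : IsMetric U g)
    {f : Jet Met → V} (hf : ContDiffOn ℝ ∞ f detNegJets) : ContDiffOn ℝ ∞ (fun y => f (jet g y)) U :=
  hf.comp (ContDiffOn.jet hg.smooth hg.isOpen) fun _ hx => hg.jet_mem hx

theorem smooth_lower (hg : IsMetric U g) (a b : Fin 4) :
    ContDiffOn ℝ ∞ (fun y => lower (g y) a b) U := hg.comp_jet (contDiffOn_lower_jet a b)

theorem smooth_sqrtNeg (hg : IsMetric U g) : ContDiffOn ℝ ∞ (fun y => sqrtNeg (g y)) U :=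
  contDiffOn_sqrtNeg.comp hg.smooth hg.det_neg

theorem sqrtNeg_pos (hg : IsMetric U g) {x : Pt} (hx : x ∈ U) : 0 < sqrtNeg (g x) :=
  GR.sqrtNeg_pos (hg.det_neg x hx)

theorem diff {V : Type*} [NormedAddCommGroup V] [NormedSpace ℝ V] (hg : IsMetric U g) {f : Pt → V}
    (hf : ContDiffOn ℝ ∞ f U) {x : Pt} (hx : x ∈ U) : DifferentiableAt ℝ f x :=
  ContDiffOn.diffAt hf hg.isOpen hx

theorem pdMat_metric (hg : IsMetric U g) {x : Pt} (hx : x ∈ U) (m : Fin 4) :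
    pdMat m (fun y => Matrix.of (g y)) x = Matrix.of (pd m g x) := by
  ext a b; exact pd_apply (hg.diff hg.smooth hx) m a b

/-- Differentiate `lower (g y) * g y = 1` and multiply by the inverse on the right. -/
theorem pdMat_lower (hg : IsMetric U g) {x : Pt} (hx : x ∈ U) (m : Fin 4) :
    pdMat m (fun y => lower (g y)) x = dLowerJet (jet g x) m := by
  have hne := (hg.det_neg x hx).ne
  have h1 : pdMat m (fun y => lower (g y) * Matrix.of (g y)) x = 0 := by
    ext a b
    refine (pd_congr_on hg.isOpen (g := fun _ => (1 : Matrix (Fin 4) (Fin 4) ℝ) a b)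
      (fun y hy => ?_) hx m).trans (pd_const m _ x)
    exact congrFun (congrFun (lower_mul (hg.det_neg y hy).ne) a) b
  rw [pdMat_mul (B := fun y => Matrix.of (g y)) (fun i j => hg.diff (hg.smooth_lower i j) hx)
    (fun i j => hg.diff (hg.smooth_entry i j) hx), hg.pdMat_metric hx] at h1
  have h2 := congrArg (· * lower (g x)) h1
  simp only [Matrix.add_mul, Matrix.zero_mul, Matrix.mul_assoc, mul_lower hne,
    Matrix.mul_one] at h2
  rw [eq_neg_of_add_eq_zero_left h2]
  simp only [dLowerJet, jet, Matrix.mul_assoc]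

theorem pd_lower (hg : IsMetric U g) {x : Pt} (hx : x ∈ U) (m a b : Fin 4) :
    pd m (fun y => lower (g y) a b) x = dLowerJet (jet g x) m a b :=
  congrFun (congrFun (hg.pdMat_lower hx m) a) b

theorem pdMat_dLower (hg : IsMetric U g) {x : Pt} (hx : x ∈ U) (k m : Fin 4) :
    pdMat k (fun y => dLowerJet (jet g y) m) x = ddLowerJet (jet g x) k m := by
  have dL := fun i j => hg.diff (hg.smooth_lower i j) hx
  have sd : ContDiffOn ℝ ∞ (pd m g) U := ContDiffOn.pd hg.smooth hg.isOpen m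
  have dd : ∀ i j, DifferentiableAt ℝ (fun y => Matrix.of (pd m g y) i j) x := fun i j =>
    hg.diff ((contDiff_entry i j).comp_contDiffOn sd) hx
  have dLd : ∀ i j, DifferentiableAt ℝ (fun y => (lower (g y) * Matrix.of (pd m g y)) i j) x :=
    fun i j => hg.diff (contDiffOn_matrix_mul hg.smooth_lower
      (fun i j => (contDiff_entry i j).comp_contDiffOn sd) i j) hx
  have e1 : pdMat k (fun y => dLowerJet (jet g y) m) x
      = -pdMat k (fun y => lower (g y) * Matrix.of (pd m g y) * lower (g y)) x := by
    ext a b; exact pd_neg _ x k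
  have e2 : pdMat k (fun y => Matrix.of (pd m g y)) x = Matrix.of (pd k (pd m g) x) := by
    ext a b; exact pd_apply (hg.diff sd hx) k a b
  rw [e1, pdMat_mul dLd dL, pdMat_mul dL dd, hg.pdMat_lower hx, e2]
  simp only [ddLowerJet, dLowerJet, jet]
  noncomm_ring

theorem christoffel_eq (hg : IsMetric U g) {x : Pt} (hx : x ∈ U) (l m n : Fin 4) :
    christoffel g l m n x = christoffelJet (jet g x) l m n := by
  simp only [christoffel, christoffelJet, hg.pd_lower hx]; rfl

theorem smooth_christoffel (hg : IsMetric U g) (l m n : Fin 4) :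
    ContDiffOn ℝ ∞ (christoffel g l m n) U :=
  (hg.comp_jet (contDiffOn_christoffelJet l m n)).congr fun _ hy => hg.christoffel_eq hy l m n

theorem pd_christoffel (hg : IsMetric U g) {x : Pt} (hx : x ∈ U) (k l m n : Fin 4) :
    pd k (christoffel g l m n) x = dChristoffelJet (jet g x) k l m n := by
  rw [pd_congr_on hg.isOpen (fun y hy => hg.christoffel_eq hy l m n) hx]
  have dl : ∀ m s n, DifferentiableAt ℝ (fun y => dLowerJet (jet g y) m s n) x := fun m s n =>
    hg.diff (hg.comp_jet (contDiffOn_dLowerJet m s n)) hx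
  have dg : ∀ l s, DifferentiableAt ℝ (fun y => g y l s) x := fun l s =>
    hg.diff (hg.smooth_entry l s) hx
  have db := fun s => ((dl m s n).fun_add (dl n s m)).fun_sub (dl s m n)
  have e : ∀ m s n, pd k (fun y => dLowerJet (jet g y) m s n) x = ddLowerJet (jet g x) k m s n :=
    fun m s n => congrFun (congrFun (hg.pdMat_dLower hx k m) s) n
  simp only [christoffelJet]
  change pd k (fun y => 1 / 2 * ∑ s, g y l s * (dLowerJet (jet g y) m s n
    + dLowerJet (jet g y) n s m - dLowerJet (jet g y) s m n)) x = _
  rw [pd_const_mul (DifferentiableAt.fun_sum fun s _ => (dg l s).fun_mul (db s)),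
    pd_sum fun s _ => (dg l s).fun_mul (db s)]
  unfold dChristoffelJet
  congr 1
  refine Finset.sum_congr rfl fun s _ => ?_
  rw [pd_mul (dg l s) (db s), pd_sub ((dl m s n).fun_add (dl n s m)) (dl s m n),
    pd_add (dl m s n) (dl n s m), e, e, e, pd_apply (hg.diff hg.smooth hx)]
  rfl

theorem ricci_eq (hg : IsMetric U g) {x : Pt} (hx : x ∈ U) (a b : Fin 4) :
    ricci g a b x = ricciJet (jet g x) a b := by
  simp only [ricci, ricciJet, hg.pd_christoffel hx, hg.christoffel_eq hx]

theorem scalarCurvature_eq (hg : IsMetric U g) {x : Pt} (hx : x ∈ U) :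
    scalarCurvature g x = scalarJet (jet g x) := by
  simp only [scalarCurvature, scalarJet, hg.ricci_eq hx]; rfl

theorem smooth_ricci (hg : IsMetric U g) (a b : Fin 4) : ContDiffOn ℝ ∞ (ricci g a b) U :=
  (hg.comp_jet (contDiffOn_ricciJet a b)).congr fun _ hy => hg.ricci_eq hy a b

theorem smooth_scalarCurvature (hg : IsMetric U g) : ContDiffOn ℝ ∞ (scalarCurvature g) U :=
  (hg.comp_jet contDiffOn_scalarJet).congr fun _ hy => hg.scalarCurvature_eq hy

theorem pd_sqrtNeg (hg : IsMetric U g) {x : Pt} (hx : x ∈ U) (m : Fin 4) :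
    pd m (fun y => sqrtNeg (g y)) x
      = -(1 / 2) * sqrtNeg (g x) * ∑ a, ∑ b, lower (g x) a b * pd m g x b a := by
  have h1 := (ContDiffOn.diffAt contDiffOn_sqrtNeg isOpen_det_neg (hg.det_neg x hx)).hasFDerivAt
  have := (h1.comp x (hg.diff hg.smooth hx).hasFDerivAt).fderiv
  rw [← fderiv_sqrtNeg (hg.det_neg x hx)]
  unfold pd
  rw [show (fun y => sqrtNeg (g y)) = sqrtNeg ∘ g from rfl, this]; rfl

section Symmetric

theorem pd_lower_symm (hg : IsMetric U g)
    (hs : ∀ x ∈ U, ∀ a b, g x a b = g x b a) {x : Pt} (hx : x ∈ U) (m a b : Fin 4) :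
    pd m (fun y => lower (g y) a b) x = pd m (fun y => lower (g y) b a) x :=
  pd_congr_on hg.isOpen (fun y hy => lower_symm (hs y hy) a b) hx m

theorem christoffel_symm (hg : IsMetric U g)
    (hs : ∀ x ∈ U, ∀ a b, g x a b = g x b a) {x : Pt} (hx : x ∈ U) (l m n : Fin 4) :
    christoffel g l m n x = christoffel g l n m x := by
  unfold christoffel
  congr 1
  refine Finset.sum_congr rfl fun s _ => ?_
  rw [hg.pd_lower_symm hs hx s m n]; ring

/-- Metric compatibility, `∇_m g^{ab} = 0`. Raising both indices of `∂_m g_{sk}` gives `-∂_m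
g^{ab}`, and in the sum of the two Christoffel terms the remaining metric derivatives are
antisymmetric in `a, b` and cancel. -/
theorem pd_metric (hg : IsMetric U g)
    (hs : ∀ x ∈ U, ∀ a b, g x a b = g x b a) {x : Pt} (hx : x ∈ U) (m a b : Fin 4) :
    pd m g x a b = -∑ k, (christoffel g a m k x * g x k b + christoffel g b m k x * g x a k) := by
  set D : Fin 4 → Fin 4 → Fin 4 → ℝ := fun m s n => pd m (fun y => lower (g y) s n) x with hD
  have hDs : ∀ m s n, D m s n = D m n s := fun m s n => hg.pd_lower_symm hs hx m s n
  have hsx := hs x hx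
  have hne := (hg.det_neg x hx).ne
  have hT : ∑ k, ∑ s, g x a s * D m s k * g x k b = -pd m g x a b := by
    have h1 : Matrix.of (g x) * dLowerJet (jet g x) m * Matrix.of (g x) = -Matrix.of (pd m g x) := by
      simp only [dLowerJet, jet, Matrix.mul_neg, Matrix.neg_mul, Matrix.mul_assoc, lower_mul hne,
        Matrix.mul_one]
      rw [← Matrix.mul_assoc, mul_lower hne, Matrix.one_mul]
    have h2 := congrFun (congrFun h1 a) b
    simp only [Matrix.mul_apply, Matrix.of_apply, Matrix.neg_apply, Finset.sum_mul] at h2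
    simp only [hD, hg.pd_lower hx]
    exact h2
  have hT' : ∑ k, ∑ s, g x b s * D m s k * g x k a = ∑ k, ∑ s, g x a s * D m s k * g x k b := by
    rw [Finset.sum_comm]
    refine Finset.sum_congr rfl fun k _ => Finset.sum_congr rfl fun s _ => ?_
    rw [hDs m k s, hsx b k, hsx s a]; ring
  have hS : ∀ a b, ∑ k, ∑ s, g x a s * D s m k * g x k b = ∑ k, ∑ s, g x b s * D k s m * g x k a := by
    intro a b
    rw [Finset.sum_comm]
    refine Finset.sum_congr rfl fun k _ => Finset.sum_congr rfl fun s _ => ?_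
    rw [hDs k m s, hsx a k, hsx s b]; ring
  have hΓ : ∀ a b, ∑ k, christoffel g a m k x * g x k b
      = 1 / 2 * (∑ k, ∑ s, g x a s * D m s k * g x k b + ∑ k, ∑ s, g x a s * D k s m * g x k b
        - ∑ k, ∑ s, g x b s * D k s m * g x k a) := by
    intro a b
    rw [← hS a b, ← Finset.sum_add_distrib, ← Finset.sum_sub_distrib, Finset.mul_sum]
    refine Finset.sum_congr rfl fun k _ => ?_
    rw [← Finset.sum_add_distrib, ← Finset.sum_sub_distrib, christoffel, mul_assoc, Finset.sum_mul]
    congr 1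
    exact Finset.sum_congr rfl fun s _ => by ring
  have hb : ∑ k, christoffel g b m k x * g x a k = ∑ k, christoffel g b m k x * g x k a :=
    Finset.sum_congr rfl fun k _ => by rw [hsx a k]
  rw [Finset.sum_add_distrib, hb, hΓ a b, hΓ b a, hT', hT]
  ring

/-- In the contracted symbol `Γ^m_{mn}` two of the three metric derivatives cancel by symmetry of
`g`; the third is the trace produced by Jacobi's formula. -/
theorem pd_sqrtNeg_eq (hg : IsMetric U g)
    (hs : ∀ x ∈ U, ∀ a b, g x a b = g x b a) {x : Pt} (hx : x ∈ U) (n : Fin 4) :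
    pd n (fun y => sqrtNeg (g y)) x = sqrtNeg (g x) * ∑ m, christoffel g m m n x := by
  have hsx := hs x hx
  have hne := (hg.det_neg x hx).ne
  have h1 : ∑ m, ∑ s, g x m s * pd m (fun y => lower (g y) s n) x
      = ∑ m, ∑ s, g x m s * pd s (fun y => lower (g y) m n) x := by
    rw [Finset.sum_comm]
    exact Finset.sum_congr rfl fun m _ => Finset.sum_congr rfl fun s _ => by rw [hsx]
  have h2 : ∑ m, ∑ s, g x m s * pd n (fun y => lower (g y) s m) x
      = -∑ a, ∑ b, lower (g x) a b * pd n g x b a := by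
    have e : (Matrix.of (g x) * dLowerJet (jet g x) n).trace
        = -(lower (g x) * Matrix.of (pd n g x)).trace := by
      rw [dLowerJet, Matrix.mul_neg, Matrix.trace_neg, ← Matrix.mul_assoc, Matrix.trace_mul_comm,
        ← Matrix.mul_assoc, ← Matrix.mul_assoc]
      simp only [jet]
      rw [Matrix.mul_assoc (lower (g x)), mul_lower hne, Matrix.mul_one]
    simp only [hg.pd_lower hx]
    exact e
  have h3 : ∑ m, christoffel g m m n x = 1 / 2 * ∑ m, ∑ s,
      g x m s * pd n (fun y => lower (g y) s m) x := by
    simp only [christoffel, ← Finset.mul_sum, mul_add, mul_sub, Finset.sum_add_distrib,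
      Finset.sum_sub_distrib, h1]
    ring
  rw [hg.pd_sqrtNeg hx, h3, h2]; ring

theorem pd_log_sqrtNeg (hg : IsMetric U g)
    (hs : ∀ x ∈ U, ∀ a b, g x a b = g x b a) {x : Pt} (hx : x ∈ U) (n : Fin 4) :
    pd n (fun y => Real.log (sqrtNeg (g y))) x = ∑ m, christoffel g m m n x := by
  have h1 := (hg.diff hg.smooth_sqrtNeg hx).hasFDerivAt.log (hg.sqrtNeg_pos hx).ne'
  have h2 := hg.pd_sqrtNeg_eq hs hx n
  unfold pd at h2 ⊢
  rw [h1.fderiv]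
  simp only [smul_apply, h2, smul_eq_mul]
  rw [inv_mul_cancel_left₀ (hg.sqrtNeg_pos hx).ne']

/-- The only piece not visibly symmetric is `∂_b Γ^m_{am}`, and it equals `∂_b ∂_a log √(-g)`.
Symmetry matters because variations along `symUnit a b` detect only the symmetric part of the
Einstein tensor. -/
theorem ricci_symm (hg : IsMetric U g)
    (hs : ∀ x ∈ U, ∀ a b, g x a b = g x b a) {x : Pt} (hx : x ∈ U) (a b : Fin 4) : ricci g a b x = ricci g b a x := by
  have hlog : ContDiffOn ℝ ∞ (fun y => Real.log (sqrtNeg (g y))) U :=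
    hg.smooth_sqrtNeg.log fun y hy => (hg.sqrtNeg_pos hy).ne'
  have htr : ∀ a b, ∑ m, pd b (christoffel g m a m) x
      = pd b (pd a fun y => Real.log (sqrtNeg (g y))) x := by
    intro a b
    rw [pd_congr_on hg.isOpen (fun y hy => hg.pd_log_sqrtNeg hs hy a) hx b,
      pd_sum fun m _ => hg.diff (hg.smooth_christoffel m m a) hx]
    exact Finset.sum_congr rfl fun m _ =>
      pd_congr_on hg.isOpen (fun y hy => hg.christoffel_symm hs hy m a m) hx b
  have h1 : ∀ m, pd m (christoffel g m a b) x = pd m (christoffel g m b a) x := fun m =>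
    pd_congr_on hg.isOpen (fun y hy => hg.christoffel_symm hs hy m a b) hx m
  have h2 : ∑ m, ∑ n, christoffel g m b n x * christoffel g n a m x
      = ∑ m, ∑ n, christoffel g m a n x * christoffel g n b m x := by
    rw [Finset.sum_comm]
    exact Finset.sum_congr rfl fun m _ => Finset.sum_congr rfl fun n _ => mul_comm _ _
  simp only [ricci, Finset.sum_add_distrib, Finset.sum_sub_distrib, htr, h1, h2,
    hg.christoffel_symm hs hx _ a b, pd_comm hlog hg.isOpen hx a b]

end Symmetric

end IsMetric

end Curvature

end GR

namespace GR

open Filter Topology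

/-! ### The algebra of the Palatini identity -/

section Palatini

theorem sum4_swap_first {f : Fin 4 → Fin 4 → Fin 4 → Fin 4 → ℝ} :
    ∑ a, ∑ b, ∑ c, ∑ d, f a b c d = ∑ b, ∑ a, ∑ c, ∑ d, f a b c d := Finset.sum_comm

theorem sum4_swap_middle {f : Fin 4 → Fin 4 → Fin 4 → Fin 4 → ℝ} :
    ∑ a, ∑ b, ∑ c, ∑ d, f a b c d = ∑ a, ∑ c, ∑ b, ∑ d, f a b c d :=
  Finset.sum_congr rfl fun _ _ => Finset.sum_comm

theorem sum4_swap_last {f : Fin 4 → Fin 4 → Fin 4 → Fin 4 → ℝ} :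
    ∑ a, ∑ b, ∑ c, ∑ d, f a b c d = ∑ a, ∑ b, ∑ d, ∑ c, f a b c d :=
  Finset.sum_congr rfl fun _ _ => Finset.sum_congr rfl fun _ _ => Finset.sum_comm

/-- The variation of the Ricci tensor, contracted with the metric, is a divergence: the algebraic
content of the Palatini identity. -/
theorem palatini_algebra {g : Fin 4 → Fin 4 → ℝ} {Γ C : Fin 4 → Fin 4 → Fin 4 → ℝ}
    {dC : Fin 4 → Fin 4 → Fin 4 → Fin 4 → ℝ} {dg : Fin 4 → Fin 4 → Fin 4 → ℝ}
    (hg : ∀ a b, g a b = g b a) (hΓ : ∀ l m n, Γ l m n = Γ l n m) (hC : ∀ l m n, C l m n = C l n m)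
    (hdg : ∀ m a b, dg m a b = -∑ k, (Γ a m k * g k b + Γ b m k * g a k)) :
    ∑ a, ∑ b, g a b * ∑ m, (dC m m a b - dC b m a m
      + ∑ n, (C m m n * Γ n a b + Γ m m n * C n a b - (C m b n * Γ n a m + Γ m b n * C n a m)))
    = ∑ m, ((∑ k, Γ k k m) * (∑ a, ∑ b, g a b * C m a b - ∑ a, ∑ n, g a m * C n a n)
      + (∑ a, ∑ b, (dg m a b * C m a b + g a b * dC m m a b)
        - ∑ a, ∑ n, (dg m a m * C n a n + g a m * dC m n a n))) := by
  -- Here `C` plays the variation of the Christoffel symbols and `dC` its derivatives. The right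
  -- side is the covariant divergence of `V^m = g^{ab} C^m_{ab} - g^{am} C^n_{an}`, written out.
  -- Each contraction is brought to a common index order; substituting `hdg` for `dg` then leaves a
  -- linear identity.
  have e1 : ∑ a, ∑ b, g a b * ∑ m, dC m m a b = ∑ m, ∑ a, ∑ b, g a b * dC m m a b := by
    simp only [Finset.mul_sum]
    rw [Finset.sum_congr rfl fun a _ => Finset.sum_comm, Finset.sum_comm]
  have e2 : ∑ a, ∑ b, g a b * ∑ m, dC b m a m = ∑ m, ∑ a, ∑ n, g a m * dC m n a n := by
    simp only [Finset.mul_sum]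
    exact Finset.sum_comm
  have e3 : ∑ a, ∑ b, g a b * ∑ m, ∑ n, C m m n * Γ n a b
      = ∑ m, ∑ a, ∑ n, (∑ k, Γ a m k * g k m) * C n a n := by
    simp only [Finset.mul_sum, Finset.sum_mul]
    rw [sum4_swap_last, sum4_swap_middle, sum4_swap_last]
    refine Finset.sum_congr rfl fun m _ => Finset.sum_congr rfl fun a _ =>
      Finset.sum_congr rfl fun n _ => Finset.sum_congr rfl fun k _ => ?_
    rw [hg m k, hC n n a]; ring
  have e4 : ∑ a, ∑ b, g a b * ∑ m, ∑ n, Γ m m n * C n a b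
      = ∑ m, (∑ k, Γ k k m) * ∑ a, ∑ b, g a b * C m a b := by
    simp only [Finset.mul_sum]
    rw [sum4_swap_last, sum4_swap_middle, sum4_swap_first, sum4_swap_last, sum4_swap_middle]
    refine Finset.sum_congr rfl fun m _ => ?_
    simp only [← Finset.mul_sum]
    rw [Finset.sum_mul]
    refine Finset.sum_congr rfl fun k _ => ?_
    simp only [Finset.mul_sum]
    exact Finset.sum_congr rfl fun a _ => Finset.sum_congr rfl fun b _ => by ring
  have e5 : ∑ a, ∑ b, g a b * ∑ m, ∑ n, C m b n * Γ n a m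
      = ∑ m, ∑ a, ∑ b, (∑ k, Γ a m k * g k b) * C m a b := by
    simp only [Finset.mul_sum, Finset.sum_mul]
    rw [sum4_swap_first, sum4_swap_middle, sum4_swap_first, sum4_swap_last, sum4_swap_middle]
    refine Finset.sum_congr rfl fun m _ => Finset.sum_congr rfl fun a _ =>
      Finset.sum_congr rfl fun b _ => Finset.sum_congr rfl fun k _ => ?_
    rw [hC m b a, hΓ a k m]; ring
  have e6 : ∑ a, ∑ b, g a b * ∑ m, ∑ n, Γ m b n * C n a m
      = ∑ m, ∑ a, ∑ b, (∑ k, Γ b m k * g a k) * C m a b := by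
    simp only [Finset.mul_sum, Finset.sum_mul]
    rw [sum4_swap_last, sum4_swap_middle, sum4_swap_first, sum4_swap_last]
    refine Finset.sum_congr rfl fun m _ => Finset.sum_congr rfl fun a _ =>
      Finset.sum_congr rfl fun b _ => Finset.sum_congr rfl fun k _ => ?_
    rw [hΓ b k m]; ring
  -- This half of `∂_m g^{am}` cancels the part of `Γ^k_{km} V^m` that has no counterpart in the
  -- variation of Ricci.
  have e7 : ∑ m, ∑ a, ∑ n, (∑ k, Γ m m k * g a k) * C n a n
      = ∑ m, (∑ k, Γ k k m) * ∑ a, ∑ n, g a m * C n a n := by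
    simp only [Finset.sum_mul]
    rw [sum4_swap_last, sum4_swap_middle, sum4_swap_first]
    refine Finset.sum_congr rfl fun m _ => Finset.sum_congr rfl fun k _ => ?_
    simp only [Finset.mul_sum]
    exact Finset.sum_congr rfl fun a _ => Finset.sum_congr rfl fun b _ => by ring
  simp only [hdg, mul_sub, mul_add, Finset.sum_add_distrib, Finset.sum_sub_distrib, neg_mul,
    add_mul, Finset.sum_neg_distrib, e1, e2, e3, e4, e5, e6, e7]
  ring

end Palatini

end GR

namespace GR

open Filter Topology MeasureTheory

/-! ### The variation of curvature and the Euler-Lagrange expression of `√(-g) R` -/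

section PalatiniVariation

variable {U : Set Pt} {g δg : Pt → Met}

/-- The first variation of the Christoffel symbols. -/
noncomputable def christoffelVar (g δg : Pt → Met) (l m n : Fin 4) (x : Pt) : ℝ :=
  fderiv ℝ (fun j => christoffelJet j l m n) (jet g x) (jet δg x)

theorem IsMetric.smooth_christoffelVar (hg : IsMetric U g) (hδ : ContDiffOn ℝ ∞ δg U)
    (l m n : Fin 4) : ContDiffOn ℝ ∞ (christoffelVar g δg l m n) U :=
  ContDiffOn.clm_apply
    (hg.comp_jet ((contDiffOn_christoffelJet l m n).fderiv_of_isOpen isOpen_detNegJets (by simp)))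
    (ContDiffOn.jet hδ hg.isOpen)

theorem IsMetric.hasDerivAt_jet (hg : IsMetric U g) {f : Jet Met → ℝ}
    (hf : ContDiffOn ℝ ∞ f detNegJets) {x : Pt} (hx : x ∈ U) (v : Jet Met) :
    HasDerivAt (fun ε : ℝ => f (jet g x + ε • v)) (fderiv ℝ f (jet g x) v) 0 :=
  hasDerivAt_line (ContDiffOn.diffAt hf isOpen_detNegJets (hg.jet_mem hx)) v

/-- The varied metric has negative determinant only on a smaller open set depending on `ε`. Each
point of `U` lies in it for small `ε`, so the formulas for metrics may be used there before
differentiating at `0`. -/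
theorem IsMetric.perturb (hg : IsMetric U g) (hδ : ContDiffOn ℝ ∞ δg U) (ε : ℝ) :
    IsMetric {y | y ∈ U ∧ (Matrix.of (g y + ε • δg y)).det < 0} (fun y => g y + ε • δg y) where
  isOpen := (hg.smooth.add (hδ.const_smul ε) :
    ContDiffOn ℝ ∞ (fun y => g y + ε • δg y) U).continuousOn.isOpen_inter_preimage
      hg.isOpen isOpen_det_neg
  smooth := (hg.smooth.add (hδ.const_smul ε) :
    ContDiffOn ℝ ∞ (fun y => g y + ε • δg y) U).mono fun _ hy => hy.1
  det_neg := fun _ hy => hy.2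

theorem IsMetric.eventually_mem_perturb (hg : IsMetric U g) {x : Pt} (hx : x ∈ U) (v : Met) :
    ∀ᶠ ε in 𝓝 (0 : ℝ), x ∈ U ∧ (Matrix.of (g x + ε • v)).det < 0 := by
  have hc : Continuous fun ε : ℝ => g x + ε • v := by fun_prop
  have := hc.continuousAt.eventually_mem (x := 0)
    (isOpen_det_neg.mem_nhds (by simpa using hg.det_neg x hx))
  exact this.mono fun ε h => ⟨hx, h⟩

/-- The symbols of the symmetric metric `g + ε δg` are symmetric in their lower indices for all
small `ε`; differentiate at `0`. -/
theorem IsMetric.christoffelVar_symm (hg : IsMetric U g) (hδ : ContDiffOn ℝ ∞ δg U)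
    (hs : ∀ x ∈ U, ∀ a b, g x a b = g x b a) (hδs : ∀ x ∈ U, ∀ a b, δg x a b = δg x b a)
    {x : Pt} (hx : x ∈ U) (l m n : Fin 4) :
    christoffelVar g δg l m n x = christoffelVar g δg l n m x := by
  refine (hg.hasDerivAt_jet (contDiffOn_christoffelJet l m n) hx _).unique
    ((hg.hasDerivAt_jet (contDiffOn_christoffelJet l n m) hx _).congr_of_eventuallyEq ?_)
  filter_upwards [hg.eventually_mem_perturb hx (δg x)] with ε hε
  have hp := hg.perturb hδ ε
  rw [← jet_add_smul hg.smooth hδ hg.isOpen hx, ← hp.christoffel_eq hε, ← hp.christoffel_eq hε]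
  refine hp.christoffel_symm (fun y hy a b => ?_) hε l m n
  simp [hs y hy.1 a b, hδs y hy.1 a b]

/-- The variation commutes with partial differentiation of the Christoffel symbols. -/
theorem IsMetric.hasDerivAt_dChristoffelJet (hg : IsMetric U g) (hδ : ContDiffOn ℝ ∞ δg U)
    {x : Pt} (hx : x ∈ U) (k l m n : Fin 4) :
    HasDerivAt (fun ε : ℝ => dChristoffelJet (jet g x + ε • jet δg x) k l m n)
      (pd k (christoffelVar g δg l m n) x) 0 := by
  set N : Set (ℝ × Pt) := {q | q.2 ∈ U ∧ jet g q.2 + q.1 • jet δg q.2 ∈ detNegJets}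
  have hN : IsOpen N := isOpen_jet_line isOpen_detNegJets hg.smooth hδ hg.isOpen
  set F : ℝ × Pt → ℝ := fun q => christoffelJet (jet g q.2 + q.1 • jet δg q.2) l m n
  have hF : ContDiffOn ℝ ∞ F N := (contDiffOn_christoffelJet l m n).comp
    (contDiffOn_jet_line hg.smooth hδ hg.isOpen) fun q hq => hq.2
  have hmem : ∀ y ∈ U, ((0 : ℝ), y) ∈ N := fun y hy => ⟨hy, by simpa using hg.jet_mem hy⟩
  have hε : ∀ ε y, HasDerivAt (fun t : ℝ => (t, y)) ((1 : ℝ), (0 : Pt)) ε := fun ε y =>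
    (hasDerivAt_id _).prodMk (hasDerivAt_const _ y)
  have hy : ∀ (ε : ℝ) (y : Pt), HasFDerivAt (fun z : Pt => (ε, z)) (ContinuousLinearMap.inr ℝ ℝ Pt) y :=
    fun ε y => hasFDerivAt_prodMk_right ε y
  -- `F (ε, x)` is the Christoffel symbol of the varied metric. The left side is its coordinate
  -- derivative, `christoffelVar` is its `ε`-derivative at `0`, and the two commute by Schwarz's
  -- theorem on `ℝ × Pt`.
  have h1 : ∀ᶠ ε in 𝓝 (0 : ℝ), dChristoffelJet (jet g x + ε • jet δg x) k l m n
      = fderiv ℝ F (ε, x) (0, Pi.single k 1) := by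
    filter_upwards [hg.eventually_mem_perturb hx (δg x)] with ε he
    have hp := hg.perturb hδ ε
    rw [← jet_add_smul hg.smooth hδ hg.isOpen hx, ← hp.pd_christoffel he,
      pd_congr_on hp.isOpen (g := fun y => F (ε, y)) (fun y hy => ?_) he]
    · have hq : ((ε, x) : ℝ × Pt) ∈ N := ⟨hx, he.2⟩
      have := ((ContDiffOn.diffAt hF hN hq).hasFDerivAt.comp x (hy ε x)).fderiv
      unfold pd
      rw [show (fun y => F (ε, y)) = F ∘ fun z => (ε, z) from rfl, this]
      rfl
    · rw [hp.christoffel_eq hy, jet_add_smul hg.smooth hδ hg.isOpen hy.1]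
  have h2 : ∀ y ∈ U, christoffelVar g δg l m n y = fderiv ℝ F (0, y) (1, 0) := fun y hyU =>
    (hg.hasDerivAt_jet (contDiffOn_christoffelJet l m n) hyU _).unique
      (show HasDerivAt (F ∘ fun ε : ℝ => (ε, y)) _ 0 from
        (ContDiffOn.diffAt hF hN (hmem y hyU)).hasFDerivAt.comp_hasDerivAt 0 (hε 0 y))
  have hF' : ∀ v, ContDiffOn ℝ ∞ (fun q => fderiv ℝ F q v) N := fun v =>
    (hF.fderiv_of_isOpen hN (by simp)).clm_apply contDiffOn_const
  have h3 := (ContDiffOn.diffAt (hF' (0, Pi.single k 1)) hN (hmem x hx)).hasFDerivAt.comp_hasDerivAt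
    0 (hε 0 x)
  rw [fderiv_apply_comm hF hN (hmem x hx)] at h3
  have h4 : pd k (christoffelVar g δg l m n) x
      = fderiv ℝ (fun q => fderiv ℝ F q (1, 0)) (0, x) (0, Pi.single k 1) := by
    rw [pd_congr_on hg.isOpen h2 hx]
    have := ((ContDiffOn.diffAt (hF' (1, 0)) hN (hmem x hx)).hasFDerivAt.comp x (hy 0 x)).fderiv
    unfold pd
    rw [show (fun y => fderiv ℝ F (0, y) (1, 0)) = (fun q => fderiv ℝ F q (1, 0)) ∘ fun z => (0, z)
      from rfl, this]
    rfl
  rw [h4]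
  exact h3.congr_of_eventuallyEq h1

/-- The first variation of the Ricci tensor. -/
noncomputable def ricciVar (g δg : Pt → Met) (a b : Fin 4) (x : Pt) : ℝ :=
  ∑ m, (pd m (christoffelVar g δg m a b) x - pd b (christoffelVar g δg m a m) x
    + ∑ n, (christoffelVar g δg m m n x * christoffel g n a b x
      + christoffel g m m n x * christoffelVar g δg n a b x
      - (christoffelVar g δg m b n x * christoffel g n a m x
        + christoffel g m b n x * christoffelVar g δg n a m x)))

theorem IsMetric.hasDerivAt_ricciJet (hg : IsMetric U g) (hδ : ContDiffOn ℝ ∞ δg U)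
    {x : Pt} (hx : x ∈ U) (a b : Fin 4) :
    HasDerivAt (fun ε : ℝ => ricciJet (jet g x + ε • jet δg x) a b) (ricciVar g δg a b x) 0 := by
  have hd := fun k l m n => hg.hasDerivAt_dChristoffelJet hδ hx k l m n
  have hc : ∀ l m n, HasDerivAt (fun ε : ℝ => christoffelJet (jet g x + ε • jet δg x) l m n)
      (christoffelVar g δg l m n x) 0 := fun l m n =>
    hg.hasDerivAt_jet (contDiffOn_christoffelJet l m n) hx (jet δg x)
  unfold ricciJet ricciVar
  refine HasDerivAt.fun_sum fun m _ => ((hd m m a b).fun_sub (hd b m a m)).fun_add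
    (HasDerivAt.fun_sum fun n _ => ?_)
  have h := ((hc m m n).fun_mul (hc n a b)).fun_sub ((hc m b n).fun_mul (hc n a m))
  simpa only [zero_smul, add_zero, ← hg.christoffel_eq hx] using h

theorem IsMetric.hasDerivAt_scalarJet (hg : IsMetric U g) (hδ : ContDiffOn ℝ ∞ δg U)
    {x : Pt} (hx : x ∈ U) :
    HasDerivAt (fun ε : ℝ => scalarJet (jet g x + ε • jet δg x))
      (∑ a, ∑ b, δg x a b * ricci g a b x + ∑ a, ∑ b, g x a b * ricciVar g δg a b x) 0 := by
  simp only [← Finset.sum_add_distrib]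
  refine HasDerivAt.fun_sum fun a _ => HasDerivAt.fun_sum fun b _ => ?_
  have h1 : HasDerivAt (fun ε : ℝ => (jet g x + ε • jet δg x).1 a b) (δg x a b) 0 := by
    have : HasDerivAt (fun ε : ℝ => g x a b + ε * δg x a b) (1 * δg x a b) 0 :=
      ((hasDerivAt_id (0 : ℝ)).mul_const _).const_add _
    rw [one_mul] at this
    exact this
  have h := h1.fun_mul (hg.hasDerivAt_ricciJet hδ hx a b)
  simp only [zero_smul, add_zero, ← hg.ricci_eq hx] at h
  exact h

/-- The density `√(-g) R`. -/
noncomputable def hilbertDensity (j : Jet Met) : ℝ := sqrtNeg j.1 * scalarJet j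

theorem contDiffOn_sqrtNeg_jet : ContDiffOn ℝ ∞ (fun j : Jet Met => sqrtNeg j.1) detNegJets :=
  contDiffOn_sqrtNeg.comp contDiff_fst.contDiffOn fun _ hj => hj

theorem contDiffOn_hilbertDensity : ContDiffOn ℝ ∞ hilbertDensity detNegJets :=
  contDiffOn_sqrtNeg_jet.mul contDiffOn_scalarJet

/-- The current whose divergence is `√(-g) g^{ab} δR_{ab}`. -/
noncomputable def palatiniCurrent (g δg : Pt → Met) (m : Fin 4) (x : Pt) : ℝ :=
  sqrtNeg (g x) * (∑ a, ∑ b, g x a b * christoffelVar g δg m a b x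
    - ∑ a, ∑ n, g x a m * christoffelVar g δg n a n x)

theorem IsMetric.smooth_palatiniCurrent (hg : IsMetric U g) (hδ : ContDiffOn ℝ ∞ δg U)
    (m : Fin 4) : ContDiffOn ℝ ∞ (palatiniCurrent g δg m) U :=
  hg.smooth_sqrtNeg.mul ((ContDiffOn.sum fun a _ => ContDiffOn.sum fun b _ =>
    (hg.smooth_entry a b).mul (hg.smooth_christoffelVar hδ m a b)).sub
    (ContDiffOn.sum fun a _ => ContDiffOn.sum fun n _ =>
      (hg.smooth_entry a m).mul (hg.smooth_christoffelVar hδ n a n)))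

/-- Since `∂_m √(-g) = √(-g) Γ^k_{km}`, the factor `√(-g)` turns the covariant divergence of
`palatini_algebra` into an ordinary one. -/
theorem IsMetric.palatini (hg : IsMetric U g) (hδ : ContDiffOn ℝ ∞ δg U)
    (hs : ∀ x ∈ U, ∀ a b, g x a b = g x b a) (hδs : ∀ x ∈ U, ∀ a b, δg x a b = δg x b a)
    {x : Pt} (hx : x ∈ U) :
    sqrtNeg (g x) * ∑ a, ∑ b, g x a b * ricciVar g δg a b x
      = ∑ m, pd m (palatiniCurrent g δg m) x := by
  have dC := fun l m n => hg.diff (hg.smooth_christoffelVar hδ l m n) hx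
  have dg := fun a b => hg.diff (hg.smooth_entry a b) hx
  have h1 : ∀ m, pd m (palatiniCurrent g δg m) x
      = sqrtNeg (g x) * ((∑ k, christoffel g k k m x)
          * (∑ a, ∑ b, g x a b * christoffelVar g δg m a b x
            - ∑ a, ∑ n, g x a m * christoffelVar g δg n a n x)
        + (∑ a, ∑ b, (pd m g x a b * christoffelVar g δg m a b x
              + g x a b * pd m (christoffelVar g δg m a b) x)
          - ∑ a, ∑ n, (pd m g x a m * christoffelVar g δg n a n x
              + g x a m * pd m (christoffelVar g δg n a n) x))) := by
    intro m
    have d1 := fun a b => (dg a b).fun_mul (dC m a b)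
    have d2 := fun a n => (dg a m).fun_mul (dC n a n)
    have s1 := fun a => DifferentiableAt.fun_sum (u := Finset.univ) fun b _ => d1 a b
    have s2 := fun a => DifferentiableAt.fun_sum (u := Finset.univ) fun n _ => d2 a n
    have t1 := DifferentiableAt.fun_sum (u := Finset.univ) fun a _ => s1 a
    have t2 := DifferentiableAt.fun_sum (u := Finset.univ) fun a _ => s2 a
    have p1 : pd m (fun y => ∑ a, ∑ b, g y a b * christoffelVar g δg m a b y) x
        = ∑ a, ∑ b, (pd m g x a b * christoffelVar g δg m a b x
              + g x a b * pd m (christoffelVar g δg m a b) x) := by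
      rw [pd_sum fun a _ => s1 a]
      refine Finset.sum_congr rfl fun a _ => ?_
      rw [pd_sum fun b _ => d1 a b]
      refine Finset.sum_congr rfl fun b _ => ?_
      rw [pd_mul (dg a b) (dC m a b), pd_apply (hg.diff hg.smooth hx)]
    have p2 : pd m (fun y => ∑ a, ∑ n, g y a m * christoffelVar g δg n a n y) x
        = ∑ a, ∑ n, (pd m g x a m * christoffelVar g δg n a n x
              + g x a m * pd m (christoffelVar g δg n a n) x) := by
      rw [pd_sum fun a _ => s2 a]
      refine Finset.sum_congr rfl fun a _ => ?_
      rw [pd_sum fun n _ => d2 a n]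
      refine Finset.sum_congr rfl fun n _ => ?_
      rw [pd_mul (dg a m) (dC n a n), pd_apply (hg.diff hg.smooth hx)]
    unfold palatiniCurrent
    rw [pd_mul (hg.diff hg.smooth_sqrtNeg hx) (t1.fun_sub t2), pd_sub t1 t2, p1, p2,
      hg.pd_sqrtNeg_eq hs hx]
    ring
  have h2 := palatini_algebra (dC := fun k l m n => pd k (christoffelVar g δg l m n) x)
    (dg := fun m a b => pd m g x a b) (hs x hx) (hg.christoffel_symm hs hx)
    (hg.christoffelVar_symm hδ hs hδs hx) (hg.pd_metric hs hx)
  simp only [ricciVar]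
  rw [h2, Finset.mul_sum]
  exact Finset.sum_congr rfl fun m _ => (h1 m).symm

/-- The first variation of `√(-g) R`. -/
theorem IsMetric.fderiv_hilbertDensity (hg : IsMetric U g) (hδ : ContDiffOn ℝ ∞ δg U)
    (hs : ∀ x ∈ U, ∀ a b, g x a b = g x b a) (hδs : ∀ x ∈ U, ∀ a b, δg x a b = δg x b a)
    {x : Pt} (hx : x ∈ U) :
    fderiv ℝ hilbertDensity (jet g x) (jet δg x)
      = sqrtNeg (g x) * ∑ a, ∑ b, einstein g a b x * δg x a b
        + ∑ m, pd m (palatiniCurrent g δg m) x := by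
  rw [← hg.palatini hδ hs hδs hx]
  refine (hg.hasDerivAt_jet contDiffOn_hilbertDensity hx (jet δg x)).unique ?_
  have h1 : HasDerivAt (fun ε : ℝ => sqrtNeg (jet g x + ε • jet δg x).1)
      (-(1 / 2) * sqrtNeg (g x) * ∑ a, ∑ b, lower (g x) a b * δg x b a) 0 := by
    rw [← fderiv_sqrtNeg (hg.det_neg x hx)]
    exact hasDerivAt_line (ContDiffOn.diffAt contDiffOn_sqrtNeg isOpen_det_neg (hg.det_neg x hx)) _
  refine (h1.fun_mul (hg.hasDerivAt_scalarJet hδ hx)).congr_deriv ?_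
  simp only [zero_smul, add_zero, ← hg.scalarCurvature_eq hx]
  have e1 : ∑ a, ∑ b, einstein g a b x * δg x a b = ∑ a, ∑ b, δg x a b * ricci g a b x
      - 1 / 2 * scalarCurvature g x * ∑ a, ∑ b, lower (g x) a b * δg x b a := by
    simp only [Finset.mul_sum, ← Finset.sum_sub_distrib]
    refine Finset.sum_congr rfl fun a _ => Finset.sum_congr rfl fun b _ => ?_
    rw [hδs x hx b a, einstein]; ring
  rw [e1]
  change _ * _ + sqrtNeg (g x) * _ = _
  ring

theorem symUnit_symm (a b i j : Fin 4) : symUnit a b i j = symUnit a b j i := by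
  unfold symUnit
  simp only [and_comm, add_comm]

theorem sum_mul_symUnit (f : Fin 4 → Fin 4 → ℝ) (a b : Fin 4) :
    ∑ i, ∑ j, f i j * symUnit a b i j = (f a b + f b a) / 2 := by
  have h : ∀ c d : Fin 4, ∑ i, ∑ j, f i j * (if i = c ∧ j = d then (1 : ℝ) else 0) = f c d := by
    intro c d
    rw [Finset.sum_eq_single c, Finset.sum_eq_single d] <;> simp +contextual
  have e : ∀ i j, f i j * symUnit a b i j = (f i j * (if i = a ∧ j = b then (1 : ℝ) else 0)
      + f i j * (if i = b ∧ j = a then (1 : ℝ) else 0)) / 2 := fun i j => by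
    unfold symUnit; ring
  simp only [e, ← Finset.sum_div, Finset.sum_add_distrib, h]

/-- The Euler-Lagrange expression of the Hilbert action. -/
theorem IsMetric.eulerLagrange_hilbertDensity (hg : IsMetric U g)
    (hs : ∀ x ∈ U, ∀ a b, g x a b = g x b a) (a b : Fin 4) {x : Pt} (hx : x ∈ U) :
    eulerLagrange hilbertDensity g (symUnit a b) x = sqrtNeg (g x) * einstein g a b x := by
  have hj := fun y (hy : y ∈ U) => hg.jet_mem hy
  have hEL : ContDiffOn ℝ ∞ (eulerLagrange hilbertDensity g (symUnit a b)) U :=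
    contDiffOn_eulerLagrange contDiffOn_hilbertDensity isOpen_detNegJets hg.smooth hg.isOpen hj _
  have hE : ContDiffOn ℝ ∞ (fun y => sqrtNeg (g y) * einstein g a b y) U :=
    hg.smooth_sqrtNeg.mul ((hg.smooth_ricci a b).sub
      ((contDiffOn_const.mul (hg.smooth_lower a b)).mul hg.smooth_scalarCurvature))
  -- Two pointwise formulas for the same variation along `c • symUnit a b` are compared, the general
  -- one and Palatini's. They differ by a divergence that integrates to zero for every test function
  -- `c`, so the coefficients of `c` agree.
  refine sub_eq_zero.1 (eq_zero_of_integral_mul_eq_zero hg.isOpen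
    (f := fun y => eulerLagrange hilbertDensity g (symUnit a b) y - sqrtNeg (g y) * einstein g a b y)
    (hEL.sub hE).continuousOn (fun c Ω hc hΩ hcΩ => ?_) x hx)
  have hcU : ContDiffOn ℝ ∞ c U := hc.contDiffOn
  set δg : Pt → Met := fun y => c y • symUnit a b with hδdef
  have hδ : ContDiffOn ℝ ∞ δg U := hcU.smul contDiffOn_const
  have hδs : ∀ x ∈ U, ∀ i j, δg x i j = δg x j i := fun y _ i j => by
    simp [hδdef, symUnit_symm a b i j]
  have hout : ∀ y ∈ frontier Ω, ∀ᶠ z in 𝓝 y, c z = 0 := by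
    intro y hy
    have : y ∉ tsupport c := fun h => by
      rw [hΩ.isOpen.frontier_eq] at hy; exact hy.2 (hcΩ h)
    exact notMem_tsupport_iff_eventuallyEq.1 this
  have key : ∀ y ∈ Ω, (eulerLagrange hilbertDensity g (symUnit a b) y
      - sqrtNeg (g y) * einstein g a b y) * c y
      = ∑ m, (pd m (palatiniCurrent g δg m) y
        - pd m (variationCurrent hilbertDensity g (symUnit a b) c m) y) := by
    intro y hy
    have hyU := hΩ.subset' hy
    have h1 := hg.fderiv_hilbertDensity hδ hs hδs hyU
    rw [hδdef, fderiv_jet_smul_const contDiffOn_hilbertDensity isOpen_detNegJets hg.smooth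
      hg.isOpen hj _ hcU hyU] at h1
    have h2 : ∑ i, ∑ j, einstein g i j y * (c y • symUnit a b) i j = einstein g a b y * c y := by
      have e : ∀ i j, einstein g i j y * (c y • symUnit a b) i j
          = c y * (einstein g i j y * symUnit a b i j) := fun i j => by
        simp only [Pi.smul_apply, smul_eq_mul]; ring
      have es : einstein g b a y = einstein g a b y := by
        rw [einstein, einstein, hg.ricci_symm hs hyU b a, lower_symm (hs y hyU) b a]
      simp only [e, ← Finset.mul_sum, sum_mul_symUnit, es]
      ring
    rw [h2] at h1
    rw [Finset.sum_sub_distrib]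
    linear_combination h1
  have sP := hg.smooth_palatiniCurrent hδ
  have sV := contDiffOn_variationCurrent contDiffOn_hilbertDensity isOpen_detNegJets hg.smooth
    hg.isOpen hj (symUnit a b) hcU
  rw [setIntegral_congr_fun hΩ.isOpen.measurableSet key, integral_finsetSum]
  · refine Finset.sum_eq_zero fun m _ => ?_
    rw [integral_sub (hΩ.integrableOn (ContDiffOn.pd (sP m) hg.isOpen m).continuousOn)
      (hΩ.integrableOn (ContDiffOn.pd (sV m) hg.isOpen m).continuousOn),
      integral_pd_eq_zero_of_frontier hg.isOpen hΩ (sP m) (fun y hy => ?_),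
      integral_pd_eq_zero_of_frontier hg.isOpen hΩ (sV m) (fun y hy => ?_), sub_zero]
    · have hz := hout y hy
      have h0 : ∀ n, pd n c y = 0 := fun n => (pd_congr hz n).trans (pd_const n 0 y)
      simp [variationCurrent, h0, hz.self_of_nhds]
    -- The variation is identically zero near the frontier, so its whole jet vanishes there, and
    -- with it the variation of the Christoffel symbols. The jet of the zero function is obtained as
    -- that of an empty sum.
    · have h0 : jet δg y = 0 := by
        rw [jet_congr (g := fun _ => 0) ((hout y hy).mono fun z hz => by simp [hδdef, hz])]
        simpa using jet_finset_sum (∅ : Finset Empty) (f := fun _ _ => (0 : Met))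
          (fun _ => contDiffOn_const) isOpen_univ (Set.mem_univ y)
      simp [palatiniCurrent, christoffelVar, h0]
  · exact fun m _ => (hΩ.integrableOn (ContDiffOn.pd (sP m) hg.isOpen m).continuousOn).sub
      (hΩ.integrableOn (ContDiffOn.pd (sV m) hg.isOpen m).continuousOn)

end PalatiniVariation

end GR

namespace GR

open Filter Topology

/-! ### The identity `I = 0` -/

section Identity

variable {U : Set Pt} {g : Pt → Met}

theorem partial0_hilbertDensity {j : Jet Met} (hj : j ∈ detNegJets) (hs : ∀ a b, j.1 a b = j.1 b a)
    (a b : Fin 4) : partial0 hilbertDensity (symUnit a b) j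
      = sqrtNeg j.1 * (partial0 scalarJet (symUnit a b) j - 1 / 2 * lower j.1 a b * scalarJet j) := by
  have h1 : HasDerivAt (fun t : ℝ => sqrtNeg (j.1 + t • symUnit a b))
      (-(1 / 2) * sqrtNeg j.1 * lower j.1 a b) 0 := by
    have h := hasDerivAt_line (ContDiffOn.diffAt contDiffOn_sqrtNeg isOpen_det_neg hj) (symUnit a b)
    rw [fderiv_sqrtNeg hj] at h
    refine h.congr_deriv ?_
    have e : ∑ c, ∑ d, lower j.1 c d * symUnit a b d c = lower j.1 a b := by
      rw [Finset.sum_congr rfl fun c _ => Finset.sum_congr rfl fun d _ =>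
        congrArg (lower j.1 c d * ·) (symUnit_symm a b d c)]
      refine (sum_mul_symUnit (fun c d => lower j.1 c d) a b).trans ?_
      rw [lower_symm hs b a]; ring
    rw [e]
  have h2 := hasDerivAt_line (ContDiffOn.diffAt contDiffOn_scalarJet isOpen_detNegJets hj)
    ((symUnit a b, 0, 0) : Jet Met)
  rw [← partial0_eq (ContDiffOn.diffAt contDiffOn_scalarJet isOpen_detNegJets hj)] at h2
  have h3 := h1.fun_mul h2
  simp only [zero_smul, add_zero] at h3
  rw [partial0_eq_line]
  refine (h3.congr_deriv ?_).deriv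
  ring

/-- `√(-g)` involves no derivatives of the metric, so it acts as a constant. -/
theorem partial1_hilbertDensity (j : Jet Met) (m : Fin 4) (w : Met) :
    partial1 hilbertDensity m w j = sqrtNeg j.1 * partial1 scalarJet m w j := by
  simp only [partial1, hilbertDensity, deriv_const_mul_field]

theorem partial2_hilbertDensity (j : Jet Met) (m n : Fin 4) (w : Met) :
    partial2 hilbertDensity m n w j = sqrtNeg j.1 * partial2 scalarJet m n w j := by
  simp only [partial2, hilbertDensity, deriv_const_mul_field]

/-- The logarithmic derivative `g_{rs} ∂_m g^{rs}` of the determinant. -/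
noncomputable def traceDeriv (g : Pt → Met) (m : Fin 4) (x : Pt) : ℝ :=
  ∑ r, ∑ s, lower (g x) r s * pd m g x r s

theorem IsMetric.smooth_traceDeriv (hg : IsMetric U g) (m : Fin 4) :
    ContDiffOn ℝ ∞ (traceDeriv g m) U :=
  ContDiffOn.sum fun r _ => ContDiffOn.sum fun s _ => (hg.smooth_lower r s).mul
    ((contDiff_entry r s).comp_contDiffOn (ContDiffOn.pd hg.smooth hg.isOpen m))

theorem IsMetric.pd_sqrtNeg_traceDeriv (hg : IsMetric U g)
    (hs : ∀ x ∈ U, ∀ a b, g x a b = g x b a) {x : Pt} (hx : x ∈ U) (m : Fin 4) :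
    pd m (fun y => sqrtNeg (g y)) x = -(1 / 2) * (sqrtNeg (g x) * traceDeriv g m x) := by
  rw [hg.pd_sqrtNeg hx, traceDeriv, Finset.sum_comm, mul_assoc]
  simp only [lower_symm (hs x hx)]

/-- The derivative falling on `g_{rs}` gives the term quadratic in `∂g`, with a minus sign. The two
sums are the source of the last two terms of the identity. -/
theorem IsMetric.pd_traceDeriv (hg : IsMetric U g)
    (hs : ∀ x ∈ U, ∀ a b, g x a b = g x b a) {x : Pt} (hx : x ∈ U) (m n : Fin 4) :
    pd m (traceDeriv g n) x = ∑ r, ∑ s, lower (g x) r s * pd m (pd n g) x r s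
      - ∑ r, ∑ s, ∑ p, ∑ q, lower (g x) r p * lower (g x) s q * pd m g x r s * pd n g x p q := by
  have sd : ContDiffOn ℝ ∞ (pd n g) U := ContDiffOn.pd hg.smooth hg.isOpen n
  have dL := fun r s => hg.diff (hg.smooth_lower r s) hx
  have dd : ∀ r s, DifferentiableAt ℝ (fun y => pd n g y r s) x := fun r s =>
    hg.diff ((contDiff_entry r s).comp_contDiffOn sd) hx
  have h1 : pd m (traceDeriv g n) x = ∑ r, ∑ s, (dLowerJet (jet g x) m r s * pd n g x r s
      + lower (g x) r s * pd m (pd n g) x r s) := by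
    unfold traceDeriv
    rw [pd_sum fun r _ => DifferentiableAt.fun_sum fun s _ => (dL r s).fun_mul (dd r s)]
    refine Finset.sum_congr rfl fun r _ => ?_
    rw [pd_sum fun s _ => (dL r s).fun_mul (dd r s)]
    refine Finset.sum_congr rfl fun s _ => ?_
    rw [pd_mul (dL r s) (dd r s), hg.pd_lower hx, pd_apply (hg.diff sd hx)]
  have h2 : ∑ p, ∑ q, dLowerJet (jet g x) m p q * pd n g x p q = -∑ r, ∑ s, ∑ p, ∑ q,
      lower (g x) r p * lower (g x) s q * pd m g x r s * pd n g x p q := by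
    rw [sum4_swap_middle, sum4_swap_first, sum4_swap_last, sum4_swap_middle]
    simp only [← Finset.sum_neg_distrib]
    refine Finset.sum_congr rfl fun p _ => Finset.sum_congr rfl fun q _ => ?_
    have e : dLowerJet (jet g x) m p q
        = -∑ s, (∑ r, lower (g x) p r * pd m g x r s) * lower (g x) s q := by
      simp only [dLowerJet, jet, Matrix.neg_apply, Matrix.mul_apply, Matrix.of_apply]
    rw [e, neg_mul, Finset.sum_mul, ← Finset.sum_neg_distrib, Finset.sum_comm]
    refine Finset.sum_congr rfl fun s _ => ?_
    rw [Finset.sum_mul, Finset.sum_mul, ← Finset.sum_neg_distrib]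
    refine Finset.sum_congr rfl fun r _ => ?_
    rw [lower_symm (hs x hx) p r]; ring
  rw [h1]
  simp only [Finset.sum_add_distrib]
  rw [h2]; ring

/-- The Euler-Lagrange expression of `√(-g) R` is known to be `√(-g) (R_{ab} - ½ g_{ab} R)`.
Expanding it by the product rule gives `√(-g)` times the sum of `I_{ab}` and the same tensor, and
`√(-g)` is nonzero. -/
theorem IsMetric.identityExpr_eq_zero (hg : IsMetric U g)
    (hs : ∀ x ∈ U, ∀ a b, g x a b = g x b a) {x : Pt} (hx : x ∈ U) (a b : Fin 4) :
    identityExpr g a b x = 0 := by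
  have hU := hg.isOpen
  have hj := fun y (hy : y ∈ U) => hg.jet_mem hy
  have hpos := hg.sqrtNeg_pos hx
  set w := symUnit a b with hw
  set R1 : Fin 4 → Pt → ℝ := fun m y => partial1 scalarJet m w (jet g y) with hR1
  set R2 : Fin 4 → Fin 4 → Pt → ℝ := fun m n y => partial2 scalarJet m n w (jet g y) with hR2
  set s : Pt → ℝ := fun y => sqrtNeg (g y) with hsd
  have s1 : ∀ m, ContDiffOn ℝ ∞ (R1 m) U := fun m =>
    contDiffOn_partial1 contDiffOn_scalarJet isOpen_detNegJets hg.smooth hU hj m w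
  have s2 : ∀ m n, ContDiffOn ℝ ∞ (R2 m n) U := fun m n =>
    contDiffOn_partial2 contDiffOn_scalarJet isOpen_detNegJets hg.smooth hU hj m n w
  have ss : ContDiffOn ℝ ∞ s U := hg.smooth_sqrtNeg
  have ds := hg.diff ss hx
  have ds' := fun n => hg.diff (ContDiffOn.pd ss hU n) hx
  have d2 := fun m n => hg.diff (s2 m n) hx
  have d2' := fun m n k => hg.diff (ContDiffOn.pd (s2 m n) hU k) hx
  have e1 : ∀ m, pd m (fun y => partial1 hilbertDensity m w (jet g y)) x
      = pd m s x * R1 m x + s x * pd m (R1 m) x := fun m => by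
    simp only [partial1_hilbertDensity]
    exact pd_mul ds (hg.diff (s1 m) hx) m
  have e2 : ∀ m n, pd m (pd n (fun y => partial2 hilbertDensity m n w (jet g y))) x
      = pd m (pd n s) x * R2 m n x + pd n s x * pd m (R2 m n) x
        + (pd m s x * pd n (R2 m n) x + s x * pd m (pd n (R2 m n)) x) := fun m n => by
    simp only [partial2_hilbertDensity]
    change pd m (pd n fun y => s y * R2 m n y) x = _
    rw [pd_congr_on hU (g := fun y => pd n s y * R2 m n y + s y * pd n (R2 m n) y)
      (fun y hy => pd_mul (hg.diff ss hy) (hg.diff (s2 m n) hy) n) hx,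
      pd_add ((ds' n).fun_mul (d2 m n)) (ds.fun_mul (d2' m n n)), pd_mul (ds' n) (d2 m n),
      pd_mul ds (d2' m n n)]
  have e3 : ∀ m, pd m s x = -(1 / 2) * (s x * traceDeriv g m x) :=
    hg.pd_sqrtNeg_traceDeriv hs hx
  -- The second derivative of `√(-g)` is the origin of the coefficients `1/4` and `∓1/2` in front of
  -- `R2`.
  have e4 : ∀ m n, pd m (pd n s) x = s x * (1 / 4 * (traceDeriv g m x * traceDeriv g n x)
      - 1 / 2 * pd m (traceDeriv g n) x) := fun m n => by
    have dt := hg.diff (hg.smooth_traceDeriv n) hx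
    rw [pd_congr_on hU (fun y hy => hg.pd_sqrtNeg_traceDeriv hs hy n) hx,
      pd_const_mul (ds.fun_mul dt), pd_mul ds dt, e3]
    ring
  -- By symmetry of `R2` the two cross terms are equal, so their halves add up to the coefficient
  -- `-1` in the identity.
  have e5 : ∑ m, ∑ n, traceDeriv g n x * pd m (R2 m n) x
      = ∑ m, ∑ n, traceDeriv g m x * pd n (R2 m n) x := by
    rw [Finset.sum_comm]
    refine Finset.sum_congr rfl fun m _ => Finset.sum_congr rfl fun n _ => ?_
    simp only [hR2, partial2_comm scalarJet n m]
  have hEL := hg.eulerLagrange_hilbertDensity hs a b hx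
  have q1 : ∑ m, (pd m s x * R1 m x + s x * pd m (R1 m) x)
      = s x * (-(1 / 2) * ∑ m, traceDeriv g m x * R1 m x + ∑ m, pd m (R1 m) x) := by
    rw [mul_add, Finset.mul_sum, Finset.mul_sum, Finset.mul_sum, ← Finset.sum_add_distrib]
    exact Finset.sum_congr rfl fun m _ => by rw [e3]; ring
  have q2 : ∑ m, ∑ n, (pd m (pd n s) x * R2 m n x + pd n s x * pd m (R2 m n) x
        + (pd m s x * pd n (R2 m n) x + s x * pd m (pd n (R2 m n)) x))
      = s x * (1 / 4 * ∑ m, ∑ n, traceDeriv g m x * traceDeriv g n x * R2 m n x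
        - 1 / 2 * ∑ m, ∑ n, pd m (traceDeriv g n) x * R2 m n x
        - 1 / 2 * ∑ m, ∑ n, traceDeriv g n x * pd m (R2 m n) x
        - 1 / 2 * ∑ m, ∑ n, traceDeriv g m x * pd n (R2 m n) x
        + ∑ m, ∑ n, pd m (pd n (R2 m n)) x) := by
    simp only [Finset.mul_sum, ← Finset.sum_add_distrib, ← Finset.sum_sub_distrib]
    refine Finset.sum_congr rfl fun m _ => Finset.sum_congr rfl fun n _ => ?_
    rw [e4, e3, e3]; ring
  have q3 : ∑ m, ∑ n, pd m (traceDeriv g n) x * R2 m n x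
      = ∑ m, ∑ n, (∑ r, ∑ s, lower (g x) r s * pd m (pd n g) x r s) * R2 m n x
        - ∑ m, ∑ n, (∑ r, ∑ s, ∑ p, ∑ q,
          lower (g x) r p * lower (g x) s q * pd m g x r s * pd n g x p q) * R2 m n x := by
    simp only [← Finset.sum_sub_distrib]
    refine Finset.sum_congr rfl fun m _ => Finset.sum_congr rfl fun n _ => ?_
    rw [hg.pd_traceDeriv hs hx]; ring
  have hI : s x * identityExpr g a b x = 0 := by
    unfold eulerLagrange at hEL
    rw [partial0_hilbertDensity (hj x hx) (hs x hx), ← hw] at hEL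
    simp only [e1, e2] at hEL
    rw [q1, q2, q3, e5, ← hg.scalarCurvature_eq hx, einstein] at hEL
    unfold identityExpr
    change s x * (partial0 scalarJet w (jet g x) - ricci g a b x - ∑ m, pd m (R1 m) x
      + ∑ m, ∑ n, pd m (pd n (R2 m n)) x + 1 / 2 * ∑ m, traceDeriv g m x * R1 m x
      + 1 / 4 * ∑ m, ∑ n, traceDeriv g m x * traceDeriv g n x * R2 m n x
      - ∑ m, ∑ n, traceDeriv g m x * pd n (R2 m n) x
      - 1 / 2 * ∑ m, ∑ n, (∑ r, ∑ s, lower (g x) r s * pd m (pd n g) x r s) * R2 m n x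
      + 1 / 2 * ∑ m, ∑ n, (∑ r, ∑ s, ∑ p, ∑ q,
          lower (g x) r p * lower (g x) s q * pd m g x r s * pd n g x p q) * R2 m n x) = 0
    change s x * (partial0 scalarJet w (jet g x) - 1 / 2 * lower (g x) a b * scalarCurvature g x)
      - _ + _ = s x * _ at hEL
    linear_combination hEL
  exact (mul_eq_zero.1 hI).resolve_left hpos.ne'

end Identity

end GR

namespace GR

open Filter Topology MeasureTheory

/-! ### Functional derivatives with respect to matter and metric -/

section MatterFields

variable {ι κ : Type*}

/-- The arguments of the matter Lagrangian as a function of the jet of the fields. -/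
noncomputable def matterJetArg (j : Jet (Fields ι κ)) : Met × Matter ι κ × (Fin 4 → Matter ι κ) :=
  (j.1.1, j.1.2, fun m => ((j.2.1 m).2.1,
     fun b al => (j.2.1 m).2.2 b al - ∑ l, christoffelJet (metJet j) l m al * j.1.2.2 b l))

theorem matterLagrangian_eq (LM : Met × Matter ι κ × (Fin 4 → Matter ι κ) → ℝ)
    (j : Jet (Fields ι κ)) : matterLagrangian LM j = sqrtNeg j.1.1 * LM (matterJetArg j) := rfl

theorem gravLagrangian_eq (G : ℝ) : (gravLagrangian G : Jet (Fields ι κ) → ℝ)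
    = fun j => 1 / (16 * Real.pi * G) * hilbertDensity (metJet j) := by
  funext j
  rw [gravLagrangian, hilbertDensity]
  change _ = _ * (sqrtNeg j.1.1 * _)
  ring

/-- The jets on which the symmetrized Lagrangians are smooth. -/
def lorentzianJets (ι κ : Type*) : Set (Jet (Fields ι κ)) :=
  {j | (Matrix.of j.1.1).det < 0 ∧ IsLorentzian (symMet j.1.1)}

theorem isOpen_lorentzianJets : IsOpen (lorentzianJets ι κ) :=
  (isOpen_det_neg.preimage (continuous_fst.comp continuous_fst)).inter
    (isOpen_isLorentzian_symMet.preimage (continuous_fst.comp continuous_fst))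

/-- Because `∂_m u` enters `∇_m u` with coefficient one and nothing else, differentiating in `∂_m u`
is the same as differentiating in `∇_m u`. -/
theorem matterJetArg_dir1 (j : Jet (Fields ι κ)) (m : Fin 4) (w : Matter ι κ) (t : ℝ) :
    matterJetArg (j.1, j.2.1 + t • (Pi.single m ((0, w) : Fields ι κ) : Fin 4 → Fields ι κ), j.2.2)
      = ((matterJetArg j).1, (matterJetArg j).2.1, (matterJetArg j).2.2
        + t • (Pi.single m w : Fin 4 → Matter ι κ)) := by
  have e : ∀ k, (Pi.single m ((0, w) : Fields ι κ) : Fin 4 → Fields ι κ) k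
      = (0, (Pi.single m w : Fin 4 → Matter ι κ) k) := fun k => by
    by_cases h : k = m
    · subst h; simp
    · simp [h]; rfl
  have hm : metJet ((j.1, j.2.1 + t • (Pi.single m ((0, w) : Fields ι κ) : Fin 4 → Fields ι κ),
      j.2.2) : Jet (Fields ι κ)) = metJet j :=
    Prod.ext rfl (Prod.ext (funext fun k => by simp [metJet, e]) rfl)
  unfold matterJetArg
  rw [hm]
  refine Prod.ext rfl (Prod.ext rfl (funext fun k => Prod.ext ?_ ?_))
  · simp [e]
  · funext b al
    simp [e]; ring

variable [Fintype ι] [Fintype κ]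
  {LM : Met × Matter ι κ × (Fin 4 → Matter ι κ) → ℝ} {U : Set Pt} {Φ δΦ : Pt → Fields ι κ}

theorem contDiff_metJet : ContDiff ℝ ∞ (metJet : Jet (Fields ι κ) → Jet Met) := by
  unfold metJet; fun_prop

theorem contDiffOn_matterJetArg :
    ContDiffOn ℝ ∞ (matterJetArg : Jet (Fields ι κ) → _) (lorentzianJets ι κ) := by
  have hΓ : ∀ l m n, ContDiffOn ℝ ∞ (fun j : Jet (Fields ι κ) => christoffelJet (metJet j) l m n)
      (lorentzianJets ι κ) := fun l m n =>
    (contDiffOn_christoffelJet l m n).comp contDiff_metJet.contDiffOn fun j hj => hj.1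
  unfold matterJetArg
  refine ContDiffOn.prodMk (ContDiff.contDiffOn (by fun_prop)) (ContDiffOn.prodMk
    (ContDiff.contDiffOn (by fun_prop)) (contDiffOn_pi.2 fun m => ContDiffOn.prodMk
    (ContDiff.contDiffOn (by fun_prop)) (contDiffOn_pi.2 fun b => contDiffOn_pi.2 fun al => ?_)))
  exact ContDiffOn.sub (ContDiff.contDiffOn (by fun_prop)) (ContDiffOn.sum fun l _ =>
    (hΓ l m al).mul (ContDiff.contDiffOn (by fun_prop)))

theorem contDiffOn_sqrtNeg_fields :
    ContDiffOn ℝ ∞ (fun j : Jet (Fields ι κ) => sqrtNeg j.1.1) (lorentzianJets ι κ) :=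
  contDiffOn_sqrtNeg.comp (ContDiff.contDiffOn (by fun_prop)) fun j hj => hj.1

theorem contDiffOn_matterLagrangian (hLM : ContDiffOn ℝ ∞ LM {p | IsLorentzian (symMet p.1)}) :
    ContDiffOn ℝ ∞ (matterLagrangian LM) (lorentzianJets ι κ) :=
  contDiffOn_sqrtNeg_fields.mul (hLM.comp contDiffOn_matterJetArg fun _ hj => hj.2)

theorem contDiffOn_hilbertDensity_metJet :
    ContDiffOn ℝ ∞ (fun j : Jet (Fields ι κ) => hilbertDensity (metJet j)) (lorentzianJets ι κ) :=
  contDiffOn_hilbertDensity.comp contDiff_metJet.contDiffOn fun _ hj => hj.1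

theorem contDiffOn_gravLagrangian (G : ℝ) :
    ContDiffOn ℝ ∞ (gravLagrangian G) (lorentzianJets ι κ) := by
  rw [gravLagrangian_eq]
  exact contDiffOn_const.mul contDiffOn_hilbertDensity_metJet

theorem contDiffOn_totalLagrangian (G : ℝ)
    (hLM : ContDiffOn ℝ ∞ LM {p | IsLorentzian (symMet p.1)}) :
    ContDiffOn ℝ ∞ (totalLagrangian G LM) (lorentzianJets ι κ) :=
  (contDiffOn_gravLagrangian G).add (contDiffOn_matterLagrangian hLM)

namespace IsConfiguration

theorem symm (hΦ : IsConfiguration U Φ) : ∀ x ∈ U, ∀ a b, (Φ x).1 a b = (Φ x).1 b a :=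
  fun x hx a b => (hΦ.lorentzian x hx).symm a b

theorem isMetric (hΦ : IsConfiguration U Φ) (hU : IsOpen U) : IsMetric U fun y => (Φ y).1 where
  isOpen := hU
  smooth := hΦ.smooth.fst
  det_neg := fun x hx => (hΦ.lorentzian x hx).det_neg

theorem jet_mem (hΦ : IsConfiguration U Φ) {x : Pt} (hx : x ∈ U) :
    jet Φ x ∈ lorentzianJets ι κ := by
  refine ⟨(hΦ.lorentzian x hx).det_neg, ?_⟩
  change IsLorentzian (symMet (Φ x).1)
  rw [symMet_eq_self (hΦ.symm x hx)]
  exact hΦ.lorentzian x hx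

theorem metJet_jet (hΦ : IsConfiguration U Φ) (hU : IsOpen U) {x : Pt} (hx : x ∈ U) :
    metJet (jet Φ x) = jet (fun y => (Φ y).1) x :=
  (jet_clm (ContinuousLinearMap.fst ℝ Met (Matter ι κ)) hΦ.smooth hU hx).symm

theorem matterArg_eq (hΦ : IsConfiguration U Φ) (hU : IsOpen U) {x : Pt} (hx : x ∈ U) :
    matterArg Φ x = matterJetArg (jet Φ x) := by
  have hd : DifferentiableAt ℝ Φ x := ContDiffOn.diffAt hΦ.smooth hU hx
  unfold matterArg matterJetArg covDeriv
  rw [hΦ.metJet_jet hU hx]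
  simp only [(hΦ.isMetric hU).christoffel_eq hx]
  refine Prod.ext rfl (Prod.ext rfl (funext fun m => Prod.ext (funext fun a => ?_)
    (funext fun b => funext fun al => congrArg (· - _) ?_)))
  · exact pd_clm ((ContinuousLinearMap.proj a : (ι → ℝ) →L[ℝ] ℝ).comp
      ((ContinuousLinearMap.fst ℝ (ι → ℝ) (κ → Fin 4 → ℝ)).comp
        (ContinuousLinearMap.snd ℝ Met (Matter ι κ)))) hd m
  · exact pd_clm ((ContinuousLinearMap.proj al : (Fin 4 → ℝ) →L[ℝ] ℝ).comp
      ((ContinuousLinearMap.proj b : (κ → Fin 4 → ℝ) →L[ℝ] (Fin 4 → ℝ)).comp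
      ((ContinuousLinearMap.snd ℝ (ι → ℝ) (κ → Fin 4 → ℝ)).comp
        (ContinuousLinearMap.snd ℝ Met (Matter ι κ))))) hd m

theorem scalarJet_eq (hΦ : IsConfiguration U Φ) (hU : IsOpen U) {x : Pt} (hx : x ∈ U) :
    scalarJet (jet (fun y => (Φ y).1) x) = scalarCurvature (fun y => (Φ y).1) x :=
  ((hΦ.isMetric hU).scalarCurvature_eq hx).symm

theorem gravLagrangian_jet (hΦ : IsConfiguration U Φ) (hU : IsOpen U) {x : Pt} (hx : x ∈ U)
    (G : ℝ) : gravLagrangian G (jet Φ x) = sqrtNeg (Φ x).1 *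
      (1 / (16 * Real.pi * G) * scalarCurvature (fun y => (Φ y).1) x) := by
  rw [gravLagrangian, hΦ.metJet_jet hU hx, hΦ.scalarJet_eq hU hx]; rfl

theorem matterLagrangian_jet (hΦ : IsConfiguration U Φ) (hU : IsOpen U) {x : Pt} (hx : x ∈ U)
    (LM : Met × Matter ι κ × (Fin 4 → Matter ι κ) → ℝ) :
    matterLagrangian LM (jet Φ x) = sqrtNeg (Φ x).1 * LM (matterArg Φ x) := by
  rw [matterLagrangian_eq, hΦ.matterArg_eq hU hx]; rfl

end IsConfiguration

theorem eulerLagrange_zero {V : Type*} [NormedAddCommGroup V] [NormedSpace ℝ V] (L : Jet V → ℝ)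
    (Φ : Pt → V) (x : Pt) : eulerLagrange L Φ 0 x = 0 := by
  have h0 : ∀ j, partial0 L 0 j = 0 := fun j => by simp [partial0]
  have h1 : ∀ m j, partial1 L m 0 j = 0 := fun m j => by simp [partial1]
  have h2 : ∀ m n j, partial2 L m n 0 j = 0 := fun m n j => by simp [partial2]
  have h3 : ∀ n : Fin 4, pd n (fun _ : Pt => (0 : ℝ)) = fun _ => 0 := fun n =>
    funext fun y => pd_const n 0 y
  simp [eulerLagrange, h0, h1, h2, h3]

/-- `metJet` is linear and sends the jet directions of `w` to those of its metric part. Hence the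
gravitational Lagrangian contributes nothing in matter directions. -/
theorem eulerLagrange_metJet (L : Jet Met → ℝ) (hΦ : IsConfiguration U Φ) (hU : IsOpen U)
    (w : Fields ι κ) {x : Pt} (hx : x ∈ U) :
    eulerLagrange (fun j => L (metJet j)) Φ w x = eulerLagrange L (fun y => (Φ y).1) w.1 x := by
  have hm1 : ∀ (m : Fin 4), metJet (dir1 m w) = dir1 m w.1 := fun m => by
    unfold metJet dir1
    refine Prod.ext rfl (Prod.ext (funext fun k => ?_) rfl)
    by_cases h : k = m
    · subst h; simp
    · simp [h]
  have hm2 : ∀ (m n : Fin 4), metJet (dir2 m n w) = dir2 m n w.1 := fun m n => by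
    unfold metJet dir2
    refine Prod.ext rfl (Prod.ext rfl (funext fun k => funext fun l => ?_))
    have e : ∀ c d : Fin 4, ((Pi.single c (Pi.single d w : Fin 4 → Fields ι κ) :
        Fin 4 → Fin 4 → Fields ι κ) k l).1
        = (Pi.single c (Pi.single d w.1 : Fin 4 → Met) : Fin 4 → Fin 4 → Met) k l := by
      intro c d
      by_cases h : k = c
      · subst h
        by_cases h' : l = d
        · subst h'; simp
        · simp [h']
      · simp [h]
    change (1 / 2 : ℝ) • (((Pi.single m (Pi.single n w : Fin 4 → Fields ι κ) :
        Fin 4 → Fin 4 → Fields ι κ) k l).1 + ((Pi.single n (Pi.single m w : Fin 4 → Fields ι κ) :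
        Fin 4 → Fin 4 → Fields ι κ) k l).1) = _
    rw [e, e]; rfl
  have hl : ∀ (j v : Jet (Fields ι κ)) (t : ℝ), metJet (j + t • v) = metJet j + t • metJet v :=
    fun j v t => rfl
  have h0 : ∀ y ∈ U, partial0 (fun j => L (metJet j)) w (jet Φ y)
      = partial0 L w.1 (jet (fun y => (Φ y).1) y) := fun y hy => by
    simp only [partial0_eq_line, hl, hΦ.metJet_jet hU hy]; rfl
  have h1 : ∀ m, ∀ y ∈ U, partial1 (fun j => L (metJet j)) m w (jet Φ y)
      = partial1 L m w.1 (jet (fun y => (Φ y).1) y) := fun m y hy => by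
    simp only [partial1_eq_line, hl, hΦ.metJet_jet hU hy, hm1]
  have h2 : ∀ m n, ∀ y ∈ U, partial2 (fun j => L (metJet j)) m n w (jet Φ y)
      = partial2 L m n w.1 (jet (fun y => (Φ y).1) y) := fun m n y hy => by
    simp only [partial2_eq_line, hl, hΦ.metJet_jet hU hy, hm2]
  unfold eulerLagrange
  rw [h0 x hx, Finset.sum_congr rfl fun m _ => pd_congr_on hU (h1 m) hx m,
    Finset.sum_congr rfl fun m _ => Finset.sum_congr rfl fun n _ =>
      pd_congr_on hU (fun y hy => pd_congr_on hU (h2 m n) hy n) hx m]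

theorem eulerLagrange_gravLagrangian (hΦ : IsConfiguration U Φ) (hU : IsOpen U) (G : ℝ)
    (w : Fields ι κ) {x : Pt} (hx : x ∈ U) :
    eulerLagrange (gravLagrangian G) Φ w x
      = 1 / (16 * Real.pi * G) * eulerLagrange hilbertDensity (fun y => (Φ y).1) w.1 x := by
  rw [gravLagrangian_eq, eulerLagrange_const_mul contDiffOn_hilbertDensity_metJet
    isOpen_lorentzianJets hΦ.smooth hU (fun y hy => hΦ.jet_mem hy) _ w hx,
    eulerLagrange_metJet hilbertDensity hΦ hU w hx]

theorem eulerLagrange_totalLagrangian (hΦ : IsConfiguration U Φ) (hU : IsOpen U)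
    (hLM : ContDiffOn ℝ ∞ LM {p | IsLorentzian (symMet p.1)}) (G : ℝ)
    (w : Fields ι κ) {x : Pt} (hx : x ∈ U) :
    eulerLagrange (totalLagrangian G LM) Φ w x
      = 1 / (16 * Real.pi * G) * eulerLagrange hilbertDensity (fun y => (Φ y).1) w.1 x
        + eulerLagrange (matterLagrangian LM) Φ w x := by
  rw [← eulerLagrange_gravLagrangian hΦ hU G w hx]
  exact eulerLagrange_add (contDiffOn_gravLagrangian G) (contDiffOn_matterLagrangian hLM)
    isOpen_lorentzianJets hΦ.smooth hU (fun y hy => hΦ.jet_mem hy) w hx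

theorem partial2_matterLagrangian (LM : Met × Matter ι κ × (Fin 4 → Matter ι κ) → ℝ)
    (m n : Fin 4) (w : Fields ι κ) (j : Jet (Fields ι κ)) :
    partial2 (matterLagrangian LM) m n w j = 0 := by
  unfold partial2
  exact deriv_const (𝕜 := ℝ) (F := ℝ) 0 (matterLagrangian LM j)

/-- Second derivatives enter only through `R`, as `∂²g`. This is why `δu` needs no boundary
condition on its derivatives. -/
theorem partial2_totalLagrangian (G : ℝ) (LM : Met × Matter ι κ × (Fin 4 → Matter ι κ) → ℝ)
    (m n : Fin 4) (w : Matter ι κ) (j : Jet (Fields ι κ)) :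
    partial2 (totalLagrangian G LM) m n ((0, w) : Fields ι κ) j = 0 := by
  have hm : ∀ t : ℝ, metJet ((j.1, j.2.1, j.2.2 +
      t • ((1 / 2 : ℝ) • (Pi.single m (Pi.single n ((0, w) : Fields ι κ))
        + Pi.single n (Pi.single m ((0, w) : Fields ι κ)) :
        Fin 4 → Fin 4 → Fields ι κ))) : Jet (Fields ι κ)) = metJet j := fun t => by
    refine Prod.ext rfl (Prod.ext rfl (funext fun k => funext fun l => ?_))
    have e : ∀ c d : Fin 4, ((Pi.single c (Pi.single d ((0, w) : Fields ι κ) :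
        Fin 4 → Fields ι κ) : Fin 4 → Fin 4 → Fields ι κ) k l).1 = 0 := by
      intro c d
      by_cases h : k = c
      · subst h
        by_cases h' : l = d
        · subst h'; simp
        · simp [h']
      · simp [h]
    simp [metJet, e]
  unfold partial2 totalLagrangian gravLagrangian
  simp only [hm]
  exact deriv_const (𝕜 := ℝ) (F := ℝ) 0 (totalLagrangian G LM j)

theorem partial1_matterLagrangian (hΦ : IsConfiguration U Φ) (hU : IsOpen U)
    (LM : Met × Matter ι κ × (Fin 4 → Matter ι κ) → ℝ)
    (m : Fin 4) (w : Matter ι κ) {x : Pt} (hx : x ∈ U) :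
    partial1 (matterLagrangian LM) m ((0, w) : Fields ι κ) (jet Φ x)
      = sqrtNeg (Φ x).1 * matterPartial1 LM Φ m w x := by
  unfold partial1 matterPartial1
  simp only [matterLagrangian_eq, matterJetArg_dir1, deriv_const_mul_field, hΦ.matterArg_eq hU hx]
  rfl

/-- The change of the covariant derivative in the direction `w`, per unit of the field. -/
noncomputable def connectionTerm (g : Pt → Met) (w : Matter ι κ) (x : Pt) (m : Fin 4) :
    Matter ι κ :=
  (0, fun b al => -∑ l, christoffel g l m al x * w.2 b l)

/-- Varying `u` with `∂u` held fixed still changes `∇u`, by `-Γ δu`; this second effect is the sum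
over `connectionTerm`. -/
theorem partial0_matterLagrangian (hΦ : IsConfiguration U Φ) (hU : IsOpen U)
    (hLM : ContDiffOn ℝ ∞ LM {p | IsLorentzian (symMet p.1)})
    (w : Matter ι κ) {x : Pt} (hx : x ∈ U) :
    partial0 (matterLagrangian LM) ((0, w) : Fields ι κ) (jet Φ x)
      = sqrtNeg (Φ x).1 * (matterPartial0 LM Φ w x
        + ∑ m, matterPartial1 LM Φ m (connectionTerm (fun y => (Φ y).1) w x m) x) := by
  set p := matterArg Φ x with hp
  set ν := connectionTerm (fun y => (Φ y).1) w x with hν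
  have hpj : matterJetArg (jet Φ x) = p := (hΦ.matterArg_eq hU hx).symm
  have hopen : IsOpen {p : Met × Matter ι κ × (Fin 4 → Matter ι κ) | IsLorentzian (symMet p.1)} :=
    isOpen_isLorentzian_symMet.preimage continuous_fst
  have hd : DifferentiableAt ℝ LM p := ContDiffOn.diffAt hLM hopen (hΦ.jet_mem hx).2
  have hline : ∀ t : ℝ, matterJetArg ((jet Φ x).1 + t • ((0, w) : Fields ι κ), (jet Φ x).2.1,
      (jet Φ x).2.2) = p + t • ((0, w, ν) : Met × Matter ι κ × (Fin 4 → Matter ι κ)) := by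
    intro t
    have hm : metJet (((jet Φ x).1 + t • ((0, w) : Fields ι κ), (jet Φ x).2.1,
        (jet Φ x).2.2) : Jet (Fields ι κ)) = metJet (jet Φ x) :=
      Prod.ext (by simp [metJet]) rfl
    rw [← hpj]
    unfold matterJetArg
    rw [hm]
    refine Prod.ext (by simp) (Prod.ext rfl (funext fun m => Prod.ext ?_ ?_))
    · simp [hν, connectionTerm]
    · funext b al
      simp only [hν, connectionTerm, (hΦ.isMetric hU).christoffel_eq hx, ← hΦ.metJet_jet hU hx,
        Prod.snd_add, Prod.smul_snd, Pi.add_apply, Pi.smul_apply,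
        smul_eq_mul, mul_add, Finset.sum_add_distrib]
      rw [mul_neg, Finset.mul_sum, sub_add_eq_sub_sub, sub_eq_add_neg (_ - _)]
      congr 2
      exact Finset.sum_congr rfl fun l _ => by ring
  have h0 : matterPartial0 LM Φ w x
      = fderiv ℝ LM p ((0, w, 0) : Met × Matter ι κ × (Fin 4 → Matter ι κ)) := by
    rw [← (hasDerivAt_line hd _).deriv, matterPartial0]
    congr 1; funext t; congr 1
    refine Prod.ext (by simp [hp]) (Prod.ext rfl (by simp [hp]))
  have h1 : ∀ m v, matterPartial1 LM Φ m v x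
      = fderiv ℝ LM p ((0, 0, Pi.single m v) : Met × Matter ι κ × (Fin 4 → Matter ι κ)) := by
    intro m v
    rw [← (hasDerivAt_line hd _).deriv, matterPartial1]
    congr 1; funext t; congr 1
    refine Prod.ext (by simp [hp]) (Prod.ext (by simp [hp]) rfl)
  have hsum : ((0, w, ν) : Met × Matter ι κ × (Fin 4 → Matter ι κ))
      = (0, w, 0) + ∑ m, (0, 0, Pi.single m (ν m)) := by
    refine Prod.ext (by simp [Prod.fst_sum]) (Prod.ext (by simp [Prod.fst_sum, Prod.snd_sum]) ?_)
    simp only [Prod.snd_add, Prod.snd_sum, zero_add]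
    exact (Finset.univ_sum_single ν).symm
  unfold partial0
  simp only [matterLagrangian_eq, hline]
  have h2 := (hasDerivAt_line hd ((0, w, ν) : Met × Matter ι κ × (Fin 4 → Matter ι κ))).const_mul
    (sqrtNeg (Φ x).1)
  rw [hsum, map_add, map_sum, ← h0, Finset.sum_congr rfl fun m _ => (h1 m (ν m)).symm] at h2
  rw [← h2.deriv]
  congr 1; funext t
  rw [← hsum]; simp [jet]

/-- Linearity in the direction lets `connectionTerm` be resolved into the coordinate directions
`vectorDir`. -/
theorem matterPartial1_smul_sum (hΦ : IsConfiguration U Φ)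
    (hLM : ContDiffOn ℝ ∞ LM {p | IsLorentzian (symMet p.1)}) {I : Type*} (s : Finset I)
    (c : I → ℝ) (v : I → Matter ι κ) (m : Fin 4) {x : Pt} (hx : x ∈ U) :
    matterPartial1 LM Φ m (∑ i ∈ s, c i • v i) x = ∑ i ∈ s, c i * matterPartial1 LM Φ m (v i) x := by
  have hopen : IsOpen {p : Met × Matter ι κ × (Fin 4 → Matter ι κ) | IsLorentzian (symMet p.1)} :=
    isOpen_isLorentzian_symMet.preimage continuous_fst
  have hd : DifferentiableAt ℝ LM (matterArg Φ x) := ContDiffOn.diffAt hLM hopen (hΦ.jet_mem hx).2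
  have h1 : ∀ v, matterPartial1 LM Φ m v x
      = fderiv ℝ LM (matterArg Φ x) ((ContinuousLinearMap.inr ℝ Met (Matter ι κ × (Fin 4 → Matter ι κ)))
        (ContinuousLinearMap.inr ℝ (Matter ι κ) (Fin 4 → Matter ι κ)
          (ContinuousLinearMap.single ℝ (fun _ : Fin 4 => Matter ι κ) m v))) := by
    intro v
    rw [← (hasDerivAt_line hd _).deriv, matterPartial1]
    congr 1; funext t; congr 1
    refine Prod.ext (by simp) (Prod.ext (by simp) rfl)
  simp only [h1, map_sum, map_smul, smul_eq_mul]

/-- Smoothness is inherited from the jet partial of `matterLagrangian` on dividing by `√(-g) > 0`.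
-/
theorem smooth_matterPartial1 (hΦ : IsConfiguration U Φ) (hU : IsOpen U)
    (hLM : ContDiffOn ℝ ∞ LM {p | IsLorentzian (symMet p.1)}) (m : Fin 4) (w : Matter ι κ) :
    ContDiffOn ℝ ∞ (matterPartial1 LM Φ m w) U := by
  have h1 := contDiffOn_partial1 (contDiffOn_matterLagrangian hLM) isOpen_lorentzianJets hΦ.smooth hU
    (fun y hy => hΦ.jet_mem hy) m ((0, w) : Fields ι κ)
  have hg := hΦ.isMetric hU
  refine ((hg.smooth_sqrtNeg.inv fun y hy => (hg.sqrtNeg_pos hy).ne').mul h1).congr fun y hy => ?_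
  change _ = (sqrtNeg (Φ y).1)⁻¹ * _
  rw [partial1_matterLagrangian hΦ hU LM m w hy,
    inv_mul_cancel_left₀ (hg.sqrtNeg_pos hy).ne']

/-- The matter field equations in an arbitrary constant direction. -/
theorem eulerLagrange_matter (hΦ : IsConfiguration U Φ) (hU : IsOpen U)
    (hLM : ContDiffOn ℝ ∞ LM {p | IsLorentzian (symMet p.1)}) (G : ℝ)
    (w : Matter ι κ) {x : Pt} (hx : x ∈ U) :
    eulerLagrange (totalLagrangian G LM) Φ ((0, w) : Fields ι κ) x
      = sqrtNeg (Φ x).1 * (matterPartial0 LM Φ w x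
        + ∑ m, matterPartial1 LM Φ m (connectionTerm (fun y => (Φ y).1) w x m) x
        - ∑ m, (pd m (matterPartial1 LM Φ m w) x
          + ∑ n, christoffel (fun y => (Φ y).1) m m n x * matterPartial1 LM Φ n w x)) := by
  have hg := hΦ.isMetric hU
  rw [eulerLagrange_totalLagrangian hΦ hU hLM G _ hx, eulerLagrange_zero, mul_zero, zero_add]
  unfold eulerLagrange
  -- The derivative of `√(-g)` supplies the `Γ^k_{km}` term of the covariant divergence.
  have h1 : ∀ m, pd m (fun y => partial1 (matterLagrangian LM) m ((0, w) : Fields ι κ) (jet Φ y)) x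
      = sqrtNeg (Φ x).1 * ((∑ k, christoffel (fun y => (Φ y).1) k k m x)
          * matterPartial1 LM Φ m w x + pd m (matterPartial1 LM Φ m w) x) := by
    intro m
    rw [pd_congr_on hU (fun y hy => partial1_matterLagrangian hΦ hU LM m w hy) hx,
      pd_mul (hg.diff hg.smooth_sqrtNeg hx) (hg.diff (smooth_matterPartial1 hΦ hU hLM m w) hx),
      hg.pd_sqrtNeg_eq hΦ.symm hx]
    ring
  have h3 : ∀ n : Fin 4, pd n (fun _ : Pt => (0 : ℝ)) = fun _ => 0 := fun n =>
    funext fun y => pd_const n 0 y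
  simp only [h1, partial2_matterLagrangian, h3, partial0_matterLagrangian hΦ hU hLM w hx,
    Finset.sum_const_zero, add_zero, ← Finset.mul_sum]
  rw [← mul_sub]
  congr 2
  simp only [Finset.sum_add_distrib, Finset.sum_mul]
  rw [Finset.sum_comm, add_comm]

/-- Scalars have no connection term, so only the divergence of a vector field remains. -/
theorem eulerLagrange_scalarDir [DecidableEq ι] (hΦ : IsConfiguration U Φ) (hU : IsOpen U)
    (hLM : ContDiffOn ℝ ∞ LM {p | IsLorentzian (symMet p.1)}) (G : ℝ) (a : ι) {x : Pt}
    (hx : x ∈ U) : eulerLagrange (totalLagrangian G LM) Φ (0, scalarDir a) x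
      = sqrtNeg (Φ x).1 * scalarEq LM Φ a x := by
  rw [eulerLagrange_matter hΦ hU hLM G _ hx]
  have h0 : ∀ m, connectionTerm (fun y => (Φ y).1) (scalarDir a : Matter ι κ) x m = 0 := fun m => by
    refine Prod.ext rfl (funext fun b => funext fun al => ?_)
    simp [connectionTerm, scalarDir]
  have h1 : ∀ m, matterPartial1 LM Φ m 0 x = 0 := fun m => by
    simp [matterPartial1]
  simp only [h0, h1, Finset.sum_const_zero, add_zero]
  rfl

/-- In a covector direction the connection term is `-Γ^α_{mn}` times the directions of `u_{bn}`. It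
becomes the second Christoffel term in the divergence of a contravariant 2-tensor. -/
theorem eulerLagrange_vectorDir [DecidableEq κ] (hΦ : IsConfiguration U Φ) (hU : IsOpen U)
    (hLM : ContDiffOn ℝ ∞ LM {p | IsLorentzian (symMet p.1)}) (G : ℝ) (b : κ) (al : Fin 4) {x : Pt}
    (hx : x ∈ U) : eulerLagrange (totalLagrangian G LM) Φ (0, vectorDir b al) x
      = sqrtNeg (Φ x).1 * vectorEq LM Φ b al x := by
  rw [eulerLagrange_matter hΦ hU hLM G _ hx]
  have h0 : ∀ m, connectionTerm (fun y => (Φ y).1) (vectorDir b al : Matter ι κ) x m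
      = ∑ n, (-christoffel (fun y => (Φ y).1) al m n x) • (vectorDir b n : Matter ι κ) := fun m => by
    refine Prod.ext (by simp [connectionTerm, vectorDir, Prod.fst_sum])
      (funext fun c => funext fun n => ?_)
    rw [Prod.snd_sum, Finset.sum_apply, Finset.sum_apply]
    by_cases h : c = b
    · subst h
      simp [connectionTerm, vectorDir, Pi.single_apply]
    · simp [connectionTerm, vectorDir, h]
  simp only [h0, matterPartial1_smul_sum hΦ hLM _ _ _ _ hx]
  rw [vectorEq, divTensor]
  congr 1
  rw [add_sub_assoc, sub_eq_add_neg (matterPartial0 _ _ _ _)]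
  congr 1
  rw [← Finset.sum_sub_distrib, ← Finset.sum_neg_distrib]
  refine Finset.sum_congr rfl fun m _ => ?_
  simp only [neg_mul, Finset.sum_neg_distrib]
  ring

theorem eulerLagrange_metDir (hΦ : IsConfiguration U Φ) (hU : IsOpen U)
    (hLM : ContDiffOn ℝ ∞ LM {p | IsLorentzian (symMet p.1)}) {G : ℝ} (hG : 0 < G) (a b : Fin 4)
    {x : Pt} (hx : x ∈ U) : eulerLagrange (totalLagrangian G LM) Φ (metDir a b) x
      = sqrtNeg (Φ x).1 * (1 / (16 * Real.pi * G)) * (einstein (fun y => (Φ y).1) a b x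
        - 8 * Real.pi * G * energyMomentum LM Φ a b x) := by
  have hg := hΦ.isMetric hU
  rw [eulerLagrange_totalLagrangian hΦ hU hLM G _ hx, metDir,
    hg.eulerLagrange_hilbertDensity hΦ.symm a b hx, energyMomentum, metDir]
  have h1 := (hg.sqrtNeg_pos hx).ne'
  have h2 := Real.pi_pos.ne'
  field_simp
  ring

end MatterFields

end GR

namespace GR

open Filter Topology MeasureTheory

/-! ### Passing between the matter Lagrangian and its symmetrization -/

section Symmetrization

variable {ι κ : Type*}

/-- The matter Lagrangian evaluated at the symmetric part of the metric. -/
noncomputable def symLM (LM : Met × Matter ι κ × (Fin 4 → Matter ι κ) → ℝ) :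
    Met × Matter ι κ × (Fin 4 → Matter ι κ) → ℝ := fun p => LM (symMet p.1, p.2)

theorem symLM_apply (LM : Met × Matter ι κ × (Fin 4 → Matter ι κ) → ℝ)
    {p : Met × Matter ι κ × (Fin 4 → Matter ι κ)} (hp : ∀ a b, p.1 a b = p.1 b a) :
    symLM LM p = LM p := by
  rw [symLM, symMet_eq_self hp]

theorem totalLagrangian_symLM (G : ℝ) (LM : Met × Matter ι κ × (Fin 4 → Matter ι κ) → ℝ)
    {j : Jet (Fields ι κ)} (hj : ∀ a b, j.1.1 a b = j.1.1 b a) :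
    totalLagrangian G (symLM LM) j = totalLagrangian G LM j := by
  unfold totalLagrangian matterLagrangian
  rw [symLM_apply LM hj]

theorem matterLagrangian_symLM (LM : Met × Matter ι κ × (Fin 4 → Matter ι κ) → ℝ)
    {j : Jet (Fields ι κ)} (hj : ∀ a b, j.1.1 a b = j.1.1 b a) :
    matterLagrangian (symLM LM) j = matterLagrangian LM j := by
  unfold matterLagrangian
  rw [symLM_apply LM hj]

variable [Fintype ι] [Fintype κ]
  {LM : Met × Matter ι κ × (Fin 4 → Matter ι κ) → ℝ} {U : Set Pt} {Φ δΦ : Pt → Fields ι κ}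

/-- The Lorentzian arrays have empty interior among all arrays; composing with the symmetrization
moves smoothness to an open set, where the calculus of jets applies. -/
theorem contDiffOn_symLM (hLM : ContDiffOn ℝ ∞ LM {p | IsLorentzian p.1}) :
    ContDiffOn ℝ ∞ (symLM LM) {p | IsLorentzian (symMet p.1)} := by
  have h : ContDiff ℝ ∞ fun p : Met × Matter ι κ × (Fin 4 → Matter ι κ) => (symMet p.1, p.2) :=
    (symMet.contDiff.comp contDiff_fst).prodMk contDiff_snd
  exact hLM.comp h.contDiffOn fun p hp => hp

/-- Every line used by the Euler-Lagrange expression keeps the metric symmetric: `w.1` is symmetric,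
and the derivative directions leave the value of the metric alone. -/
theorem eulerLagrange_symLM (hΦ : IsConfiguration U Φ) (hU : IsOpen U) {w : Fields ι κ}
    (hw : ∀ a b, w.1 a b = w.1 b a) {L L' : Jet (Fields ι κ) → ℝ}
    (hL : ∀ j : Jet (Fields ι κ), (∀ a b, j.1.1 a b = j.1.1 b a) → L j = L' j)
    {x : Pt} (hx : x ∈ U) : eulerLagrange L Φ w x = eulerLagrange L' Φ w x := by
  refine eulerLagrange_congr hU (fun y hy t => hL _ fun a b => ?_)
    (fun y hy t p q => hL _ fun a b => ?_) hx
  · change (Φ y).1 a b + t * w.1 a b = (Φ y).1 b a + t * w.1 b a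
    rw [hΦ.symm y hy, hw]
  · change (Φ y).1 a b + t * 0 = (Φ y).1 b a + t * 0
    rw [hΦ.symm y hy]

theorem energyMomentum_symLM (hΦ : IsConfiguration U Φ) (hU : IsOpen U) (a b : Fin 4)
    {x : Pt} (hx : x ∈ U) : energyMomentum (symLM LM) Φ a b x = energyMomentum LM Φ a b x := by
  unfold energyMomentum
  rw [eulerLagrange_symLM hΦ hU (w := metDir a b) (fun i j => symUnit_symm a b i j)
    (fun j hj => matterLagrangian_symLM LM hj) hx]

theorem matterPartial0_symLM (hΦ : IsConfiguration U Φ) (w : Matter ι κ) {x : Pt} (hx : x ∈ U) :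
    matterPartial0 (symLM LM) Φ w x = matterPartial0 LM Φ w x := by
  unfold matterPartial0
  congr 1; funext t
  exact symLM_apply LM (hΦ.symm x hx)

theorem matterPartial1_symLM (hΦ : IsConfiguration U Φ) (m : Fin 4) (w : Matter ι κ) {x : Pt}
    (hx : x ∈ U) : matterPartial1 (symLM LM) Φ m w x = matterPartial1 LM Φ m w x := by
  unfold matterPartial1
  congr 1; funext t
  exact symLM_apply LM (hΦ.symm x hx)

theorem scalarEq_symLM [DecidableEq ι] (hΦ : IsConfiguration U Φ) (hU : IsOpen U) (a : ι) {x : Pt}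
    (hx : x ∈ U) : scalarEq (symLM LM) Φ a x = scalarEq LM Φ a x := by
  simp only [scalarEq, divVector, matterPartial0_symLM hΦ _ hx, matterPartial1_symLM hΦ _ _ hx,
    pd_congr_on hU (fun y hy => matterPartial1_symLM hΦ _ _ hy) hx]

theorem vectorEq_symLM [DecidableEq κ] (hΦ : IsConfiguration U Φ) (hU : IsOpen U) (b : κ)
    (al : Fin 4) {x : Pt} (hx : x ∈ U) : vectorEq (symLM LM) Φ b al x = vectorEq LM Φ b al x := by
  simp only [vectorEq, divTensor, matterPartial0_symLM hΦ _ hx, matterPartial1_symLM hΦ _ _ hx,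
    pd_congr_on hU (fun y hy => matterPartial1_symLM hΦ _ _ hy) hx]

end Symmetrization

/-! ### The first variation of the action and stationarity -/

section ActionPrinciple

variable {ι κ : Type*} [Fintype ι] [Fintype κ]
  {LM : Met × Matter ι κ × (Fin 4 → Matter ι κ) → ℝ} {U Ω : Set Pt} {Φ δΦ : Pt → Fields ι κ}

theorem IsConfiguration.perturb (hΦ : IsConfiguration U Φ) (hU : IsOpen U)
    (hδ : ContDiffOn ℝ ∞ δΦ U) (hs : ∀ x ∈ U, ∀ a b, (δΦ x).1 a b = (δΦ x).1 b a) (ε : ℝ) :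
    IsOpen {y | y ∈ U ∧ IsLorentzian (symMet (Φ y + ε • δΦ y).1)} ∧
    IsConfiguration {y | y ∈ U ∧ IsLorentzian (symMet (Φ y + ε • δΦ y).1)}
      (fun y => Φ y + ε • δΦ y) := by
  have hsm : ContDiffOn ℝ ∞ (fun y => Φ y + ε • δΦ y) U := hΦ.smooth.add (hδ.const_smul ε)
  refine ⟨hsm.fst.continuousOn.isOpen_inter_preimage hU isOpen_isLorentzian_symMet,
    hsm.mono fun y hy => hy.1, fun y hy => ?_⟩
  have h := hy.2
  rwa [symMet_eq_self fun a b => ?_] at h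
  simp [hΦ.symm y hy.1 a b, hs y hy.1 a b]

/-- The action is defined geometrically, so rewriting it in jets requires `Φ + ε δΦ` to be again a
configuration near each point of `Ω`; `hε` provides this. -/
theorem action_eq (hU : IsOpen U) (hΦ : IsConfiguration U Φ)
    (G : ℝ) (hΩ : IsRegion U Ω) (hδ : IsVariation U Ω δΦ) {ε : ℝ}
    (hε : ∀ x ∈ closure Ω, jet Φ x + ε • jet δΦ x ∈ lorentzianJets ι κ) :
    action G LM Ω (fun x => Φ x + ε • δΦ x) =
      ∫ x in Ω, totalLagrangian G (symLM LM) (jet Φ x + ε • jet δΦ x) := by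
  refine setIntegral_congr_fun hΩ.isOpen.measurableSet fun x hx => ?_
  obtain ⟨hVo, hV⟩ := hΦ.perturb hU hδ.smooth hδ.symm ε
  have hx' : x ∈ {y | y ∈ U ∧ IsLorentzian (symMet (Φ y + ε • δΦ y).1)} :=
    ⟨hΩ.subset' hx, (hε x (subset_closure hx)).2⟩
  have hj := jet_add_smul hΦ.smooth hδ.smooth hU hx'.1 ε
  change _ = totalLagrangian G (symLM LM) (jet Φ x + ε • jet δΦ x)
  rw [← hj, totalLagrangian_symLM G LM (hV.symm x hx'), totalLagrangian,
    hV.gravLagrangian_jet hVo hx' G, hV.matterLagrangian_jet hVo hx' LM]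
  rw [mul_add]

theorem hasDerivAt_action (hU : IsOpen U) (hΦ : IsConfiguration U Φ)
    (hLM : ContDiffOn ℝ ∞ LM {p | IsLorentzian p.1}) (G : ℝ) (hΩ : IsRegion U Ω)
    (hδ : IsVariation U Ω δΦ) :
    HasDerivAt (fun ε : ℝ => action G LM Ω (fun x => Φ x + ε • δΦ x))
      (∫ x in Ω, fderiv ℝ (totalLagrangian G (symLM LM)) (jet Φ x) (jet δΦ x)) 0 :=
  hasDerivAt_of_eq_integral_jet (contDiffOn_totalLagrangian G (contDiffOn_symLM hLM))
    isOpen_lorentzianJets hΦ.smooth hδ.smooth hU (fun _ hy => hΦ.jet_mem hy) hΩ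
    fun _ hε => action_eq hU hΦ G hΩ hδ hε

/-- The components of a field value. -/
def fieldComponent (v : Fields ι κ) : (Fin 4 × Fin 4) ⊕ ι ⊕ (κ × Fin 4) → ℝ :=
  Sum.elim (fun p => v.1 p.1 p.2) (Sum.elim (fun a => v.2.1 a) fun p => v.2.2 p.1 p.2)

theorem contDiff_fieldComponent (i : (Fin 4 × Fin 4) ⊕ ι ⊕ (κ × Fin 4)) :
    ContDiff ℝ ∞ fun v : Fields ι κ => fieldComponent v i := by
  rcases i with p | a | p <;> simp only [fieldComponent, Sum.elim_inl, Sum.elim_inr] <;> fun_prop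

variable [DecidableEq ι] [DecidableEq κ]

/-- The directions of all field components. -/
noncomputable def fieldDir (ι κ : Type*) [DecidableEq ι] [DecidableEq κ] :
    (Fin 4 × Fin 4) ⊕ ι ⊕ (κ × Fin 4) → Fields ι κ :=
  Sum.elim (fun p => metDir p.1 p.2)
    (Sum.elim (fun a => (0, scalarDir a)) fun p => (0, vectorDir p.1 p.2))

/-- The sum over ordered pairs meets each off-diagonal metric direction twice, and the factor `1/2`
in `symUnit` compensates; this is where symmetry of `v.1` is needed. -/
theorem sum_fieldComponent (v : Fields ι κ) (hv : ∀ a b, v.1 a b = v.1 b a) :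
    v = ∑ i, fieldComponent v i • fieldDir ι κ i := by
  simp only [Fintype.sum_sum_type, Fintype.sum_prod_type, fieldComponent, fieldDir, Sum.elim_inl,
    Sum.elim_inr]
  refine Prod.ext ?_ (Prod.ext ?_ ?_)
  · funext i j
    have h := sum_mul_symUnit v.1 i j
    have e : ∀ a b, symUnit a b i j = symUnit i j a b := fun a b => by
      unfold symUnit
      simp only [@eq_comm _ a i, @eq_comm _ b j, @eq_comm _ a j, @eq_comm _ b i, and_comm (a := j = a)]
    simp only [metDir, Prod.fst_add, Prod.fst_sum, Prod.smul_fst, smul_zero,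
      Finset.sum_const_zero, add_zero, Finset.sum_apply, Pi.smul_apply, smul_eq_mul, e, h,
      hv j i]
    ring
  · funext a
    simp [metDir, scalarDir, vectorDir, Prod.fst_sum, Prod.snd_sum, Pi.single_apply]
  · funext b al
    simp only [metDir, scalarDir, vectorDir, Prod.snd_add, Prod.snd_sum, Prod.smul_snd, smul_zero,
      Finset.sum_const_zero, zero_add, Finset.sum_apply, Pi.smul_apply]
    rw [Finset.sum_eq_single b (fun c _ hc => by simp [hc.symm]) (by simp)]
    simp [Pi.single_apply]

theorem integral_first_variation (hU : IsOpen U) (hΦ : IsConfiguration U Φ)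
    (hLM : ContDiffOn ℝ ∞ LM {p | IsLorentzian (symMet p.1)}) (G : ℝ) (hΩ : IsRegion U Ω)
    (hδ : IsVariation U Ω δΦ) :
    ∫ x in Ω, fderiv ℝ (totalLagrangian G LM) (jet Φ x) (jet δΦ x)
      = ∫ x in Ω, ∑ i, eulerLagrange (totalLagrangian G LM) Φ (fieldDir ι κ i) x
        * fieldComponent (δΦ x) i := by
  refine integral_fderiv_jet_sum (contDiffOn_totalLagrangian G hLM) isOpen_lorentzianJets
    hΦ.smooth hU (fun _ hy => hΦ.jet_mem hy) (c := fun i x => fieldComponent (δΦ x) i)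
    (fun i => (contDiff_fieldComponent i).comp_contDiffOn hδ.smooth) hΩ
    (fun x hx => sum_fieldComponent _ (hδ.symm x hx)) (fun i x hx => ?_) fun i x hx m n => ?_
  · rcases i with p | a | p <;> simp [fieldComponent, hδ.boundary x hx]
  · have hxU : x ∈ U := hΩ.subset (frontier_subset_closure hx)
    -- Metric components use the boundary condition on `∂δg`; for matter components `partial2` is
    -- already zero.
    rcases i with p | a | p
    · have h : pd n (fun y => (δΦ y).1 p.1 p.2) x = 0 := by
        rw [pd_apply (ContDiffOn.diffAt hδ.smooth.fst hU hxU), hδ.boundary_deriv x hx n]; rfl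
      exact mul_eq_zero_of_right _ h
    · exact mul_eq_zero_of_left (partial2_totalLagrangian G LM m n _ _) _
    · exact mul_eq_zero_of_left (partial2_totalLagrangian G LM m n _ _) _

theorem eulerLagrange_fieldDir_symLM (hΦ : IsConfiguration U Φ) (hU : IsOpen U) (G : ℝ)
    (i : (Fin 4 × Fin 4) ⊕ ι ⊕ (κ × Fin 4)) {x : Pt} (hx : x ∈ U) :
    eulerLagrange (totalLagrangian G (symLM LM)) Φ (fieldDir ι κ i) x
      = eulerLagrange (totalLagrangian G LM) Φ (fieldDir ι κ i) x := by
  refine eulerLagrange_symLM hΦ hU (fun a b => ?_) (fun j hj => totalLagrangian_symLM G LM hj) hx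
  rcases i with p | c | p
  · exact symUnit_symm _ _ a b
  · rfl
  · rfl

/-- The first variation of the action. -/
theorem hasDerivAt_action_eulerLagrange (hU : IsOpen U) (hΦ : IsConfiguration U Φ)
    (hLM : ContDiffOn ℝ ∞ LM {p | IsLorentzian p.1}) (G : ℝ) (hΩ : IsRegion U Ω)
    (hδ : IsVariation U Ω δΦ) :
    HasDerivAt (fun ε : ℝ => action G LM Ω (fun x => Φ x + ε • δΦ x))
      (∫ x in Ω, ∑ i, eulerLagrange (totalLagrangian G LM) Φ (fieldDir ι κ i) x
        * fieldComponent (δΦ x) i) 0 := by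
  have h := hasDerivAt_action hU hΦ hLM G hΩ hδ
  rw [integral_first_variation hU hΦ (contDiffOn_symLM hLM) G hΩ hδ,
    setIntegral_congr_fun hΩ.isOpen.measurableSet fun x hx => Finset.sum_congr rfl fun i _ => by
      rw [eulerLagrange_fieldDir_symLM hΦ hU G i (hΩ.subset' hx)]] at h
  exact h

/-- The action is stationary under the variations with values in `K` if and only if the
Euler-Lagrange expressions of the components spanning `K` vanish. -/
theorem stationaryAction_iff (hU : IsOpen U) (hΦ : IsConfiguration U Φ)
    (hLM : ContDiffOn ℝ ∞ LM {p | IsLorentzian p.1}) (G : ℝ) {K : Set (Fields ι κ)}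
    {S : Set ((Fin 4 × Fin 4) ⊕ ι ⊕ (κ × Fin 4))}
    (hSK : ∀ i ∈ S, ∀ c : ℝ, c • fieldDir ι κ i ∈ K)
    (hKS : ∀ v ∈ K, ∀ i ∉ S, fieldComponent v i = 0) :
    StationaryAction G LM U Φ K ↔
      ∀ x ∈ U, ∀ i ∈ S, eulerLagrange (totalLagrangian G LM) Φ (fieldDir ι κ i) x = 0 := by
  have hLM' := contDiffOn_symLM hLM
  have hsL := contDiffOn_totalLagrangian G hLM'
  constructor
  · intro hst x hx i hi
    rw [← eulerLagrange_fieldDir_symLM hΦ hU G i hx]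
    refine eq_zero_of_integral_mul_eq_zero hU (contDiffOn_eulerLagrange hsL isOpen_lorentzianJets
      hΦ.smooth hU (fun _ hy => hΦ.jet_mem hy) _).continuousOn (fun c Ω hc hΩ hcΩ => ?_) x hx
    have hout : ∀ y ∈ frontier Ω, ∀ᶠ z in 𝓝 y, c z = 0 := by
      intro y hy
      have : y ∉ tsupport c := fun h => by
        rw [hΩ.isOpen.frontier_eq] at hy; exact hy.2 (hcΩ h)
      exact notMem_tsupport_iff_eventuallyEq.1 this
    -- A test function supported inside `Ω` vanishes near the frontier, so `c • e_i` is admissible;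
    -- `hSK` keeps its values in `K`.
    have hδ : IsVariation U Ω fun y => c y • fieldDir ι κ i := by
      refine ⟨hc.contDiffOn.smul contDiffOn_const, fun y _ a b => ?_, fun y hy => ?_,
        fun y hy m => ?_⟩
      · rcases i with p | d | p
        · exact congrArg (c y * ·) (symUnit_symm _ _ a b)
        · rfl
        · rfl
      · rw [(hout y hy).self_of_nhds, zero_smul]
      · refine (pd_congr (g := fun _ => 0) ((hout y hy).mono fun z hz => ?_) m).trans
          (pd_const m _ y)
        simp [hz]
    rw [← integral_fderiv_jet_smul_const hsL isOpen_lorentzianJets hΦ.smooth hU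
      (fun _ hy => hΦ.jet_mem hy) (fieldDir ι κ i) hc.contDiffOn hΩ
      (fun y hy => (hout y hy).self_of_nhds) fun y hy m n =>
        mul_eq_zero_of_right _ ((pd_congr (hout y hy) n).trans (pd_const n 0 y))]
    exact (hasDerivAt_action hU hΦ hLM G hΩ hδ).unique
      (hst Ω _ hΩ hδ fun y => hSK i hi (c y))
  · intro hEL Ω δΦ hΩ hδ hK
    refine (hasDerivAt_action_eulerLagrange hU hΦ hLM G hΩ hδ).congr_deriv ?_
    refine setIntegral_eq_zero_of_forall_eq_zero fun x hx => Finset.sum_eq_zero fun i _ => ?_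
    by_cases hi : i ∈ S
    · rw [hEL x (hΩ.subset' hx) i hi, zero_mul]
    · rw [hKS _ (hK x) i hi, mul_zero]

end ActionPrinciple

end GR

namespace GR

section FieldDir

variable {ι κ : Type*} [DecidableEq ι] [DecidableEq κ]

theorem fieldDir_metric (a b : Fin 4) : fieldDir ι κ (Sum.inl (a, b)) = metDir a b := rfl

theorem fieldDir_scalar (a : ι) : fieldDir ι κ (Sum.inr (Sum.inl a)) = (0, scalarDir a) := rfl

theorem fieldDir_vector (b : κ) (al : Fin 4) :
    fieldDir ι κ (Sum.inr (Sum.inr (b, al))) = (0, vectorDir b al) := rfl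

end FieldDir

/-! ### Field equations for the original matter Lagrangian -/

section FieldEquations

variable {ι κ : Type*} [Fintype ι] [Fintype κ] [DecidableEq ι] [DecidableEq κ]
  {LM : Met × Matter ι κ × (Fin 4 → Matter ι κ) → ℝ} {U : Set Pt} {Φ : Pt → Fields ι κ} {G : ℝ}

/-- The formula is known for `symLM LM`, and neither side changes on passing back to `LM`. The same
argument serves the vector and metric directions. -/
theorem eulerLagrange_scalarDir_eq (hU : IsOpen U) (hΦ : IsConfiguration U Φ)
    (hLM : ContDiffOn ℝ ∞ LM {p | IsLorentzian p.1}) (G : ℝ) (a : ι) {x : Pt} (hx : x ∈ U) :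
    eulerLagrange (totalLagrangian G LM) Φ (0, scalarDir a) x =
      sqrtNeg (Φ x).1 * scalarEq LM Φ a x := by
  rw [← scalarEq_symLM hΦ hU a hx,
    ← eulerLagrange_scalarDir hΦ hU (contDiffOn_symLM hLM) G a hx]
  exact (eulerLagrange_fieldDir_symLM hΦ hU G (Sum.inr (Sum.inl a)) hx).symm

theorem eulerLagrange_vectorDir_eq (hU : IsOpen U) (hΦ : IsConfiguration U Φ)
    (hLM : ContDiffOn ℝ ∞ LM {p | IsLorentzian p.1}) (G : ℝ) (b : κ) (al : Fin 4) {x : Pt}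
    (hx : x ∈ U) :
    eulerLagrange (totalLagrangian G LM) Φ (0, vectorDir b al) x =
      sqrtNeg (Φ x).1 * vectorEq LM Φ b al x := by
  rw [← vectorEq_symLM hΦ hU b al hx,
    ← eulerLagrange_vectorDir hΦ hU (contDiffOn_symLM hLM) G b al hx]
  exact (eulerLagrange_fieldDir_symLM hΦ hU G (Sum.inr (Sum.inr (b, al))) hx).symm

theorem eulerLagrange_metDir_eq (hU : IsOpen U) (hΦ : IsConfiguration U Φ)
    (hLM : ContDiffOn ℝ ∞ LM {p | IsLorentzian p.1}) (hG : 0 < G) (a b : Fin 4) {x : Pt}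
    (hx : x ∈ U) :
    eulerLagrange (totalLagrangian G LM) Φ (metDir a b) x =
      sqrtNeg (Φ x).1 * (1 / (16 * Real.pi * G)) *
        (einstein (fun y => (Φ y).1) a b x - 8 * Real.pi * G * energyMomentum LM Φ a b x) := by
  rw [← energyMomentum_symLM hΦ hU a b hx,
    ← eulerLagrange_metDir hΦ hU (contDiffOn_symLM hLM) hG a b hx]
  exact (eulerLagrange_fieldDir_symLM hΦ hU G (Sum.inl (a, b)) hx).symm

theorem eulerLagrange_fieldDir_scalar_eq_zero_iff (hU : IsOpen U) (hΦ : IsConfiguration U Φ)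
    (hLM : ContDiffOn ℝ ∞ LM {p | IsLorentzian p.1}) (G : ℝ) (a : ι) {x : Pt} (hx : x ∈ U) :
    eulerLagrange (totalLagrangian G LM) Φ (fieldDir ι κ (Sum.inr (Sum.inl a))) x = 0 ↔
      scalarEq LM Φ a x = 0 := by
  rw [fieldDir_scalar, eulerLagrange_scalarDir_eq hU hΦ hLM G a hx, mul_eq_zero,
    or_iff_right ((hΦ.isMetric hU).sqrtNeg_pos hx).ne']

theorem eulerLagrange_fieldDir_vector_eq_zero_iff (hU : IsOpen U) (hΦ : IsConfiguration U Φ)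
    (hLM : ContDiffOn ℝ ∞ LM {p | IsLorentzian p.1}) (G : ℝ) (b : κ) (al : Fin 4) {x : Pt}
    (hx : x ∈ U) :
    eulerLagrange (totalLagrangian G LM) Φ (fieldDir ι κ (Sum.inr (Sum.inr (b, al)))) x = 0 ↔
      vectorEq LM Φ b al x = 0 := by
  rw [fieldDir_vector, eulerLagrange_vectorDir_eq hU hΦ hLM G b al hx, mul_eq_zero,
    or_iff_right ((hΦ.isMetric hU).sqrtNeg_pos hx).ne']

theorem eulerLagrange_fieldDir_metric_eq_zero_iff (hU : IsOpen U) (hΦ : IsConfiguration U Φ)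
    (hLM : ContDiffOn ℝ ∞ LM {p | IsLorentzian p.1}) (hG : 0 < G) (a b : Fin 4) {x : Pt}
    (hx : x ∈ U) :
    eulerLagrange (totalLagrangian G LM) Φ (fieldDir ι κ (Sum.inl (a, b))) x = 0 ↔
      einstein (fun y => (Φ y).1) a b x = 8 * Real.pi * G * energyMomentum LM Φ a b x := by
  have hc : 1 / (16 * Real.pi * G) ≠ 0 := by have := Real.pi_pos; positivity
  rw [fieldDir_metric, eulerLagrange_metDir_eq hU hΦ hLM hG a b hx, mul_eq_zero,
    or_iff_right (mul_ne_zero ((hΦ.isMetric hU).sqrtNeg_pos hx).ne' hc), sub_eq_zero]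

theorem stationaryAction_metric_iff (hU : IsOpen U) (hΦ : IsConfiguration U Φ)
    (hLM : ContDiffOn ℝ ∞ LM {p | IsLorentzian p.1}) (hG : 0 < G) :
    StationaryAction G LM U Φ {v | v.2 = 0} ↔
      ∀ x ∈ U, ∀ a b, einstein (fun y => (Φ y).1) a b x =
        8 * Real.pi * G * energyMomentum LM Φ a b x := by
  have h := fun hSK hKS => stationaryAction_iff hU hΦ hLM G (K := {v | v.2 = 0})
    (S := Set.range Sum.inl) hSK hKS
  refine (h ?_ ?_).trans ?_
  · rintro _ ⟨p, rfl⟩ c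
    exact smul_zero c
  · rintro v hv (p | a | p) hi
    · exact absurd ⟨p, rfl⟩ hi
    · exact congrFun (congrArg Prod.fst hv) a
    · exact congrFun (congrFun (congrArg Prod.snd hv) p.1) p.2
  · refine forall₂_congr fun x hx => ⟨fun h a b => ?_, ?_⟩
    · exact (eulerLagrange_fieldDir_metric_eq_zero_iff hU hΦ hLM hG a b hx).1 (h _ ⟨(a, b), rfl⟩)
    · rintro h _ ⟨p, rfl⟩
      exact (eulerLagrange_fieldDir_metric_eq_zero_iff hU hΦ hLM hG p.1 p.2 hx).2 (h p.1 p.2)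

theorem stationaryAction_matter_iff (hU : IsOpen U) (hΦ : IsConfiguration U Φ)
    (hLM : ContDiffOn ℝ ∞ LM {p | IsLorentzian p.1}) (G : ℝ) :
    StationaryAction G LM U Φ {v | v.1 = 0} ↔
      ∀ x ∈ U, (∀ a, scalarEq LM Φ a x = 0) ∧ (∀ b al, vectorEq LM Φ b al x = 0) := by
  have h := fun hSK hKS => stationaryAction_iff hU hΦ hLM G (K := {v | v.1 = 0})
    (S := Set.range Sum.inr) hSK hKS
  refine (h ?_ ?_).trans ?_
  · rintro _ ⟨a | p, rfl⟩ c
    · exact smul_zero c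
    · exact smul_zero c
  · rintro v hv (p | q) hi
    · exact congrFun (congrFun hv p.1) p.2
    · exact absurd ⟨q, rfl⟩ hi
  · refine forall₂_congr fun x hx => ⟨fun h => ⟨fun a => ?_, fun b al => ?_⟩, ?_⟩
    · exact (eulerLagrange_fieldDir_scalar_eq_zero_iff hU hΦ hLM G a hx).1 (h _ ⟨Sum.inl a, rfl⟩)
    · exact (eulerLagrange_fieldDir_vector_eq_zero_iff hU hΦ hLM G b al hx).1
        (h _ ⟨Sum.inr (b, al), rfl⟩)
    · rintro h _ ⟨a | p, rfl⟩
      · exact (eulerLagrange_fieldDir_scalar_eq_zero_iff hU hΦ hLM G a hx).2 (h.1 a)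
      · exact (eulerLagrange_fieldDir_vector_eq_zero_iff hU hΦ hLM G p.1 p.2 hx).2 (h.2 p.1 p.2)

theorem stationaryAction_univ_iff (hU : IsOpen U) (hΦ : IsConfiguration U Φ)
    (hLM : ContDiffOn ℝ ∞ LM {p | IsLorentzian p.1}) (hG : 0 < G) :
    StationaryAction G LM U Φ Set.univ ↔
      ∀ x ∈ U, (∀ a, scalarEq LM Φ a x = 0) ∧ (∀ b al, vectorEq LM Φ b al x = 0) ∧
        ∀ a b, einstein (fun y => (Φ y).1) a b x =
          8 * Real.pi * G * energyMomentum LM Φ a b x := by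
  refine (stationaryAction_iff hU hΦ hLM G (S := Set.univ) (fun _ _ _ => Set.mem_univ _)
    (fun _ _ i hi => absurd (Set.mem_univ i) hi)).trans ?_
  refine forall₂_congr fun x hx => ⟨fun h => ⟨fun a => ?_, fun b al => ?_, fun a b => ?_⟩, ?_⟩
  · exact (eulerLagrange_fieldDir_scalar_eq_zero_iff hU hΦ hLM G a hx).1 (h _ (Set.mem_univ _))
  · exact (eulerLagrange_fieldDir_vector_eq_zero_iff hU hΦ hLM G b al hx).1 (h _ (Set.mem_univ _))
  · exact (eulerLagrange_fieldDir_metric_eq_zero_iff hU hΦ hLM hG a b hx).1 (h _ (Set.mem_univ _))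
  · rintro h (p | a | p) -
    · exact (eulerLagrange_fieldDir_metric_eq_zero_iff hU hΦ hLM hG p.1 p.2 hx).2
        (h.2.2 p.1 p.2)
    · exact (eulerLagrange_fieldDir_scalar_eq_zero_iff hU hΦ hLM G a hx).2 (h.1 a)
    · exact (eulerLagrange_fieldDir_vector_eq_zero_iff hU hΦ hLM G p.1 p.2 hx).2
        (h.2.1 p.1 p.2)

end FieldEquations

end GR

theorem mainTheorem4 {ι κ : Type*} [Fintype ι] [DecidableEq ι] [Fintype κ] [DecidableEq κ]
    (G : ℝ) (hG : 0 < G)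
    (LM : Met × Matter ι κ × (Fin 4 → Matter ι κ) → ℝ)
    (hLM : ContDiffOn ℝ ∞ LM {p | IsLorentzian p.1})
    (U : Set Pt) (hU : IsOpen U)
    (Φ : Pt → Fields ι κ) (hΦ : IsConfiguration U Φ) :
    -- `R`, `L_G`, `L_M`, as functions of the fields and their derivatives, are the geometric ones
    (∀ x ∈ U,
      scalarJet (jet (fun y => (Φ y).1) x) = scalarCurvature (fun y => (Φ y).1) x ∧
      gravLagrangian G (jet Φ x) = sqrtNeg (Φ x).1 *
        (1 / (16 * Real.pi * G) * scalarCurvature (fun y => (Φ y).1) x) ∧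
      matterLagrangian LM (jet Φ x) = sqrtNeg (Φ x).1 * LM (matterArg Φ x)) ∧
    -- the first variation of the action
    (∀ (Ω : Set Pt) (δΦ : Pt → Fields ι κ), IsRegion U Ω → IsVariation U Ω δΦ →
      HasDerivAt (fun ε : ℝ => action G LM Ω (fun x => Φ x + ε • δΦ x))
        (∫ x in Ω,
          ((∑ a, ∑ b, eulerLagrange (totalLagrangian G LM) Φ (metDir a b) x * (δΦ x).1 a b)
          + (∑ a, eulerLagrange (totalLagrangian G LM) Φ (0, scalarDir a) x * (δΦ x).2.1 a)
          + ∑ b, ∑ al,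
              eulerLagrange (totalLagrangian G LM) Φ (0, vectorDir b al) x * (δΦ x).2.2 b al)) 0) ∧
    -- the algebraic identity
    (∀ x ∈ U, ∀ a b, identityExpr (fun y => (Φ y).1) a b x = 0) ∧
    -- the functional derivatives with respect to the scalars, the vectors and the metric
    (∀ x ∈ U,
      (∀ a, eulerLagrange (totalLagrangian G LM) Φ (0, scalarDir a) x =
        sqrtNeg (Φ x).1 * scalarEq LM Φ a x) ∧
      (∀ b al, eulerLagrange (totalLagrangian G LM) Φ (0, vectorDir b al) x =
        sqrtNeg (Φ x).1 * vectorEq LM Φ b al x) ∧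
      (∀ a b, eulerLagrange (totalLagrangian G LM) Φ (metDir a b) x =
        sqrtNeg (Φ x).1 * (1 / (16 * Real.pi * G)) *
          (einstein (fun y => (Φ y).1) a b x - 8 * Real.pi * G * energyMomentum LM Φ a b x))) ∧
    -- stationarity under variations of the metric alone
    (StationaryAction G LM U Φ {v | v.2 = 0} ↔
      ∀ x ∈ U, ∀ a b, einstein (fun y => (Φ y).1) a b x =
        8 * Real.pi * G * energyMomentum LM Φ a b x) ∧
    -- stationarity under variations of the matter field alone
    (StationaryAction G LM U Φ {v | v.1 = 0} ↔
      ∀ x ∈ U, (∀ a, scalarEq LM Φ a x = 0) ∧ (∀ b al, vectorEq LM Φ b al x = 0)) ∧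
    -- stationarity under all variations
    (StationaryAction G LM U Φ Set.univ ↔
      ∀ x ∈ U, (∀ a, scalarEq LM Φ a x = 0) ∧ (∀ b al, vectorEq LM Φ b al x = 0) ∧
        ∀ a b, einstein (fun y => (Φ y).1) a b x =
          8 * Real.pi * G * energyMomentum LM Φ a b x) := by
  refine ⟨fun x hx => ⟨hΦ.scalarJet_eq hU hx, hΦ.gravLagrangian_jet hU hx G,
    hΦ.matterLagrangian_jet hU hx LM⟩, fun Ω δΦ hΩ hδ => ?_,
    fun x hx a b => (hΦ.isMetric hU).identityExpr_eq_zero hΦ.symm hx a b,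
    fun x hx => ⟨fun a => eulerLagrange_scalarDir_eq hU hΦ hLM G a hx,
      fun b al => eulerLagrange_vectorDir_eq hU hΦ hLM G b al hx,
      fun a b => eulerLagrange_metDir_eq hU hΦ hLM hG a b hx⟩,
    stationaryAction_metric_iff hU hΦ hLM hG, stationaryAction_matter_iff hU hΦ hLM G,
    stationaryAction_univ_iff hU hΦ hLM hG⟩
  refine (hasDerivAt_action_eulerLagrange hU hΦ hLM G hΩ hδ).congr_deriv ?_
  simp only [Fintype.sum_sum_type, Fintype.sum_prod_type, fieldComponent, fieldDir, Sum.elim_inl,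
    Sum.elim_inr, add_assoc]
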